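/- Let $\Sigma$ be a compact smooth $3$-dimensional manifold (Hausdorff, without boundary) with a Riemannian metric $h$ of regularity $C^{1,1}$ (i.e. with continuously differentiable components in charts whose first derivatives are locally Lipschitz; this includes every metric of H\"older or Zygmund class $C^\tau$, $\tau>2$), let $m>0$, and let $M=\mathbb R\times\Sigma$ carry the ultrastatic Lorentzian metric $dt^2-h$. Let $A=-\Delta_h+m^2$ be the self-adjoint operator on $L^2(\Sigma,\sqrt h\,dx)$ defined by the closure of the form $\int_\Sigma (h^{ij}\,\overline{\partial_i f}\,\partial_j g+m^2\bar f g)\sqrt h\,dx$ on $C^\infty(\Sigma)$. Let $K_G\in\mathcal D'(M\times M)$ be the kernel of the causal propagator $G=-A^{-1/2}\sin(A^{1/2}(t-s))$ of the Klein--Gordon operator $\partial_t^2+A$, that is, for $w\in C_c^\infty(M\times M)$, $$K_G(w)=-\sum_k\int_{\mathbb R}\int_{\mathbb R}\int_\Sigma\int_\Sigma \bigl(A^{-1/2}\sin(A^{1/2}(t-s))\,b_k\bigr)(x)\,\overline{b_k(y)}\,w(t,x;s,y)\,\sqrt{h(y)}\,dy\,\sqrt{h(x)}\,dx\,ds\,dt,$$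 where $(b_k)$ is an orthonormal basis of $L^2(\Sigma,\sqrt h\,dx)$ (any one); for real eigenfunctions $b_k=\phi_k$, $A\phi_k=\lambda_k^2\phi_k$ with $\lambda_k>0$, this is the kernel $-\sum_k\lambda_k^{-1}\sin(\lambda_k(t-s))\phi_k(x)\phi_k(y)$. For $\tilde y\in M$ let $J(\tilde y)=J^+(\tilde y)\cup J^-(\tilde y)$, where $J^{+}(\tilde y)$ (resp. $J^-(\tilde y)$) consists of $\tilde y$ and of all points that can be reached from $\tilde y$ (resp. from which $\tilde y$ can be reached) by a future directed causal curve, i.e. a locally Lipschitz curve whose velocity is almost everywhere causal and future directed. If $\tilde x,\tilde y\in M$ are not causally related, i.e. $\tilde x\notin J(\tilde y)$, then $(\tilde x,\tilde y)\notin\operatorname{supp}K_G$; that is, $(\tilde x,\tilde y)$ has an open neighbourhood $W$ in $M\times M$ such that $K_G(w)=0$ for every $w\in C_c^\infty(M\times M)$ with support in $W$. -/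

import Mathlib

open MeasureTheory Set Filter Topology Bundle
open scoped Manifold ContDiff ComplexConjugate

noncomputable section

namespace Ultrastatic

/-- The model space `ℝ³` of the spatial slices. -/
abbrev E3 : Type := EuclideanSpace ℝ (Fin 3)

/-- The standard basis of `ℝ³`. -/
abbrev e3 (i : Fin 3) : E3 := EuclideanSpace.single i 1

section LinearAlgebra

/-- The form `h^{ij} conj(αᵢ) βⱼ` for the inverse `h^{ij}` of a matrix. -/
def invForm (H : Matrix (Fin 3) (Fin 3) ℝ) (a b : Fin 3 → ℂ) : ℂ :=
  ∑ i, ∑ j, ((H⁻¹ i j : ℝ) : ℂ) * conj (a i) * b j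

theorem invForm_eq (H : Matrix (Fin 3) (Fin 3) ℝ) (a b : Fin 3 → ℂ) :
    invForm H a b = (star a) ⬝ᵥ (((H⁻¹).map Complex.ofRealHom).mulVec b) := by
  simp only [invForm, dotProduct, Matrix.mulVec, Matrix.map_apply, Finset.mul_sum]
  refine Finset.sum_congr rfl fun i _ => Finset.sum_congr rfl fun j _ => ?_
  simp only [Complex.ofRealHom_eq_coe, Pi.star_apply, RCLike.star_def]
  ring

theorem invForm_congr (H Q : Matrix (Fin 3) (Fin 3) ℝ) (hQ : IsUnit Q.det) (a b : Fin 3 → ℂ) :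
    invForm (Q.transpose * H * Q) ((Q.map Complex.ofRealHom).transpose.mulVec a)
      ((Q.map Complex.ofRealHom).transpose.mulVec b) = invForm H a b := by
  have hQ' : IsUnit (Q.map Complex.ofRealHom).det := by
    rw [← RingHom.mapMatrix_apply, ← RingHom.map_det]; exact hQ.map _
  have h1 : Q * (Q.transpose * H * Q)⁻¹ * Q.transpose = H⁻¹ := by
    rw [Matrix.mul_inv_rev, Matrix.mul_inv_rev, ← Matrix.mul_assoc, Matrix.mul_nonsing_inv _ hQ,
      Matrix.one_mul, Matrix.mul_assoc, Matrix.nonsing_inv_mul _ (by rwa [Matrix.det_transpose]),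
      Matrix.mul_one]
  have h2 : star ((Q.map Complex.ofRealHom).transpose.mulVec a)
      = Matrix.vecMul (star a) (Q.map Complex.ofRealHom) := by
    rw [Matrix.star_mulVec]
    congr 1
    ext i j
    simp [Matrix.conjTranspose]
  rw [invForm_eq, invForm_eq, h2, ← Matrix.dotProduct_mulVec, Matrix.mulVec_mulVec,
    Matrix.mulVec_mulVec, ← h1]
  simp only [Matrix.map_mul, Matrix.transpose_map, Matrix.mul_assoc]

theorem invForm_symm {H : Matrix (Fin 3) (Fin 3) ℝ} (hH : H.PosDef) (a b : Fin 3 → ℂ) :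
    conj (invForm H b a) = invForm H a b := by
  have hs : ∀ i j, H⁻¹ i j = H⁻¹ j i := fun i j => by
    simpa using (hH.inv.isHermitian.apply i j).symm
  simp only [invForm, map_sum, map_mul, Complex.conj_ofReal, Complex.conj_conj]
  rw [Finset.sum_comm]
  refine Finset.sum_congr rfl fun i _ => Finset.sum_congr rfl fun j _ => ?_
  rw [hs]; ring

theorem invForm_self_nonneg {H : Matrix (Fin 3) (Fin 3) ℝ} (hH : H.PosDef) (a : Fin 3 → ℂ) :
    0 ≤ (invForm H a a).re := by
  have key : (invForm H a a).re = star (fun i => (a i).re) ⬝ᵥ (H⁻¹.mulVec fun i => (a i).re)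
      + star (fun i => (a i).im) ⬝ᵥ (H⁻¹.mulVec fun i => (a i).im) := by
    simp only [invForm, Complex.re_sum, dotProduct, Matrix.mulVec, Finset.mul_sum,
      ← Finset.sum_add_distrib]
    refine Finset.sum_congr rfl fun i _ => Finset.sum_congr rfl fun j _ => ?_
    simp [Complex.mul_re]
    ring
  rw [key]
  exact add_nonneg (hH.inv.posSemidef.dotProduct_mulVec_nonneg _)
    (hH.inv.posSemidef.dotProduct_mulVec_nonneg _)

theorem sum_smul_e3 (x : Fin 3 → ℝ) (j : Fin 3) : (∑ i, x i • e3 i : E3) j = x j := by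
  simp [Pi.single_apply]

theorem posDef_of_bilin (B : E3 →L[ℝ] E3 →L[ℝ] ℝ) (hs : ∀ v w, B v w = B w v)
    (hp : ∀ v, v ≠ 0 → 0 < B v v) : (Matrix.of fun i j => B (e3 i) (e3 j)).PosDef := by
  refine Matrix.PosDef.of_dotProduct_mulVec_pos ?_ ?_
  · ext i j; simpa using hs _ _
  · intro x hx
    have hx' : (∑ i, x i • e3 i : E3) ≠ 0 := by
      intro h0
      apply hx
      ext j
      have := congrArg (fun v : E3 => v j) h0
      rw [sum_smul_e3] at this
      simpa using this
    have := hp _ hx'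
    simp only [map_sum, map_smul, _root_.sum_apply, _root_.smul_apply, smul_eq_mul, Finset.mul_sum] at this
    simp only [dotProduct, Matrix.mulVec, Matrix.of_apply, Finset.mul_sum, star_trivial]
    rw [Finset.sum_comm] at this
    refine this.trans_eq (Finset.sum_congr rfl fun i _ => Finset.sum_congr rfl fun j _ => ?_)
    ring

theorem posDef_of_bilin_frame (B : E3 →L[ℝ] E3 →L[ℝ] ℝ) (L : E3 ≃L[ℝ] E3)
    (hs : ∀ v w, B v w = B w v) (hp : ∀ v, v ≠ 0 → 0 < B v v) :
    (Matrix.of fun i j => B (L (e3 i)) (L (e3 j))).PosDef :=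
  posDef_of_bilin (B.bilinearComp (L : E3 →L[ℝ] E3) (L : E3 →L[ℝ] E3))
    (fun _ _ => hs _ _) fun _ hv => hp _ fun h0 => hv (L.map_eq_zero_iff.1 h0)

theorem frame_change (B : E3 →L[ℝ] E3 →L[ℝ] ℝ) (L : E3 ≃L[ℝ] E3) (α β : E3 →L[ℝ] ℂ) :
    invForm (Matrix.of fun i j => B (L (e3 i)) (L (e3 j))) (fun i => α (L (e3 i)))
      (fun i => β (L (e3 i)))
      = invForm (Matrix.of fun i j => B (e3 i) (e3 j)) (fun i => α (e3 i)) (fun i => β (e3 i)) := by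
  set Q : Matrix (Fin 3) (Fin 3) ℝ := Matrix.of fun i j => L (e3 j) i with hQd
  have hexp : ∀ v : E3, v = ∑ i, v i • e3 i := fun v => by
    ext j; rw [sum_smul_e3]
  have hQ : IsUnit Q.det := by
    set P : Matrix (Fin 3) (Fin 3) ℝ := Matrix.of fun i j => L.symm (e3 j) i with hP
    have : Q * P = 1 := by
      ext i j
      have h1 : L (L.symm (e3 j)) = e3 j := L.apply_symm_apply _
      rw [hexp (L.symm (e3 j))] at h1
      simp only [map_sum, map_smul] at h1
      have := congrArg (fun v : E3 => v i) h1
      simp only [WithLp.ofLp_sum, Finset.sum_apply, PiLp.smul_apply, smul_eq_mul] at this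
      simp only [Matrix.mul_apply, hQd, hP, Matrix.of_apply, Matrix.one_apply]
      simp only [mul_comm (L _ i)]
      simpa using this
    exact Matrix.isUnit_det_of_right_inverse this
  have hv : ∀ γ : E3 →L[ℝ] ℂ, (fun i => γ (L (e3 i))) =
      (Q.map Complex.ofRealHom).transpose.mulVec fun i => γ (e3 i) := by
    intro γ
    ext j
    conv_lhs => rw [hexp (L (e3 j))]
    simp [Matrix.mulVec, dotProduct, hQd]
  have hB : (Matrix.of fun i j => B (L (e3 i)) (L (e3 j))) =
      Q.transpose * (Matrix.of fun i j => B (e3 i) (e3 j)) * Q := by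
    ext i j
    rw [Matrix.of_apply, hexp (L (e3 i)), hexp (L (e3 j))]
    simp only [map_sum, map_smul, _root_.sum_apply, _root_.smul_apply, smul_eq_mul,
      Matrix.mul_apply, Matrix.transpose_apply, hQd, Matrix.of_apply, Finset.mul_sum,
      Finset.sum_mul]
    refine Finset.sum_congr rfl fun k _ => Finset.sum_congr rfl fun l _ => ?_
    ring
  rw [hv α, hv β, hB, invForm_congr _ Q hQ]

end LinearAlgebra

section Metric

variable {S : Type*} [TopologicalSpace S] [ChartedSpace E3 S] [IsManifold (𝓡 3) ∞ S]

/-- The coordinate vector field `∂ᵢ` of the chart around `c`, at the point with coordinates `z`. -/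
def coordVec (c : S) (z : E3) (i : Fin 3) : TangentSpace (𝓡 3) ((extChartAt (𝓡 3) c).symm z) :=
  mfderiv 𝓘(ℝ, E3) (𝓡 3) (extChartAt (𝓡 3) c).symm z (e3 i)

/-- The matrix `(h_ij)` of a Riemannian metric in the chart around `c`. -/
def coordMatrix (h : ContinuousRiemannianMetric E3 (fun x : S => TangentSpace (𝓡 3) x))
    (c : S) (z : E3) : Matrix (Fin 3) (Fin 3) ℝ :=
  Matrix.of fun i j => h.inner ((extChartAt (𝓡 3) c).symm z) (coordVec c z i) (coordVec c z j)

variable (S) in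
/-- A Riemannian metric of regularity `C^{1,1}` on `S`: its components in the charts are
continuously differentiable, with locally Lipschitz derivatives. -/
structure C11Metric extends ContinuousRiemannianMetric E3 (fun x : S => TangentSpace (𝓡 3) x) where
  contDiffOn_coord (c : S) (i j : Fin 3) :
    ContDiffOn ℝ 1 (fun z => coordMatrix toContinuousRiemannianMetric c z i j)
      (extChartAt (𝓡 3) c).target
  locallyLipschitzOn_fderiv_coord (c : S) (i j : Fin 3) :
    LocallyLipschitzOn (extChartAt (𝓡 3) c).target
      (fderiv ℝ fun z => coordMatrix toContinuousRiemannianMetric c z i j)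

/-- The components `h_ij` at `x`, in the standard basis of the tangent space at `x`. -/
def gram (h : C11Metric S) (x : S) : Matrix (Fin 3) (Fin 3) ℝ :=
  Matrix.of fun i j => h.inner x (e3 i) (e3 j)

/-- The (sesquilinear) inner product `h^{ij} conj(αᵢ) βⱼ` of complex covectors at `x`. -/
def cometric (h : C11Metric S) (x : S) (α β : TangentSpace (𝓡 3) x →L[ℝ] ℂ) : ℂ :=
  invForm (gram h x) (fun i => α (e3 i)) (fun i => β (e3 i))

end Metric

section Volume

variable {S : Type*} [TopologicalSpace S] [ChartedSpace E3 S] [IsManifold (𝓡 3) ∞ S]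
  [T2Space S] [CompactSpace S]

variable (S) in
/-- A smooth partition of unity subordinate to the charts. -/
def chartPartition : SmoothPartitionOfUnity S (𝓡 3) S univ :=
  Classical.choose (SmoothPartitionOfUnity.exists_isSubordinate_chartAt_source (𝓡 3) S)

variable [MeasurableSpace S]

/-- The part of the Riemannian measure seen by the chart around `c`: the image on `S` of
`ρ_c √det(h_ij) dz`. -/
def volPiece (h : C11Metric S) (c : S) : Measure S :=
  ((volume.restrict (extChartAt (𝓡 3) c).target).withDensity fun z =>
    ENNReal.ofReal (chartPartition S c ((extChartAt (𝓡 3) c).symm z) *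
      √(coordMatrix h.toContinuousRiemannianMetric c z).det)).map (extChartAt (𝓡 3) c).symm

/-- The Riemannian measure `√h dx` of `(S, h)`. -/
def vol (h : C11Metric S) : Measure S := Measure.sum (volPiece h)

end Volume


section Facts

variable {S : Type*} [TopologicalSpace S] [ChartedSpace E3 S] [IsManifold (𝓡 3) ∞ S]

theorem continuousOn_coordMatrix (h : C11Metric S) (c : S) :
    ContinuousOn (coordMatrix h.toContinuousRiemannianMetric c) (extChartAt (𝓡 3) c).target :=
  continuousOn_pi.2 fun i => continuousOn_pi.2 fun j => (h.contDiffOn_coord c i j).continuousOn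

theorem gram_posDef (h : C11Metric S) (x : S) : (gram h x).PosDef :=
  posDef_of_bilin (h.inner x) (h.symm x) (h.pos x)

theorem cometric_eq_coord (h : C11Metric S) {f g : S → ℂ}
    (hf : ContMDiff (𝓡 3) 𝓘(ℝ, ℂ) ∞ f) (hg : ContMDiff (𝓡 3) 𝓘(ℝ, ℂ) ∞ g) (c : S) {z : E3}
    (hz : z ∈ (extChartAt (𝓡 3) c).target) :
    (coordMatrix h.toContinuousRiemannianMetric c z).PosDef ∧
    cometric h ((extChartAt (𝓡 3) c).symm z)
      (mfderiv (𝓡 3) 𝓘(ℝ, ℂ) f ((extChartAt (𝓡 3) c).symm z))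
      (mfderiv (𝓡 3) 𝓘(ℝ, ℂ) g ((extChartAt (𝓡 3) c).symm z)) =
    invForm (coordMatrix h.toContinuousRiemannianMetric c z)
      (fun i => fderiv ℝ (f ∘ (extChartAt (𝓡 3) c).symm) z (e3 i))
      (fun i => fderiv ℝ (g ∘ (extChartAt (𝓡 3) c).symm) z (e3 i)) := by
  obtain ⟨L, hL⟩ := isInvertible_mfderivWithin_extChartAt_symm (I := 𝓡 3) hz
  rw [ModelWithCorners.range_eq_univ, mfderivWithin_univ] at hL
  have hd : MDifferentiableAt 𝓘(ℝ, E3) (𝓡 3) (extChartAt (𝓡 3) c).symm z := by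
    have := mdifferentiableWithinAt_extChartAt_symm (I := 𝓡 3) hz
    rwa [ModelWithCorners.range_eq_univ, mdifferentiableWithinAt_univ] at this
  have hchain : ∀ {f : S → ℂ}, ContMDiff (𝓡 3) 𝓘(ℝ, ℂ) ∞ f → ∀ v : E3,
      fderiv ℝ (f ∘ (extChartAt (𝓡 3) c).symm) z v =
        mfderiv (𝓡 3) 𝓘(ℝ, ℂ) f ((extChartAt (𝓡 3) c).symm z) (L v) := by
    intro f hf v
    rw [← mfderiv_eq_fderiv, mfderiv_comp z (hf.mdifferentiableAt (by simp)) hd, ← hL]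
    rfl
  have hM : coordMatrix h.toContinuousRiemannianMetric c z =
      Matrix.of fun i j => h.inner ((extChartAt (𝓡 3) c).symm z) (L (e3 i)) (L (e3 j)) := by
    ext i j
    simp only [coordMatrix, coordVec, ← hL]
    rfl
  constructor
  · rw [hM]
    exact posDef_of_bilin_frame (h.inner ((extChartAt (𝓡 3) c).symm z)) L (h.symm _) (h.pos _)
  · simp only [hchain hf, hchain hg, hM]
    exact (frame_change (h.inner ((extChartAt (𝓡 3) c).symm z)) L _ _).symm

theorem continuous_cometric (h : C11Metric S) {f g : S → ℂ}
    (hf : ContMDiff (𝓡 3) 𝓘(ℝ, ℂ) ∞ f) (hg : ContMDiff (𝓡 3) 𝓘(ℝ, ℂ) ∞ g) :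
    Continuous fun x => cometric h x (mfderiv (𝓡 3) 𝓘(ℝ, ℂ) f x)
      (mfderiv (𝓡 3) 𝓘(ℝ, ℂ) g x) := by
  rw [continuous_iff_continuousAt]
  intro c
  have hopen : IsOpen (extChartAt (𝓡 3) c).target := isOpen_extChartAt_target c
  have hderiv : ∀ {f : S → ℂ}, ContMDiff (𝓡 3) 𝓘(ℝ, ℂ) ∞ f → ∀ i,
      ContinuousOn (fun z => fderiv ℝ (f ∘ (extChartAt (𝓡 3) c).symm) z (e3 i))
        (extChartAt (𝓡 3) c).target := by
    intro f hf i
    have h1 : ContDiffOn ℝ ∞ (f ∘ (extChartAt (𝓡 3) c).symm) (extChartAt (𝓡 3) c).target :=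
      (hf.comp_contMDiffOn (contMDiffOn_extChartAt_symm c)).contDiffOn
    exact (h1.continuousOn_fderiv_of_isOpen hopen (by simp)).clm_apply continuousOn_const
  have hinv : ∀ i j, ContinuousOn
      (fun z => (coordMatrix h.toContinuousRiemannianMetric c z)⁻¹ i j)
      (extChartAt (𝓡 3) c).target := by
    intro i j
    simp only [Matrix.inv_def, Matrix.smul_apply, Ring.inverse_eq_inv', smul_eq_mul]
    have hdet : ContinuousOn (fun z => (coordMatrix h.toContinuousRiemannianMetric c z).det)
        (extChartAt (𝓡 3) c).target :=
      (continuous_id.matrix_det).comp_continuousOn (continuousOn_coordMatrix h c)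
    have hadj : ContinuousOn
        (fun z => (coordMatrix h.toContinuousRiemannianMetric c z).adjugate i j)
        (extChartAt (𝓡 3) c).target :=
      ((continuous_id.matrix_adjugate).matrix_elem i j).comp_continuousOn
        (continuousOn_coordMatrix h c)
    exact (hdet.inv₀ fun z hz => (cometric_eq_coord h hf hg c hz).1.det_pos.ne').mul hadj
  have hF : ContinuousOn (fun z => invForm (coordMatrix h.toContinuousRiemannianMetric c z)
      (fun i => fderiv ℝ (f ∘ (extChartAt (𝓡 3) c).symm) z (e3 i))
      (fun i => fderiv ℝ (g ∘ (extChartAt (𝓡 3) c).symm) z (e3 i)))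
      (extChartAt (𝓡 3) c).target := by
    unfold invForm
    refine continuousOn_finsetSum _ fun i _ => continuousOn_finsetSum _ fun j _ => ?_
    exact ((Complex.continuous_ofReal.comp_continuousOn (hinv i j)).mul
      (Complex.continuous_conj.comp_continuousOn (hderiv hf i))).mul (hderiv hg j)
  have hc : ContinuousOn (fun x => cometric h x (mfderiv (𝓡 3) 𝓘(ℝ, ℂ) f x)
      (mfderiv (𝓡 3) 𝓘(ℝ, ℂ) g x)) (extChartAt (𝓡 3) c).source := by
    refine (hF.comp (continuousOn_extChartAt c) (extChartAt (𝓡 3) c).mapsTo).congr ?_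
    intro x hx
    have h1 := (cometric_eq_coord h hf hg c ((extChartAt (𝓡 3) c).map_source hx)).2
    rw [(extChartAt (𝓡 3) c).left_inv hx] at h1
    exact h1
  exact hc.continuousAt (extChartAt_source_mem_nhds c)

variable [T2Space S] [CompactSpace S]

theorem chartPartition_subordinate (c : S) :
    tsupport (chartPartition S c) ⊆ (extChartAt (𝓡 3) c).source := by
  rw [extChartAt_source]
  exact Classical.choose_spec
    (SmoothPartitionOfUnity.exists_isSubordinate_chartAt_source (𝓡 3) S) c

variable [MeasurableSpace S]

instance (h : C11Metric S) (c : S) : IsFiniteMeasure (volPiece h c) := by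
  set φ := extChartAt (𝓡 3) c with hφ
  set F : E3 → ℝ := fun z => chartPartition S c (φ.symm z) *
    √(coordMatrix h.toContinuousRiemannianMetric c z).det with hFdef
  have hK : IsCompact (φ '' tsupport (chartPartition S c)) :=
    ((isClosed_tsupport _).isCompact).image_of_continuousOn
      ((continuousOn_extChartAt c).mono (chartPartition_subordinate c))
  have hKt : φ '' tsupport (chartPartition S c) ⊆ φ.target := by
    rintro _ ⟨x, hx, rfl⟩
    exact φ.map_source (chartPartition_subordinate c hx)
  have hcont : ContinuousOn F φ.target := by
    refine ContinuousOn.mul ((chartPartition S c).contMDiff.continuous.comp_continuousOn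
      (continuousOn_extChartAt_symm c)) ?_
    exact Real.continuous_sqrt.comp_continuousOn
      ((continuous_id.matrix_det).comp_continuousOn (continuousOn_coordMatrix h c))
  have hint : IntegrableOn F φ.target := by
    refine IntegrableOn.of_forall_sdiff_eq_zero
      ((hcont.mono hKt).integrableOn_compact hK) (isOpen_extChartAt_target c).measurableSet ?_
    intro z hz
    have : chartPartition S c (φ.symm z) = 0 := by
      by_contra h0
      exact hz.2 ⟨φ.symm z, subset_tsupport _ h0, φ.right_inv hz.1⟩
    simp [hFdef, this]
  have := isFiniteMeasure_withDensity_ofReal hint.2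
  unfold volPiece
  infer_instance

instance (h : C11Metric S) : IsFiniteMeasure (vol h) := by
  refine ⟨?_⟩
  have hfin : {c : S | (Function.support (chartPartition S c)).Nonempty}.Finite :=
    (chartPartition S).locallyFinite.finite_nonempty_of_compact
  rw [vol, Measure.sum_apply _ MeasurableSet.univ, tsum_eq_sum (s := hfin.toFinset)]
  · exact ENNReal.sum_lt_top.2 fun c _ => measure_lt_top _ _
  · intro c hc
    have h0 : ∀ x, chartPartition S c x = 0 := by
      intro x
      by_contra hx
      exact hc (hfin.mem_toFinset.2 ⟨x, hx⟩)
    simp [volPiece, h0]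

end Facts

section Operator

variable {S : Type*} [TopologicalSpace S] [ChartedSpace E3 S] [IsManifold (𝓡 3) ∞ S]

variable (S) in
/-- The complex valued smooth functions on `S`. -/
def smoothFun : Submodule ℂ (S → ℂ) where
  carrier := {f | ContMDiff (𝓡 3) 𝓘(ℝ, ℂ) ∞ f}
  add_mem' hf hg := hf.add hg
  zero_mem' := contMDiff_const
  smul_mem' a _ hf := (ContinuousLinearMap.mul ℝ ℂ a).contMDiff.comp hf

/-- The smooth functions on `S`, to be normed by the quadratic form of `-Δ_h + m²`. -/
def FormCore (_ : C11Metric S) (_ : ℝ) : Type _ := smoothFun S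

variable (h : C11Metric S) (m : ℝ)

instance : AddCommGroup (FormCore h m) := inferInstanceAs (AddCommGroup (smoothFun S))

instance : Module ℂ (FormCore h m) := inferInstanceAs (Module ℂ (smoothFun S))

variable {h m}

/-- The underlying function. -/
def FormCore.fn (f : FormCore h m) : S → ℂ := f.1

theorem FormCore.contMDiff (f : FormCore h m) : ContMDiff (𝓡 3) 𝓘(ℝ, ℂ) ∞ f.fn := f.2

/-- The differential. -/
def FormCore.d (f : FormCore h m) (x : S) : TangentSpace (𝓡 3) x →L[ℝ] ℂ :=
  mfderiv (𝓡 3) 𝓘(ℝ, ℂ) f.fn x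

theorem FormCore.d_add (f g : FormCore h m) (x : S) (v : TangentSpace (𝓡 3) x) :
    (f + g).d x v = f.d x v + g.d x v := by
  have := mfderiv_add (f.contMDiff.mdifferentiableAt (x := x) (by simp))
    (g.contMDiff.mdifferentiableAt (x := x) (by simp))
  exact congrArg (fun T : E3 →L[ℝ] ℂ => T v) this

theorem FormCore.d_smul (a : ℂ) (f : FormCore h m) (x : S) (v : TangentSpace (𝓡 3) x) :
    (a • f).d x v = a * f.d x v := by
  have h1 : MDifferentiableAt (𝓡 3) 𝓘(ℝ, ℂ) f.fn x := f.contMDiff.mdifferentiableAt (by simp)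
  have := ((ContinuousLinearMap.mul ℝ ℂ a).hasMFDerivAt (x := f.fn x)).comp x h1.hasMFDerivAt
  exact congrArg (fun T : E3 →L[ℝ] ℂ => T v) this.mfderiv

/-- The integrand `⟨df, dg⟩ + m² conj(f) g` of the form of `-Δ_h + m²`. -/
def formDensity (f g : FormCore h m) (x : S) : ℂ :=
  cometric h x (f.d x) (g.d x) + (m : ℂ) ^ 2 * (conj (f.fn x) * g.fn x)

theorem continuous_formDensity (f g : FormCore h m) : Continuous (formDensity f g) :=
  (continuous_cometric h f.contMDiff g.contMDiff).add (continuous_const.mul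
    ((Complex.continuous_conj.comp f.contMDiff.continuous).mul g.contMDiff.continuous))

theorem formDensity_self_re (f : FormCore h m) (x : S) :
    m ^ 2 * ‖f.fn x‖ ^ 2 ≤ (formDensity f f x).re := by
  have h1 := invForm_self_nonneg (gram_posDef h x) (fun i => f.d x (e3 i))
  have h2 : ((m : ℂ) ^ 2 * (conj (f.fn x) * f.fn x)).re = m ^ 2 * ‖f.fn x‖ ^ 2 := by
    rw [Complex.conj_mul']
    norm_cast
  rw [formDensity, Complex.add_re, h2]
  exact le_add_of_nonneg_left h1

variable [T2Space S] [CompactSpace S] [MeasurableSpace S] [BorelSpace S]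

theorem integrable_formDensity (f g : FormCore h m) : Integrable (formDensity f g) (vol h) :=
  (continuous_formDensity f g).integrable_of_hasCompactSupport (HasCompactSupport.of_compactSpace _)

variable (h m) in
/-- The sesquilinear form of `-Δ_h + m²` on smooth functions. -/
@[reducible]
def formCore : PreInnerProductSpace.Core ℂ (FormCore h m) where
  inner f g := ∫ x, formDensity f g x ∂(vol h)
  conj_inner_symm f g := by
    rw [← integral_conj]
    refine integral_congr_ae (ae_of_all _ fun x => ?_)
    simp only [formDensity, map_add, cometric, invForm_symm (gram_posDef h x), map_mul, map_pow,
      Complex.conj_ofReal, Complex.conj_conj]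
    ring
  re_inner_nonneg f := by
    have : RCLike.re (∫ x, formDensity f f x ∂(vol h)) =
        ∫ x, RCLike.re (formDensity f f x) ∂(vol h) := (integral_re (integrable_formDensity f f)).symm
    rw [this]
    exact integral_nonneg fun x => le_trans (by positivity) (formDensity_self_re f x)
  add_left f g k := by
    rw [← integral_add (integrable_formDensity f k) (integrable_formDensity g k)]
    refine integral_congr_ae (ae_of_all _ fun x => ?_)
    have : (f + g).fn x = f.fn x + g.fn x := rfl
    have hd : ∀ i, (f + g).d x (e3 i) = f.d x (e3 i) + g.d x (e3 i) :=
      fun i => FormCore.d_add f g x (e3 i)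
    simp only [formDensity, cometric, invForm, hd, map_add, this, mul_add, add_mul,
      Finset.sum_add_distrib]
    ring
  smul_left f g a := by
    rw [← integral_const_mul]
    refine integral_congr_ae (ae_of_all _ fun x => ?_)
    have : (a • f).fn x = a * f.fn x := rfl
    have hd : ∀ i, (a • f).d x (e3 i) = a * f.d x (e3 i) :=
      fun i => FormCore.d_smul a f x (e3 i)
    simp only [formDensity, cometric, invForm, hd, map_mul, this, mul_add,
      Finset.mul_sum]
    congr 1
    · refine Finset.sum_congr rfl fun i _ => Finset.sum_congr rfl fun j _ => ?_
      ring
    · ring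

instance : SeminormedAddCommGroup (FormCore h m) :=
  @InnerProductSpace.Core.toSeminormedAddCommGroup ℂ _ _ _ _ (formCore h m)

instance : InnerProductSpace ℂ (FormCore h m) := InnerProductSpace.ofCore (formCore h m)

theorem FormCore.norm_sq (f : FormCore h m) :
    ‖f‖ ^ 2 = ∫ x, (formDensity f f x).re ∂(vol h) := by
  rw [← inner_self_eq_norm_sq (𝕜 := ℂ) f]
  exact (integral_re (integrable_formDensity f f)).symm

variable (h) in
/-- The Hilbert space `L²(S, √h dx)` of complex valued functions. -/
abbrev L2 : Type _ := Lp ℂ 2 (vol h)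

variable (h) in
/-- The class in `L²` of a smooth function. -/
def toL2Lin (m : ℝ) : FormCore h m →ₗ[ℂ] L2 h where
  toFun f := ContinuousMap.toLp 2 (vol h) ℂ ⟨f.fn, f.contMDiff.continuous⟩
  map_add' f g := (ContinuousMap.toLp 2 (vol h) ℂ).map_add ⟨f.fn, f.contMDiff.continuous⟩
    ⟨g.fn, g.contMDiff.continuous⟩
  map_smul' a f := (ContinuousMap.toLp 2 (vol h) ℂ).map_smul a ⟨f.fn, f.contMDiff.continuous⟩

theorem norm_toL2Lin_le (hm : 0 < m) (f : FormCore h m) : ‖toL2Lin h m f‖ ≤ m⁻¹ * ‖f‖ := by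
  rw [← div_eq_inv_mul, le_div_iff₀ hm, mul_comm]
  refine le_of_sq_le_sq ?_ (norm_nonneg f)
  have h1 : ‖toL2Lin h m f‖ ^ 2 = ∫ x, ‖f.fn x‖ ^ 2 ∂(vol h) := by
    rw [← inner_self_eq_norm_sq (𝕜 := ℂ)]
    have h2 : inner ℂ (toL2Lin h m f) (toL2Lin h m f) = ∫ x, f.fn x * conj (f.fn x) ∂(vol h) :=
      ContinuousMap.inner_toLp (vol h) _ _
    rw [h2]
    have h3 : ∀ x, f.fn x * conj (f.fn x) = ((‖f.fn x‖ ^ 2 : ℝ) : ℂ) := fun x => by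
      rw [Complex.mul_conj']; norm_cast
    simp only [h3]
    rw [integral_complex_ofReal]
    simp
  rw [mul_pow, h1, f.norm_sq, ← integral_const_mul]
  refine integral_mono_of_nonneg (ae_of_all _ fun x => by positivity) (integrable_formDensity f f).re
    (ae_of_all _ fun x => formDensity_self_re f x)

variable (h m) in
/-- The form domain `H¹(S)`: the completion of the smooth functions in the form norm. -/
abbrev FormDomain : Type _ := UniformSpace.Completion (FormCore h m)

variable (h) in
/-- The inclusion of the form domain in `L²`. -/
def inclL2 (hm : 0 < m) : FormDomain h m →L[ℂ] L2 h :=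
  ((toL2Lin h m).mkContinuous m⁻¹ (norm_toL2Lin_le hm)).extend UniformSpace.Completion.toComplL

variable (h) in
/-- The inverse `A⁻¹` of the self-adjoint operator `A = -Δ_h + m²` on `L²(S)`, which is `ι ι*` for
the inclusion `ι` of the form domain in `L²(S)`: by definition of the adjoint, `u = ι* f` is the weak
solution of `A u = f`, i.e. `∫ (⟨du, dψ⟩ + m² conj(u) ψ) = ∫ conj(f) ψ` for all smooth `ψ`. -/
def invA (hm : 0 < m) : L2 h →L[ℂ] L2 h :=
  (inclL2 h hm).comp (ContinuousLinearMap.adjoint (inclL2 h hm))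

/-- The operator `A^{-1/2} sin(τ A^{1/2})`, as the continuous function `√r sin(τ/√r)` (with value
`0` at `r = 0`) of the bounded self-adjoint operator `R = A⁻¹`. -/
def sinOfInv {H : Type*} [NormedAddCommGroup H] [InnerProductSpace ℂ H] [CompleteSpace H]
    (R : H →L[ℂ] H) (τ : ℝ) : H →L[ℂ] H :=
  cfc (fun r : ℝ => √r * Real.sin (τ / √r)) R

variable (h) in
/-- The operator `A^{-1/2} sin(τ A^{1/2})` on `L²(S)`, for `A = -Δ_h + m²`. -/
def sinOp (hm : 0 < m) (τ : ℝ) : L2 h →L[ℂ] L2 h := sinOfInv (invA h hm) τ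

end Operator

section Kernel

/-- The model with corners of the spacetime `ℝ × S`. -/
abbrev IM : ModelWithCorners ℝ (ℝ × E3) (ModelProd ℝ E3) := 𝓘(ℝ, ℝ).prod (𝓡 3)

/-- Test functions on a manifold: smooth, complex valued, of compact support. -/
structure IsTest {E H N : Type*} [NormedAddCommGroup E] [NormedSpace ℝ E] [TopologicalSpace H]
    (I : ModelWithCorners ℝ E H) [TopologicalSpace N] [ChartedSpace H N] (w : N → ℂ) : Prop where
  contMDiff : ContMDiff I 𝓘(ℝ, ℂ) ∞ w
  hasCompactSupport : HasCompactSupport w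

/-- The support of a functional `T` on test functions: the complement of the largest open set on
which `T` vanishes. -/
def distSupport {E H N : Type*} [NormedAddCommGroup E] [NormedSpace ℝ E] [TopologicalSpace H]
    (I : ModelWithCorners ℝ E H) [TopologicalSpace N] [ChartedSpace H N] (T : (N → ℂ) → ℂ) :
    Set N :=
  (⋃₀ {U : Set N | IsOpen U ∧ ∀ w, IsTest I w → tsupport w ⊆ U → T w = 0})ᶜ

variable {S : Type*} [TopologicalSpace S] [ChartedSpace E3 S] [IsManifold (𝓡 3) ∞ S]
  [T2Space S] [CompactSpace S] [MeasurableSpace S] [BorelSpace S]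

/-- The kernel `K_G` of the causal propagator `G = -A^{-1/2} sin(A^{1/2}(t-s))`, acting on a
function `w` on `M × M`, `M = ℝ × S`: with an orthonormal basis `(b k)` of `L²(S)`,
`K_G(t,x;s,y) = -∑ₖ (A^{-1/2} sin(A^{1/2}(t-s)) bₖ)(x) conj(bₖ(y))`.
For real eigenfunctions `bₖ = φₖ` of `A` with eigenvalues `λₖ²`, this is
`-∑ₖ λₖ⁻¹ sin(λₖ(t-s)) φₖ(x) φₖ(y)`. -/
def causalKernel (h : C11Metric S) {m : ℝ} (hm : 0 < m) {ι : Type*}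
    (b : HilbertBasis ι ℂ (L2 h)) (w : (ℝ × S) × (ℝ × S) → ℂ) : ℂ :=
  -∑' k, ∫ t : ℝ, ∫ s : ℝ, ∫ x, ∫ y,
    sinOp h hm (t - s) (b k) x * conj (b k y) * w ((t, x), (s, y)) ∂(vol h) ∂(vol h)

end Kernel

section Causality

variable {S : Type*} [TopologicalSpace S] [ChartedSpace E3 S] [IsManifold (𝓡 3) ∞ S]

/-- The ultrastatic Lorentzian metric `dt² - h` on `ℝ × S`. -/
def lorentz (h : C11Metric S) (p : ℝ × S) (v w : TangentSpace IM p) : ℝ :=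
  v.1 * w.1 - h.inner p.2 v.2 w.2

/-- The velocity of a curve in `ℝ × S`. -/
def velocity (γ : ℝ → ℝ × S) (σ : ℝ) : TangentSpace IM (γ σ) :=
  mfderiv 𝓘(ℝ, ℝ) IM γ σ (1 : ℝ)

/-- Future directed causal curves on `[a, b]`: (locally) Lipschitz curves with almost everywhere
future directed causal velocity. -/
structure IsFutureCausal (h : C11Metric S) (γ : ℝ → ℝ × S) (a b : ℝ) : Prop where
  continuousOn : ContinuousOn γ (Icc a b)
  lipschitz : ∀ σ ∈ Icc a b, ∃ K, ∃ u ∈ 𝓝[Icc a b] σ, LipschitzOnWith K (extChartAt IM (γ σ) ∘ γ) u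
  causal : ∀ᵐ σ, σ ∈ Icc a b → MDifferentiableAt 𝓘(ℝ, ℝ) IM γ σ ∧
    0 ≤ lorentz h (γ σ) (velocity γ σ) (velocity γ σ) ∧ 0 < (velocity γ σ).1

/-- The causal future `J⁺(p)`. -/
def causalFuture (h : C11Metric S) (p : ℝ × S) : Set (ℝ × S) :=
  {q | q = p ∨ ∃ γ a b, a < b ∧ IsFutureCausal h γ a b ∧ γ a = p ∧ γ b = q}

/-- The causal past `J⁻(p)`. -/
def causalPast (h : C11Metric S) (p : ℝ × S) : Set (ℝ × S) := {q | p ∈ causalFuture h q}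

/-- `J(p) = J⁺(p) ∪ J⁻(p)`. -/
def causalJ (h : C11Metric S) (p : ℝ × S) : Set (ℝ × S) := causalFuture h p ∪ causalPast h p

end Causality

end Ultrastatic

end

/-!
Call a smooth function `ψ` on `Σ` short if `|dψ|_h ≤ 1`.

Finite propagation speed comes from an exponentially weighted resolvent bound. Put
`u = (A + k²)⁻¹ g` and test the weak equation against `e^{2kψ} u`: since `|d e^{kψ}| ≤ k e^{kψ}`,
the term `k²` absorbs the error, and `‖e^{kψ} u‖ ≤ m⁻² ‖e^{kψ} g‖`. If `ψ ≥ b` on the support of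
`f` and `ψ ≤ a` on the support of `g`, then `⟨f, (A + k²)⁻¹ g⟩ = O(e^{-k(b-a)})`. This resolvent is
the Laplace transform at `k` of `t ↦ A^{-1/2} sin(A^{1/2} t)`, and a bounded continuous function
whose Laplace transform is `O(e^{-kd})` vanishes on `[0, d)`. So `⟨f, A^{-1/2} sin(A^{1/2} τ) g⟩`
vanishes for `|τ| < b - a`, without any theory of hyperbolic equations.

In charts a test function on `M × M` is a superposition, weighted by its mixed partial derivative,
of products of indicators of octants; this turns `K_G(w)` into an integral of such matrix elements.

Finally, suppose no short `ψ` satisfies `ψ(x) - ψ(y) > |t - s|`. For fixed `ε` the length of chains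
with jumps shorter than `ε` is a function which regularization in charts and a partition of unity
make smooth and almost short, so `x` and `y` are joined by `ε`-chains of length about `|t - s|`.
By Tychonoff these accumulate, as `ε → 0`, at a curve along which every short function is
`1`-Lipschitz. Such a curve is Lipschitz with speed at most one, hence causal when parametrized by
time.
-/

noncomputable section

namespace Ultrastatic

section LaplaceTransform

/-- A smooth approximation, from below and sharper as `k` grows, of the indicator function of
`(-∞, σ)`; it is a power series in `e^{-kt}` without constant term. -/
def smoothStep (k σ t : ℝ) : ℝ := 1 - Real.exp (-Real.exp (k * (σ - t)))

theorem continuous_smoothStep (k σ : ℝ) : Continuous (smoothStep k σ) := by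
  unfold smoothStep
  fun_prop

theorem smoothStep_nonneg (k σ t : ℝ) : 0 ≤ smoothStep k σ t := by
  have : Real.exp (-Real.exp (k * (σ - t))) ≤ 1 := by
    rw [Real.exp_le_one_iff, neg_nonpos]
    exact (Real.exp_pos _).le
  simpa [smoothStep] using this

theorem smoothStep_le_one (k σ t : ℝ) : smoothStep k σ t ≤ 1 := by
  simpa [smoothStep] using (Real.exp_pos _).le

theorem smoothStep_le_exp (k σ t : ℝ) : smoothStep k σ t ≤ Real.exp (k * (σ - t)) := by
  have := Real.add_one_le_exp (-Real.exp (k * (σ - t)))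
  simp only [smoothStep]
  linarith

theorem smoothStep_le_exp_sub {k σ t : ℝ} (hk : 1 ≤ k) : smoothStep k σ t ≤ Real.exp (σ - t) := by
  rcases le_total t σ with hts | hts
  · exact (smoothStep_le_one k σ t).trans (Real.one_le_exp (by linarith))
  · exact (smoothStep_le_exp k σ t).trans (Real.exp_le_exp.2 (by nlinarith))

theorem tendsto_smoothStep_of_lt {σ t : ℝ} (ht : t < σ) :
    Tendsto (fun k => smoothStep k σ t) atTop (𝓝 1) := by
  have : Tendsto (fun k : ℝ => Real.exp (-Real.exp (k * (σ - t)))) atTop (𝓝 0) :=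
    Real.tendsto_exp_neg_atTop_nhds_zero.comp
      (Real.tendsto_exp_atTop.comp (tendsto_id.atTop_mul_const (sub_pos.2 ht)))
  simpa [smoothStep] using this.const_sub 1

theorem tendsto_exp_mul_sub_of_lt {σ t : ℝ} (ht : σ < t) :
    Tendsto (fun k => Real.exp (k * (σ - t))) atTop (𝓝 0) :=
  Real.tendsto_exp_atBot.comp (tendsto_id.atTop_mul_const_of_neg (sub_neg.2 ht))

theorem tendsto_smoothStep_of_gt {σ t : ℝ} (ht : σ < t) :
    Tendsto (fun k => smoothStep k σ t) atTop (𝓝 0) :=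
  squeeze_zero (fun k => smoothStep_nonneg k σ t) (fun k => smoothStep_le_exp k σ t)
    (tendsto_exp_mul_sub_of_lt ht)

theorem hasSum_exp_sub_one (y : ℝ) :
    HasSum (fun j : ℕ => ((j + 1).factorial : ℝ)⁻¹ * y ^ (j + 1)) (Real.exp y - 1) := by
  have hexp : HasSum (fun n : ℕ => (n.factorial : ℝ)⁻¹ * y ^ n) (Real.exp y) := by
    simpa [Real.exp_eq_exp_ℝ, div_eq_inv_mul] using NormedSpace.expSeries_div_hasSum_exp y
  simpa using (hasSum_nat_add_iff' 1).2 hexp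

/-- The coefficient of `e^{-k(j+1)t}` in the expansion of `smoothStep k σ t`. -/
def smoothStepCoeff (k σ : ℝ) (j : ℕ) : ℝ :=
  -(((j + 1).factorial : ℝ)⁻¹ * (-Real.exp (k * σ)) ^ (j + 1))

theorem norm_smoothStepCoeff (k σ : ℝ) (j : ℕ) :
    ‖smoothStepCoeff k σ j‖ = ((j + 1).factorial : ℝ)⁻¹ * Real.exp (k * σ) ^ (j + 1) := by
  simp [smoothStepCoeff]

theorem exp_mul_sub_pow (k σ t : ℝ) (j : ℕ) : Real.exp (k * (σ - t)) ^ (j + 1) =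
    Real.exp (k * σ) ^ (j + 1) * Real.exp (-(k * (j + 1)) * t) := by
  rw [← Real.exp_nat_mul, ← Real.exp_nat_mul, ← Real.exp_add]
  congr 1
  push_cast
  ring

theorem hasSum_smoothStep (k σ t : ℝ) : HasSum
    (fun j : ℕ => smoothStepCoeff k σ j * Real.exp (-(k * (j + 1)) * t)) (smoothStep k σ t) := by
  have hsum := (hasSum_exp_sub_one (-Real.exp (k * (σ - t)))).neg
  rw [neg_sub] at hsum
  refine hsum.congr_fun fun j => ?_
  rw [smoothStepCoeff, neg_pow, neg_pow (Real.exp (k * (σ - t))), exp_mul_sub_pow]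
  ring

variable {E : Type*} [NormedAddCommGroup E] [NormedSpace ℝ E] {F : ℝ → E} {B C d k : ℝ}

theorem integrableOn_exp_smul (hF : Continuous F) (hC : ∀ t, ‖F t‖ ≤ C) (hk : 0 < k) :
    IntegrableOn (fun t => Real.exp (-k * t) • F t) (Ioi 0) :=
  (integrableOn_exp_mul_Ioi (neg_lt_zero.2 hk) 0).smul_bdd C hF.aestronglyMeasurable
    (ae_of_all _ hC)

theorem integral_norm_exp_smul_le (hC : ∀ t, ‖F t‖ ≤ C) (hk : 0 < k) :
    ∫ t in Ioi (0 : ℝ), ‖Real.exp (-k * t) • F t‖ ≤ C / k := by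
  have hexp := integrableOn_exp_mul_Ioi (neg_lt_zero.2 hk) 0
  calc ∫ t in Ioi (0 : ℝ), ‖Real.exp (-k * t) • F t‖
      ≤ ∫ t in Ioi (0 : ℝ), Real.exp (-k * t) * C := by
        refine integral_mono_of_nonneg (ae_of_all _ fun t => norm_nonneg _) (hexp.mul_const C)
          (ae_of_all _ fun t => ?_)
        simp only [norm_smul, Real.norm_eq_abs, Real.abs_exp]
        gcongr
        exact hC t
    _ = C / k := by
        rw [integral_mul_const, integral_exp_mul_Ioi (neg_lt_zero.2 hk)]
        simp [div_eq_inv_mul]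

theorem hasSum_integral_smoothStep_smul (hF : Continuous F) (hC : ∀ t, ‖F t‖ ≤ C) (hk : 0 < k)
    (σ : ℝ) : HasSum
    (fun j : ℕ => smoothStepCoeff k σ j • ∫ t in Ioi (0 : ℝ), Real.exp (-(k * (j + 1)) * t) • F t)
    (∫ t in Ioi (0 : ℝ), smoothStep k σ t • F t) := by
  have hkj (j : ℕ) : 0 < k * (j + 1) := by positivity
  have hC0 : 0 ≤ C := (norm_nonneg _).trans (hC 0)
  have hsum := hasSum_integral_of_summable_integral_norm (μ := volume.restrict (Ioi (0 : ℝ)))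
    (F := fun (j : ℕ) t => smoothStepCoeff k σ j • (Real.exp (-(k * (j + 1)) * t) • F t))
    (fun j => (integrableOn_exp_smul hF hC (hkj j)).smul _) ?_
  · have hpt (t : ℝ) : ∑' j : ℕ, smoothStepCoeff k σ j • (Real.exp (-(k * (j + 1)) * t) • F t) =
        smoothStep k σ t • F t := by
      simp only [smul_smul]
      exact ((hasSum_smoothStep k σ t).smul_const (F t)).tsum_eq
    simpa only [integral_smul, hpt] using hsum
  · refine Summable.of_nonneg_of_le (fun j => integral_nonneg fun t => norm_nonneg _) (fun j => ?_)
      ((hasSum_exp_sub_one (Real.exp (k * σ))).summable.mul_right (C / k))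
    simp only [norm_smul (smoothStepCoeff k σ j), integral_const_mul, norm_smoothStepCoeff]
    gcongr
    refine (integral_norm_exp_smul_le hC (hkj j)).trans ?_
    gcongr
    exact le_mul_of_one_le_right hk.le (by simp)

theorem norm_integral_smoothStep_smul_le (hF : Continuous F) (hC : ∀ t, ‖F t‖ ≤ C)
    (hL : ∀ k : ℝ, 0 < k → ‖∫ t in Ioi (0 : ℝ), Real.exp (-k * t) • F t‖ ≤ B * Real.exp (-k * d))
    (hk : 0 < k) (σ : ℝ) : ‖∫ t in Ioi (0 : ℝ), smoothStep k σ t • F t‖ ≤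
      B * (Real.exp (Real.exp (k * (σ - d))) - 1) := by
  refine (hasSum_integral_smoothStep_smul hF hC hk σ).norm_le_of_bounded
    ((hasSum_exp_sub_one (Real.exp (k * (σ - d)))).mul_left B) fun j => ?_
  rw [norm_smul, norm_smoothStepCoeff, exp_mul_sub_pow]
  calc _ ≤ ((j + 1).factorial : ℝ)⁻¹ * Real.exp (k * σ) ^ (j + 1) *
        (B * Real.exp (-(k * (j + 1)) * d)) := by gcongr; exact hL _ (by positivity)
    _ = _ := by ring

theorem tendsto_integral_smoothStep_smul (hF : Continuous F) (hC : ∀ t, ‖F t‖ ≤ C) {σ : ℝ}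
    (hσ : 0 ≤ σ) : Tendsto (fun k => ∫ t in Ioi (0 : ℝ), smoothStep k σ t • F t) atTop
      (𝓝 (∫ t in (0 : ℝ)..σ, F t)) := by
  have hlim : ∫ t in (0 : ℝ)..σ, F t = ∫ t in Ioi (0 : ℝ), (Ioc 0 σ).indicator F t := by
    rw [intervalIntegral.integral_of_le hσ, setIntegral_indicator measurableSet_Ioc,
      inter_eq_right.2 Ioc_subset_Ioi_self]
  rw [hlim]
  refine tendsto_integral_filter_of_dominated_convergence
    (fun t => Real.exp σ * Real.exp (-1 * t) * C) ?_ ?_ ?_ ?_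
  · exact .of_forall fun k => ((continuous_smoothStep k σ).smul hF).aestronglyMeasurable
  · filter_upwards [eventually_ge_atTop 1] with k hk
    refine ae_of_all _ fun t => ?_
    rw [norm_smul, Real.norm_of_nonneg (smoothStep_nonneg k σ t), ← Real.exp_add, neg_one_mul,
      ← sub_eq_add_neg]
    gcongr
    exacts [smoothStep_le_exp_sub hk, hC t]
  · exact ((integrableOn_exp_mul_Ioi (by norm_num) 0).const_mul _).mul_const C
  · have hne : ∀ᵐ t ∂(volume.restrict (Ioi (0 : ℝ))), t ≠ σ :=
      ae_restrict_of_ae (Measure.ae_ne volume σ)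
    filter_upwards [hne, ae_restrict_mem measurableSet_Ioi] with t htσ ht0
    rcases lt_or_gt_of_ne htσ with hlt | hgt
    · simpa [show 0 < t ∧ t ≤ σ from ⟨ht0, hlt.le⟩] using
        (tendsto_smoothStep_of_lt hlt).smul_const (F t)
    · simpa [hgt] using (tendsto_smoothStep_of_gt hgt).smul_const (F t)

-- As `k → ∞` the integrals of `F` against the smooth steps tend both to `0` and to its primitive.
theorem eq_zero_of_norm_laplace_le [CompleteSpace E] (hF : Continuous F) (hC : ∀ t, ‖F t‖ ≤ C)
    (hL : ∀ k : ℝ, 0 < k → ‖∫ t in Ioi (0 : ℝ), Real.exp (-k * t) • F t‖ ≤ B * Real.exp (-k * d))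
    {t : ℝ} (ht : t ∈ Ioo 0 d) : F t = 0 := by
  have hprim : ∀ σ ∈ Ioo 0 d, ∫ t in (0 : ℝ)..σ, F t = 0 := by
    intro σ hσ
    refine tendsto_nhds_unique (tendsto_integral_smoothStep_smul hF hC hσ.1.le) ?_
    have hbound : Tendsto (fun k => B * (Real.exp (Real.exp (k * (σ - d))) - 1)) atTop (𝓝 0) := by
      simpa using (((tendsto_exp_mul_sub_of_lt hσ.2).rexp.sub_const 1).const_mul B)
    refine squeeze_zero_norm' ?_ hbound
    filter_upwards [eventually_gt_atTop 0] with k hk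
    exact norm_integral_smoothStep_smul_le hF hC hL hk σ
  have hloc : (fun σ => ∫ t in (0 : ℝ)..σ, F t) =ᶠ[𝓝 t] fun _ => 0 := by
    filter_upwards [isOpen_Ioo.mem_nhds ht] with σ hσ using hprim σ hσ
  rw [← hF.deriv_integral F 0 t, hloc.deriv_eq, deriv_const]

end LaplaceTransform

section SineOperator

theorem abs_sqrt_mul_sin_sub_le (r s t : ℝ) :
    |√r * Real.sin (t / √r) - √r * Real.sin (s / √r)| ≤ |t - s| := by
  rcases (Real.sqrt_nonneg r).eq_or_lt with h0 | h0
  · simp [← h0]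
  · have hsin : |Real.sin (t / √r) - Real.sin (s / √r)| ≤ |t / √r - s / √r| := by
      simpa only [Real.dist_eq, NNReal.coe_one, one_mul] using
        Real.lipschitzWith_sin.dist_le_mul (t / √r) (s / √r)
    calc |√r * Real.sin (t / √r) - √r * Real.sin (s / √r)|
        = √r * |Real.sin (t / √r) - Real.sin (s / √r)| := by
          rw [← mul_sub, abs_mul, abs_of_pos h0]
      _ ≤ √r * |t / √r - s / √r| := mul_le_mul_of_nonneg_left hsin h0.le
      _ = |t - s| := by rw [← sub_div, abs_div, abs_of_pos h0, mul_div_cancel₀ _ h0.ne']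

theorem abs_sqrt_mul_sin_le (r t : ℝ) : |√r * Real.sin (t / √r)| ≤ √r := by
  rw [abs_mul, abs_of_nonneg (Real.sqrt_nonneg r)]
  exact mul_le_of_le_one_right (Real.sqrt_nonneg r) (Real.abs_sin_le_one _)

theorem continuous_sqrt_mul_sin : Continuous fun x : ℝ × ℝ => √x.2 * Real.sin (x.1 / √x.2) := by
  rw [continuous_iff_continuousAt]
  rintro ⟨t, r⟩
  have hsqrt : ContinuousAt (fun x : ℝ × ℝ => √x.2) (t, r) := by fun_prop
  by_cases hr : √r = 0
  · rw [ContinuousAt, show √(t, r).2 * Real.sin ((t, r).1 / √(t, r).2) = 0 by simp [hr]]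
    exact squeeze_zero_norm (fun x => abs_sqrt_mul_sin_le x.2 x.1)
      (by simpa only [ContinuousAt, hr] using hsqrt)
  · exact hsqrt.mul (Real.continuous_sin.continuousAt.comp (continuousAt_fst.div hsqrt hr))

theorem continuous_sqrt_mul_sin_right (t : ℝ) : Continuous fun r : ℝ => √r * Real.sin (t / √r) :=
  continuous_sqrt_mul_sin.comp (Continuous.prodMk_right t)

theorem integral_exp_mul_sin {k : ℝ} (hk : 0 < k) (w : ℝ) :
    ∫ t in Ioi (0 : ℝ), Real.exp (-k * t) * Real.sin (t * w) = w / (k ^ 2 + w ^ 2) := by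
  have hre : ((-k : ℂ) + w * Complex.I).re < 0 := by simpa using hk
  have him (t : ℝ) : (Complex.exp (((-k : ℂ) + w * Complex.I) * t)).im =
      Real.exp (-k * t) * Real.sin (t * w) := by
    simp [Complex.exp_im, mul_comm]
  have hnormSq : Complex.normSq ((-k : ℂ) + w * Complex.I) = k ^ 2 + w ^ 2 := by
    simp [Complex.normSq_apply]
    ring
  have hint := integral_im (integrableOn_exp_mul_complex_Ioi hre 0)
  simp only [RCLike.im_to_complex, him] at hint
  rw [hint, integral_exp_mul_complex_Ioi hre 0]
  simp [hnormSq, neg_div]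

theorem integral_exp_mul_sqrt_mul_sin {k r : ℝ} (hk : 0 < k) (hr : 0 ≤ r) :
    ∫ t in Ioi (0 : ℝ), Real.exp (-k * t) * (√r * Real.sin (t / √r)) = r / (1 + k ^ 2 * r) := by
  rcases hr.eq_or_lt with rfl | hr
  · simp
  have : 0 < √r := Real.sqrt_pos.2 hr
  simp only [mul_left_comm _ (√r), div_eq_mul_inv _ (√r), integral_const_mul,
    integral_exp_mul_sin hk, inv_pow, Real.sq_sqrt hr.le]
  field_simp
  ring

variable {H : Type*} [NormedAddCommGroup H] [InnerProductSpace ℂ H] [CompleteSpace H]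
  {R : H →L[ℂ] H}

theorem norm_sinOfInv_sub_le (s t : ℝ) : ‖sinOfInv R t - sinOfInv R s‖ ≤ |t - s| := by
  unfold sinOfInv
  rw [← cfc_sub _ _ R (continuous_sqrt_mul_sin_right t).continuousOn
    (continuous_sqrt_mul_sin_right s).continuousOn]
  exact norm_cfc_le (abs_nonneg _) fun r _ => abs_sqrt_mul_sin_sub_le r s t

theorem continuous_sinOfInv : Continuous (sinOfInv R) := by
  refine (LipschitzWith.of_dist_le_mul (K := 1) fun s t => ?_).continuous
  simpa [dist_eq_norm] using norm_sinOfInv_sub_le t s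

theorem sinOfInv_neg (τ : ℝ) : sinOfInv R (-τ) = -sinOfInv R τ := by
  simp [sinOfInv, neg_div, cfc_neg]

theorem sinOfInv_zero : sinOfInv R 0 = 0 := by
  simp [sinOfInv]

theorem abs_sqrt_mul_sin_le_of_mem_spectrum {r : ℝ} (hr : r ∈ spectrum ℝ R) (t : ℝ) :
    |√r * Real.sin (t / √r)| ≤ √‖R‖ := by
  refine (abs_sqrt_mul_sin_le r t).trans (Real.sqrt_le_sqrt ?_)
  calc r ≤ ‖R‖ * ‖(1 : H →L[ℂ] H)‖ := (le_abs_self r).trans (spectrum.norm_le_norm_mul_of_mem hr)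
    _ ≤ ‖R‖ := mul_le_of_le_one_right (norm_nonneg _) ContinuousLinearMap.norm_id_le

theorem norm_sinOfInv_le (R : H →L[ℂ] H) (τ : ℝ) : ‖sinOfInv R τ‖ ≤ √‖R‖ :=
  norm_cfc_le (Real.sqrt_nonneg _) fun _ hr => abs_sqrt_mul_sin_le_of_mem_spectrum hr τ

/-- The resolvent `(A + k²)⁻¹` in terms of `R = A⁻¹`. -/
def resolventOfInv (R : H →L[ℂ] H) (k : ℝ) : H →L[ℂ] H :=
  cfc (fun r : ℝ => r / (1 + k ^ 2 * r)) R

theorem spectrum_nonneg_of_isPositive (hR : R.IsPositive) {r : ℝ} (hr : r ∈ spectrum ℝ R) :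
    0 ≤ r :=
  spectrum_nonneg_of_nonneg ((ContinuousLinearMap.nonneg_iff_isPositive R).2 hR) hr

theorem integrableOn_exp_smul_sinOfInv {k : ℝ} (hk : 0 < k) :
    IntegrableOn (fun t => Real.exp (-k * t) • sinOfInv R t) (Ioi 0) :=
  integrableOn_exp_smul continuous_sinOfInv (norm_sinOfInv_le R) hk

theorem integral_exp_smul_sinOfInv (hR : R.IsPositive) {k : ℝ} (hk : 0 < k) :
    ∫ t in Ioi (0 : ℝ), Real.exp (-k * t) • sinOfInv R t = resolventOfInv R k := by
  have hcont : ContinuousOn (Function.uncurry fun t r : ℝ =>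
      Real.exp (-k * t) * (√r * Real.sin (t / √r))) (Ioi 0 ×ˢ spectrum ℝ R) :=
    ((by fun_prop : Continuous fun x : ℝ × ℝ => Real.exp (-k * x.1)).mul
      continuous_sqrt_mul_sin).continuousOn
  have hbound : ∀ᵐ t ∂(volume.restrict (Ioi (0 : ℝ))), ∀ r ∈ spectrum ℝ R,
      ‖Real.exp (-k * t) * (√r * Real.sin (t / √r))‖ ≤ Real.exp (-k * t) * √‖R‖ := by
    refine ae_of_all _ fun t r hr => ?_
    rw [norm_mul, Real.norm_eq_abs, Real.abs_exp]
    gcongr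
    exact abs_sqrt_mul_sin_le_of_mem_spectrum hr t
  have hfin := ((integrableOn_exp_mul_Ioi (neg_lt_zero.2 hk) 0).mul_const √‖R‖).2
  calc ∫ t in Ioi (0 : ℝ), Real.exp (-k * t) • sinOfInv R t
      = ∫ t in Ioi (0 : ℝ), cfc (fun r : ℝ => Real.exp (-k * t) * (√r * Real.sin (t / √r))) R :=
        integral_congr_ae <| ae_of_all _ fun t =>
          (cfc_const_mul _ _ R (continuous_sqrt_mul_sin_right t).continuousOn).symm
    _ = cfc (fun r : ℝ => ∫ t in Ioi (0 : ℝ), Real.exp (-k * t) * (√r * Real.sin (t / √r))) R :=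
        (cfc_setIntegral measurableSet_Ioi _ _ R hcont hbound hfin hR.isSelfAdjoint).symm
    _ = resolventOfInv R k := cfc_congr fun r hr =>
        integral_exp_mul_sqrt_mul_sin hk (spectrum_nonneg_of_isPositive hR hr)

theorem integral_exp_smul_inner_sinOfInv (hR : R.IsPositive) {k : ℝ} (hk : 0 < k) (f g : H) :
    ∫ t in Ioi (0 : ℝ), Real.exp (-k * t) • inner ℂ f (sinOfInv R t g) =
      inner ℂ f (resolventOfInv R k g) := by
  have hcomm := ((innerSL ℂ f).comp (ContinuousLinearMap.apply ℂ H g)).integral_comp_comm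
    (integrableOn_exp_smul_sinOfInv (R := R) hk)
  rw [integral_exp_smul_sinOfInv hR hk] at hcomm
  simpa using hcomm

theorem resolventOfInv_eq (hR : R.IsPositive) (k : ℝ) :
    resolventOfInv R k = R * (1 - (k ^ 2) • resolventOfInv R k) := by
  have hsa := hR.isSelfAdjoint
  have hne : ∀ r ∈ spectrum ℝ R, 1 + k ^ 2 * r ≠ 0 := fun r hr => by
    have := spectrum_nonneg_of_isPositive hR hr
    positivity
  have hcont : ContinuousOn (fun r : ℝ => r / (1 + k ^ 2 * r)) (spectrum ℝ R) :=
    continuousOn_id.div (by fun_prop) hne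
  calc resolventOfInv R k
      = cfc (fun r : ℝ => r * (1 - k ^ 2 * (r / (1 + k ^ 2 * r)))) R := by
        refine cfc_congr fun r hr => ?_
        have hdiv := div_mul_cancel₀ r (hne r hr)
        linear_combination hdiv
    _ = R * (1 - (k ^ 2) • resolventOfInv R k) := by
        rw [cfc_mul (fun r : ℝ => r) _ R (by fun_prop) (by fun_prop), cfc_id' ℝ R,
          cfc_sub _ _ R (by fun_prop) (by fun_prop), cfc_const_one ℝ R, cfc_const_mul _ _ R hcont]
        rfl

theorem inner_sinOfInv_eq_zero_of_pos (hR : R.IsPositive) {f g : H} {B d : ℝ}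
    (hL : ∀ k : ℝ, 0 < k → ‖inner ℂ f (resolventOfInv R k g)‖ ≤ B * Real.exp (-k * d))
    {τ : ℝ} (hτ : τ ∈ Ioo 0 d) : inner ℂ f (sinOfInv R τ g) = 0 := by
  refine eq_zero_of_norm_laplace_le (F := fun t => inner ℂ f (sinOfInv R t g))
    (B := B) (d := d) (C := ‖f‖ * (√‖R‖ * ‖g‖)) ?_ (fun t => ?_) (fun k hk => ?_) hτ
  · exact continuous_const.inner (continuous_sinOfInv.clm_apply continuous_const)
  · refine (norm_inner_le_norm _ _).trans ?_
    gcongr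
    exact (sinOfInv R t).le_of_opNorm_le (norm_sinOfInv_le R t) g
  · rw [integral_exp_smul_inner_sinOfInv hR hk]
    exact hL k hk

theorem inner_sinOfInv_eq_zero (hR : R.IsPositive) {f g : H} {B d : ℝ}
    (hL : ∀ k : ℝ, 0 < k → ‖inner ℂ f (resolventOfInv R k g)‖ ≤ B * Real.exp (-k * d))
    {τ : ℝ} (hτ : |τ| < d) : inner ℂ f (sinOfInv R τ g) = 0 := by
  rcases lt_trichotomy τ 0 with h0 | rfl | h0
  · have := inner_sinOfInv_eq_zero_of_pos hR hL ⟨neg_pos.2 h0, by rwa [abs_of_neg h0] at hτ⟩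
    simpa [sinOfInv_neg] using this
  · simp [sinOfInv_zero]
  · exact inner_sinOfInv_eq_zero_of_pos hR hL ⟨h0, by rwa [abs_of_pos h0] at hτ⟩

end SineOperator

section InverseForm

variable {n : Type*} [Fintype n] [DecidableEq n] {Q : Matrix n n ℝ}

theorem dotProduct_inv_mulVec_le (hQ : Q.PosDef) {a : n → ℝ} {L : ℝ} (hL : 0 ≤ L)
    (ha : ∀ v : n → ℝ, (a ⬝ᵥ v) ^ 2 ≤ L * (v ⬝ᵥ Q.mulVec v)) : a ⬝ᵥ Q⁻¹.mulVec a ≤ L := by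
  have hsq : (a ⬝ᵥ Q⁻¹.mulVec a) ^ 2 ≤ L * (a ⬝ᵥ Q⁻¹.mulVec a) := by
    simpa only [Matrix.mulVec_mulVec, Matrix.mul_nonsing_inv _ hQ.det_pos.ne'.isUnit,
      Matrix.one_mulVec, dotProduct_comm (Q⁻¹.mulVec a)] using ha (Q⁻¹.mulVec a)
  nlinarith

theorem sq_dotProduct_le (hQ : Q.PosDef) (a v : n → ℝ) :
    (a ⬝ᵥ v) ^ 2 ≤ (a ⬝ᵥ Q⁻¹.mulVec a) * (v ⬝ᵥ Q.mulVec v) := by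
  have hQa : Q.mulVec (Q⁻¹.mulVec a) = a := by
    rw [Matrix.mulVec_mulVec, Matrix.mul_nonsing_inv _ hQ.det_pos.ne'.isUnit, Matrix.one_mulVec]
  have hav : (Q⁻¹.mulVec a) ⬝ᵥ Q.mulVec v = a ⬝ᵥ v := by
    have hsymm : Q.transpose = Q := by simpa using hQ.isHermitian.eq
    rw [Matrix.dotProduct_mulVec, ← Matrix.mulVec_transpose, hsymm, hQa]
  have hquad (s : ℝ) : 0 ≤ (v ⬝ᵥ Q.mulVec v) * (s * s) + (2 * (a ⬝ᵥ v)) * s +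
      a ⬝ᵥ Q⁻¹.mulVec a := by
    have hpos := hQ.posSemidef.dotProduct_mulVec_nonneg (Q⁻¹.mulVec a + s • v)
    simp only [star_trivial, Matrix.mulVec_add, Matrix.mulVec_smul, hQa, add_dotProduct,
      dotProduct_add, smul_dotProduct, dotProduct_smul, smul_eq_mul, hav] at hpos
    rw [dotProduct_comm (Q⁻¹.mulVec a) a, dotProduct_comm v a] at hpos
    linarith
  have hdiscrim := discrim_le_zero hquad
  rw [discrim] at hdiscrim
  linarith

variable {H : Matrix (Fin 3) (Fin 3) ℝ}

theorem invForm_add_left (a b c : Fin 3 → ℂ) :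
    invForm H (a + b) c = invForm H a c + invForm H b c := by
  simp only [invForm, Pi.add_apply, map_add, mul_add, add_mul, Finset.sum_add_distrib]

theorem invForm_add_right (a b c : Fin 3 → ℂ) :
    invForm H a (b + c) = invForm H a b + invForm H a c := by
  simp only [invForm, Pi.add_apply, mul_add, Finset.sum_add_distrib]

theorem invForm_smul_left (z : ℂ) (a b : Fin 3 → ℂ) :
    invForm H (z • a) b = conj z * invForm H a b := by
  simp only [invForm, Pi.smul_apply, smul_eq_mul, map_mul, Finset.mul_sum]
  exact Finset.sum_congr rfl fun i _ => Finset.sum_congr rfl fun j _ => by ring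

theorem invForm_smul_right (z : ℂ) (a b : Fin 3 → ℂ) :
    invForm H a (z • b) = z * invForm H a b := by
  simp only [invForm, Pi.smul_apply, smul_eq_mul, Finset.mul_sum]
  exact Finset.sum_congr rfl fun i _ => Finset.sum_congr rfl fun j _ => by ring

theorem re_invForm_smul_self (z : ℂ) (a : Fin 3 → ℂ) :
    (invForm H (z • a) (z • a)).re = ‖z‖ ^ 2 * (invForm H a a).re := by
  rw [invForm_smul_left, invForm_smul_right, ← mul_assoc, Complex.conj_mul', ← Complex.ofReal_pow,
    Complex.re_ofReal_mul]

theorem re_invForm_add_self_le (hH : H.PosDef) (a b : Fin 3 → ℂ) :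
    (invForm H (a + b) (a + b)).re ≤ 2 * (invForm H a a).re + 2 * (invForm H b b).re := by
  have hsub := invForm_self_nonneg hH (a + (-1 : ℂ) • b)
  simp only [invForm_add_left, invForm_add_right, invForm_smul_left, invForm_smul_right, map_neg,
    map_one, neg_mul, one_mul, Complex.add_re, Complex.neg_re] at hsub ⊢
  linarith

theorem re_invForm_add_two_smul (hH : H.PosDef) (a b : Fin 3 → ℂ) :
    (invForm H a (a + (2 : ℂ) • b)).re =
      (invForm H (a + b) (a + b)).re - (invForm H b b).re := by
  have hsymm : (invForm H b a).re = (invForm H a b).re := by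
    rw [← invForm_symm hH, Complex.conj_re]
  have htwo : (2 * invForm H a b).re = 2 * (invForm H a b).re := by simp
  simp only [invForm_add_left, invForm_add_right, invForm_smul_right, Complex.add_re, hsymm, htwo]
  ring

theorem re_invForm_ofReal (a : Fin 3 → ℝ) :
    (invForm H (fun i => (a i : ℂ)) (fun i => (a i : ℂ))).re = a ⬝ᵥ H⁻¹.mulVec a := by
  simp only [invForm, Complex.re_sum, dotProduct, Matrix.mulVec, Finset.mul_sum]
  refine Finset.sum_congr rfl fun i _ => Finset.sum_congr rfl fun j _ => ?_
  rw [Complex.conj_ofReal, ← Complex.ofReal_mul, ← Complex.ofReal_mul, Complex.ofReal_re]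
  ring

end InverseForm

section Slope

theorem eq_sum_smul_e3 (v : E3) : v = ∑ i, v i • e3 i := by
  ext j
  rw [sum_smul_e3]

theorem clm_eq_dotProduct (α : E3 →L[ℝ] ℝ) (v : E3) : α v = (fun i => α (e3 i)) ⬝ᵥ v.ofLp := by
  conv_lhs => rw [eq_sum_smul_e3 v]
  simp [dotProduct, mul_comm]

theorem bilin_eq_dotProduct (B : E3 →L[ℝ] E3 →L[ℝ] ℝ) (v : E3) :
    B v v = v.ofLp ⬝ᵥ (Matrix.of fun i j => B (e3 i) (e3 j)).mulVec v.ofLp := by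
  conv_lhs => rw [eq_sum_smul_e3 v]
  simp only [map_sum, map_smul, _root_.sum_apply, _root_.smul_apply, smul_eq_mul, dotProduct,
    Matrix.mulVec, Matrix.of_apply, Finset.mul_sum]
  rw [Finset.sum_comm]
  exact Finset.sum_congr rfl fun i _ => Finset.sum_congr rfl fun j _ => by ring

variable {S : Type*} [TopologicalSpace S] [ChartedSpace E3 S]

/-- The differential of a real valued function. -/
def realD (f : S → ℝ) (x : S) : TangentSpace (𝓡 3) x →L[ℝ] ℝ :=
  mfderiv (𝓡 3) 𝓘(ℝ, ℝ) f x

theorem mfderiv_ofReal_comp {f : S → ℝ} (hf : ContMDiff (𝓡 3) 𝓘(ℝ, ℝ) ∞ f) (x : S)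
    (v : TangentSpace (𝓡 3) x) :
    (mfderiv (𝓡 3) 𝓘(ℝ, ℂ) (fun y => (f y : ℂ)) x : E3 →L[ℝ] ℂ) v = (realD f x v : ℂ) := by
  have hcomp := (Complex.ofRealCLM.hasMFDerivAt (x := f x)).comp x
    (hf.mdifferentiableAt (by simp)).hasMFDerivAt
  exact congrArg (fun T : E3 →L[ℝ] ℂ => T v) hcomp.mfderiv

theorem contMDiff_ofReal {f : S → ℝ} (hf : ContMDiff (𝓡 3) 𝓘(ℝ, ℝ) ∞ f) :
    ContMDiff (𝓡 3) 𝓘(ℝ, ℂ) ∞ fun y => (f y : ℂ) :=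
  Complex.ofRealCLM.contMDiff.comp hf

variable [IsManifold (𝓡 3) ∞ S]

/-- The squared norm `h^{ij} ∂ᵢf ∂ⱼf` of the differential of a real valued function. -/
def slopeSq (h : C11Metric S) (f : S → ℝ) (x : S) : ℝ :=
  (invForm (gram h x) (fun i => (realD f x (e3 i) : ℂ)) (fun i => (realD f x (e3 i) : ℂ))).re

/-- The smooth functions whose differential has norm at most `1`. -/
structure IsShort (h : C11Metric S) (f : S → ℝ) : Prop where
  contMDiff : ContMDiff (𝓡 3) 𝓘(ℝ, ℝ) ∞ f
  sq_le (x : S) (v : TangentSpace (𝓡 3) x) : realD f x v ^ 2 ≤ h.inner x v v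

theorem continuous_slopeSq (h : C11Metric S) {f : S → ℝ} (hf : ContMDiff (𝓡 3) 𝓘(ℝ, ℝ) ∞ f) :
    Continuous (slopeSq h f) := by
  refine (Complex.continuous_re.comp
    (continuous_cometric h (contMDiff_ofReal hf) (contMDiff_ofReal hf))).congr fun x => ?_
  exact congrArg (fun a => (invForm (gram h x) a a).re)
    (funext fun i => mfderiv_ofReal_comp hf x (e3 i))

theorem inner_self_nonneg_tangent (h : C11Metric S) (x : S) (v : TangentSpace (𝓡 3) x) :
    0 ≤ h.inner x v v := by
  rcases eq_or_ne v 0 with rfl | hv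
  · simp
  · exact (h.pos x v hv).le

theorem inner_eq_dotProduct (h : C11Metric S) (x : S) (v : E3) :
    h.inner x v v = v.ofLp ⬝ᵥ (gram h x).mulVec v.ofLp :=
  bilin_eq_dotProduct (h.inner x) v

theorem slopeSq_eq (h : C11Metric S) (f : S → ℝ) (x : S) :
    slopeSq h f x = (fun i => realD f x (e3 i)) ⬝ᵥ (gram h x)⁻¹.mulVec fun i => realD f x (e3 i) :=
  re_invForm_ofReal _

theorem slopeSq_nonneg (h : C11Metric S) (f : S → ℝ) (x : S) : 0 ≤ slopeSq h f x :=
  invForm_self_nonneg (gram_posDef h x) _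

theorem sq_realD_le (h : C11Metric S) (f : S → ℝ) (x : S) (v : TangentSpace (𝓡 3) x) :
    realD f x v ^ 2 ≤ slopeSq h f x * h.inner x v v := by
  have hD : realD f x v = (fun i => realD f x (e3 i)) ⬝ᵥ (show E3 from v).ofLp :=
    clm_eq_dotProduct (realD f x) v
  have hinner : h.inner x v v =
      (show E3 from v).ofLp ⬝ᵥ (gram h x).mulVec (show E3 from v).ofLp :=
    inner_eq_dotProduct h x v
  rw [slopeSq_eq, hD, hinner]
  exact sq_dotProduct_le (gram_posDef h x) _ _

theorem slopeSq_le {h : C11Metric S} {f : S → ℝ} {x : S} {L : ℝ} (hL : 0 ≤ L)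
    (hf : ∀ v : TangentSpace (𝓡 3) x, realD f x v ^ 2 ≤ L * h.inner x v v) :
    slopeSq h f x ≤ L := by
  rw [slopeSq_eq]
  refine dotProduct_inv_mulVec_le (gram_posDef h x) hL fun v => ?_
  have hD := clm_eq_dotProduct (realD f x) (WithLp.toLp 2 v)
  have hinner := inner_eq_dotProduct h x (WithLp.toLp 2 v)
  exact (congrArg (· ^ 2) hD).ge.trans ((hf _).trans (congrArg (L * ·) hinner).le)

end Slope

section Multiplication

variable {S : Type*} [TopologicalSpace S] [ChartedSpace E3 S] [IsManifold (𝓡 3) ∞ S]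
  {h : C11Metric S} {m : ℝ} {ρ : S → ℝ}

/-- The components `∂ᵢf` of the differential of a smooth function. -/
def FormCore.covec (f : FormCore h m) (x : S) : Fin 3 → ℂ := fun i => f.d x (e3 i)

/-- Multiplication of smooth functions by a smooth real valued function. -/
def mulCore (hρ : ContMDiff (𝓡 3) 𝓘(ℝ, ℝ) ∞ ρ) : FormCore h m →ₗ[ℂ] FormCore h m where
  toFun f := ⟨fun x => (ρ x : ℂ) * f.fn x,
    (contDiff_mul (𝕜 := ℝ) (𝔸 := ℂ)).contMDiff.comp
      ((contMDiff_ofReal hρ).prodMk_space f.contMDiff)⟩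
  map_add' _ _ := Subtype.ext (funext fun _ => mul_add _ _ _)
  map_smul' _ _ := Subtype.ext (funext fun _ => mul_left_comm _ _ _)

theorem mulCore_fn (hρ : ContMDiff (𝓡 3) 𝓘(ℝ, ℝ) ∞ ρ) (f : FormCore h m) (x : S) :
    (mulCore hρ f).fn x = ρ x * f.fn x := rfl

theorem mulCore_covec (hρ : ContMDiff (𝓡 3) 𝓘(ℝ, ℝ) ∞ ρ) (f : FormCore h m) (x : S) :
    (mulCore hρ f).covec x =
      (ρ x : ℂ) • f.covec x + f.fn x • fun i => (realD ρ x (e3 i) : ℂ) := by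
  have hf : MDifferentiableAt (𝓡 3) 𝓘(ℝ, ℂ) f.fn x := f.contMDiff.mdifferentiableAt (by simp)
  have hρx : MDifferentiableAt (𝓡 3) 𝓘(ℝ, ℂ) (fun y => (ρ y : ℂ)) x :=
    (contMDiff_ofReal hρ).mdifferentiableAt (by simp)
  funext i
  refine (congrArg (fun T : E3 →L[ℝ] ℂ => T (e3 i))
    (hρx.hasMFDerivAt.mul hf.hasMFDerivAt).mfderiv).trans ?_
  exact congrArg (fun z : ℂ => (ρ x : ℂ) * f.covec x i + f.fn x * z)
    (mfderiv_ofReal_comp hρ x (e3 i))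

theorem re_formDensity_self (f : FormCore h m) (x : S) :
    (formDensity f f x).re =
      (invForm (gram h x) (f.covec x) (f.covec x)).re + m ^ 2 * ‖f.fn x‖ ^ 2 := by
  have hmass : ((m : ℂ) ^ 2 * (conj (f.fn x) * f.fn x)).re = m ^ 2 * ‖f.fn x‖ ^ 2 := by
    rw [Complex.conj_mul']
    norm_cast
  rw [formDensity, Complex.add_re, hmass]
  rfl

theorem re_formDensity_mulCore_mulCore (hρ : ContMDiff (𝓡 3) 𝓘(ℝ, ℝ) ∞ ρ) (f : FormCore h m)
    (x : S) :
    (formDensity f (mulCore hρ (mulCore hρ f)) x).re =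
      (formDensity (mulCore hρ f) (mulCore hρ f) x).re - slopeSq h ρ x * ‖f.fn x‖ ^ 2 := by
  set A : Fin 3 → ℂ := (ρ x : ℂ) • f.covec x with hA
  set B : Fin 3 → ℂ := f.fn x • fun i => (realD ρ x (e3 i) : ℂ) with hB
  have hcovec : (mulCore hρ (mulCore hρ f)).covec x = (ρ x : ℂ) • (A + (2 : ℂ) • B) := by
    rw [mulCore_covec, mulCore_covec, mulCore_fn, mul_smul, ← smul_add, ← hA, ← hB]
    congr 1
    module
  have hgrad : cometric h x (f.d x) ((mulCore hρ (mulCore hρ f)).d x) =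
      invForm (gram h x) A (A + (2 : ℂ) • B) := by
    change invForm (gram h x) (f.covec x) ((mulCore hρ (mulCore hρ f)).covec x) = _
    rw [hcovec, invForm_smul_right, hA, invForm_smul_left, Complex.conj_ofReal]
  have hmass : ((m : ℂ) ^ 2 * (conj (f.fn x) * ((ρ x : ℂ) * ((ρ x : ℂ) * f.fn x)))).re =
      m ^ 2 * ‖(ρ x : ℂ) * f.fn x‖ ^ 2 := by
    rw [← Complex.ofReal_re (m ^ 2 * ‖(ρ x : ℂ) * f.fn x‖ ^ 2)]
    congr 1
    push_cast
    rw [← Complex.conj_mul', map_mul, Complex.conj_ofReal]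
    ring
  have hslope : (invForm (gram h x) B B).re = slopeSq h ρ x * ‖f.fn x‖ ^ 2 := by
    rw [hB, re_invForm_smul_self, mul_comm, slopeSq]
  rw [re_formDensity_self, formDensity, Complex.add_re, hgrad,
    re_invForm_add_two_smul (gram_posDef h x), mulCore_covec, ← hA, ← hB, hslope,
    mulCore_fn, mulCore_fn, hmass]
  ring

theorem re_formDensity_mulCore_le (hm : 0 < m) (hρ : ContMDiff (𝓡 3) 𝓘(ℝ, ℝ) ∞ ρ)
    (f : FormCore h m) (x : S) :
    (formDensity (mulCore hρ f) (mulCore hρ f) x).re ≤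
      (2 * |ρ x| ^ 2 + 2 * slopeSq h ρ x / m ^ 2) * (formDensity f f x).re := by
  have hgrad := re_invForm_add_self_le (gram_posDef h x) ((ρ x : ℂ) • f.covec x)
    (f.fn x • fun i => (realD ρ x (e3 i) : ℂ))
  rw [re_invForm_smul_self, re_invForm_smul_self, ← slopeSq, ← mulCore_covec hρ, Complex.norm_real,
    Real.norm_eq_abs] at hgrad
  rw [re_formDensity_self, re_formDensity_self, mulCore_fn, norm_mul, Complex.norm_real,
    Real.norm_eq_abs, mul_pow]
  set D := (invForm (gram h x) (f.covec x) (f.covec x)).re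
  have hD : 0 ≤ D := invForm_self_nonneg (gram_posDef h x) _
  have hslope : 0 ≤ slopeSq h ρ x := slopeSq_nonneg h ρ x
  have hexpand : (2 * |ρ x| ^ 2 + 2 * slopeSq h ρ x / m ^ 2) * (D + m ^ 2 * ‖f.fn x‖ ^ 2) =
      2 * (|ρ x| ^ 2 * D) + 2 * (‖f.fn x‖ ^ 2 * slopeSq h ρ x) +
        m ^ 2 * (|ρ x| ^ 2 * ‖f.fn x‖ ^ 2) +
        (m ^ 2 * (|ρ x| ^ 2 * ‖f.fn x‖ ^ 2) + 2 * slopeSq h ρ x / m ^ 2 * D) := by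
    field_simp
    ring
  have hrest : 0 ≤ m ^ 2 * (|ρ x| ^ 2 * ‖f.fn x‖ ^ 2) + 2 * slopeSq h ρ x / m ^ 2 * D := by
    positivity
  linarith

variable [T2Space S] [CompactSpace S] [MeasurableSpace S] [BorelSpace S]

theorem exists_norm_mulCore_le (hm : 0 < m) (hρ : ContMDiff (𝓡 3) 𝓘(ℝ, ℝ) ∞ ρ) :
    ∃ C, ∀ f : FormCore h m, ‖mulCore hρ f‖ ≤ C * ‖f‖ := by
  have hcont : Continuous fun x => 2 * |ρ x| ^ 2 + 2 * slopeSq h ρ x / m ^ 2 :=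
    ((hρ.continuous.abs.pow 2).const_mul 2).add
      (((continuous_slopeSq h hρ).const_mul 2).div_const _)
  obtain ⟨C, hC⟩ := (isCompact_range hcont).bddAbove
  refine ⟨√(max C 0), fun f => le_of_sq_le_sq ?_ (by positivity)⟩
  rw [mul_pow, Real.sq_sqrt (le_max_right _ _), FormCore.norm_sq, FormCore.norm_sq,
    ← integral_const_mul]
  refine integral_mono (integrable_formDensity _ _).re
    ((integrable_formDensity f f).re.const_mul _) fun x => ?_
  calc (formDensity (mulCore hρ f) (mulCore hρ f) x).re
      ≤ (2 * |ρ x| ^ 2 + 2 * slopeSq h ρ x / m ^ 2) * (formDensity f f x).re :=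
        re_formDensity_mulCore_le hm hρ f x
    _ ≤ max C 0 * (formDensity f f x).re := by
        gcongr
        · exact le_trans (by positivity) (formDensity_self_re f x)
        · exact (hC ⟨x, rfl⟩).trans (le_max_left _ _)

theorem inclL2_coe (hm : 0 < m) (f : FormCore h m) :
    inclL2 h hm (f : FormDomain h m) = toL2Lin h m f :=
  ContinuousLinearMap.extend_eq _ UniformSpace.Completion.denseRange_coe
    (UniformSpace.Completion.isUniformInducing_coe _) f

/-- Multiplication by a smooth real valued function on the form domain. -/
def mulForm (hm : 0 < m) (hρ : ContMDiff (𝓡 3) 𝓘(ℝ, ℝ) ∞ ρ) :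
    FormDomain h m →L[ℂ] FormDomain h m :=
  ((UniformSpace.Completion.toComplL : FormCore h m →L[ℂ] FormDomain h m).comp
    ((mulCore hρ).mkContinuousOfExistsBound (exists_norm_mulCore_le hm hρ))).extend
      UniformSpace.Completion.toComplL

theorem mulForm_coe (hm : 0 < m) (hρ : ContMDiff (𝓡 3) 𝓘(ℝ, ℝ) ∞ ρ) (f : FormCore h m) :
    mulForm hm hρ (f : FormDomain h m) = (mulCore hρ f : FormCore h m) :=
  ContinuousLinearMap.extend_eq _ UniformSpace.Completion.denseRange_coe
    (UniformSpace.Completion.isUniformInducing_coe _) f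

variable (h) in
/-- Multiplication by a continuous real valued function on `L²`. -/
def mulL2 (hρ : Continuous ρ) : L2 h →L[ℂ] L2 h :=
  (ContinuousLinearMap.mul ℂ ℂ).holderL (vol h) ⊤ 2 2
    (ContinuousMap.toLp ⊤ (vol h) ℂ ⟨fun x => (ρ x : ℂ), Complex.continuous_ofReal.comp hρ⟩)

theorem coeFn_mulL2 (hρ : Continuous ρ) (f : L2 h) :
    mulL2 h hρ f =ᵐ[vol h] fun x => ρ x * f x := by
  have hmul := (ContinuousLinearMap.mul ℂ ℂ).coeFn_holder (r := 2) (μ := vol h)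
    (ContinuousMap.toLp ⊤ (vol h) ℂ ⟨fun x => (ρ x : ℂ), Complex.continuous_ofReal.comp hρ⟩) f
  have hcoe := ContinuousMap.coeFn_toLp (p := ⊤) (𝕜 := ℂ) (vol h)
    ⟨fun x => (ρ x : ℂ), Complex.continuous_ofReal.comp hρ⟩
  filter_upwards [hmul, hcoe] with x hmulx hcoex
  refine hmulx.trans ?_
  rw [hcoex]
  rfl

theorem inner_mulL2 (hρ : Continuous ρ) (f g : L2 h) :
    inner ℂ (mulL2 h hρ f) g = inner ℂ f (mulL2 h hρ g) := by
  rw [L2.inner_def, L2.inner_def]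
  refine integral_congr_ae ?_
  filter_upwards [coeFn_mulL2 hρ f, coeFn_mulL2 hρ g] with x hf hg
  rw [hf, hg]
  simp only [RCLike.inner_apply, map_mul, Complex.conj_ofReal]
  ring

theorem norm_mulL2_le (hρ : Continuous ρ) (f : L2 h) {C : ℝ}
    (hC : ∀ᵐ x ∂(vol h), f x ≠ 0 → |ρ x| ≤ C) : ‖mulL2 h hρ f‖ ≤ C * ‖f‖ := by
  refine Lp.norm_le_mul_norm_of_ae_le_mul ?_
  filter_upwards [coeFn_mulL2 hρ f, hC] with x hmul hCx
  rw [hmul, norm_mul, Complex.norm_real]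
  by_cases hfx : f x = 0
  · simp [hfx]
  · exact mul_le_mul_of_nonneg_right (hCx hfx) (norm_nonneg _)

theorem coeFn_toL2Lin (f : FormCore h m) : toL2Lin h m f =ᵐ[vol h] f.fn :=
  ContinuousMap.coeFn_toLp (p := 2) (𝕜 := ℂ) (vol h) ⟨f.fn, f.contMDiff.continuous⟩

theorem toL2Lin_mulCore (hρ : ContMDiff (𝓡 3) 𝓘(ℝ, ℝ) ∞ ρ) (f : FormCore h m) :
    toL2Lin h m (mulCore hρ f) = mulL2 h hρ.continuous (toL2Lin h m f) := by
  refine Lp.ext ?_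
  filter_upwards [coeFn_toL2Lin (mulCore hρ f), coeFn_toL2Lin f,
    coeFn_mulL2 hρ.continuous (toL2Lin h m f)] with x hρf hf hmul
  rw [hρf, hmul, hf, mulCore_fn]

theorem inclL2_mulForm (hm : 0 < m) (hρ : ContMDiff (𝓡 3) 𝓘(ℝ, ℝ) ∞ ρ) (u : FormDomain h m) :
    inclL2 h hm (mulForm hm hρ u) = mulL2 h hρ.continuous (inclL2 h hm u) := by
  induction u using UniformSpace.Completion.induction_on with
  | hp => exact isClosed_eq (by fun_prop) (by fun_prop)
  | ih f => rw [mulForm_coe, inclL2_coe, inclL2_coe, toL2Lin_mulCore]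

theorem norm_sq_toL2Lin (f : FormCore h m) :
    ‖toL2Lin h m f‖ ^ 2 = ∫ x, ‖f.fn x‖ ^ 2 ∂(vol h) := by
  rw [← inner_self_eq_norm_sq (𝕜 := ℂ), L2.inner_def, ← integral_re (L2.integrable_inner _ _)]
  refine integral_congr_ae ?_
  filter_upwards [coeFn_toL2Lin f] with x hf
  rw [hf, inner_self_eq_norm_sq]

end Multiplication

section ExpWeight

variable {S : Type*} [TopologicalSpace S] [ChartedSpace E3 S] {ψ : S → ℝ}

/-- The exponential weight `e^{kψ}`. -/
def expWeight (ψ : S → ℝ) (k : ℝ) (x : S) : ℝ := Real.exp (k * ψ x)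

theorem contMDiff_expWeight (hψ : ContMDiff (𝓡 3) 𝓘(ℝ, ℝ) ∞ ψ) (k : ℝ) :
    ContMDiff (𝓡 3) 𝓘(ℝ, ℝ) ∞ (expWeight ψ k) :=
  (Real.contDiff_exp.comp (contDiff_const.mul contDiff_id)).contMDiff.comp hψ

theorem realD_expWeight (hψ : ContMDiff (𝓡 3) 𝓘(ℝ, ℝ) ∞ ψ) (k : ℝ) (x : S)
    (v : TangentSpace (𝓡 3) x) :
    realD (expWeight ψ k) x v = k * expWeight ψ k x * realD ψ x v := by
  have hexp : HasDerivAt (fun t : ℝ => Real.exp (k * t)) (Real.exp (k * ψ x) * (k * 1)) (ψ x) :=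
    ((hasDerivAt_id _).const_mul k).exp
  have hcomp := hexp.hasFDerivAt.hasMFDerivAt.comp x
    (hψ.mdifferentiableAt (by simp)).hasMFDerivAt
  calc realD (expWeight ψ k) x v
      = realD ψ x v • (Real.exp (k * ψ x) * (k * 1)) :=
        congrArg (fun T : E3 →L[ℝ] ℝ => T v) hcomp.mfderiv
    _ = k * expWeight ψ k x * realD ψ x v := by
        simp only [expWeight, smul_eq_mul]
        ring

variable [IsManifold (𝓡 3) ∞ S]

theorem IsShort.slopeSq_expWeight_le {h : C11Metric S} (hψ : IsShort h ψ) (k : ℝ) (x : S) :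
    slopeSq h (expWeight ψ k) x ≤ (k * expWeight ψ k x) ^ 2 := by
  refine slopeSq_le (sq_nonneg _) fun v => ?_
  rw [realD_expWeight hψ.contMDiff, mul_pow]
  exact mul_le_mul_of_nonneg_left (hψ.sq_le x v) (sq_nonneg _)

end ExpWeight

section Resolvent

variable {S : Type*} [TopologicalSpace S] [ChartedSpace E3 S] [IsManifold (𝓡 3) ∞ S]
  [T2Space S] [CompactSpace S] [MeasurableSpace S] [BorelSpace S] {h : C11Metric S} {m : ℝ}

theorem isPositive_invA (hm : 0 < m) : (invA h hm).IsPositive :=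
  ContinuousLinearMap.isPositive_self_comp_adjoint _

theorem resolventOfInv_invA_apply (hm : 0 < m) (k : ℝ) (g : L2 h) :
    resolventOfInv (invA h hm) k g = inclL2 h hm
      (ContinuousLinearMap.adjoint (inclL2 h hm)
        (g - (k ^ 2 : ℝ) • resolventOfInv (invA h hm) k g)) :=
  congrArg (fun T : L2 h →L[ℂ] L2 h => T g) (resolventOfInv_eq (isPositive_invA hm) k)

section Weight

variable {ρ : S → ℝ}

theorem norm_sq_mulL2_inclL2_le (hm : 0 < m) (hρ : ContMDiff (𝓡 3) 𝓘(ℝ, ℝ) ∞ ρ) {k : ℝ}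
    (hk : ∀ x, slopeSq h ρ x ≤ (k * ρ x) ^ 2) (u : FormDomain h m) :
    m ^ 2 * ‖mulL2 h hρ.continuous (inclL2 h hm u)‖ ^ 2 ≤
      (inner ℂ u (mulForm hm hρ (mulForm hm hρ u))).re +
        k ^ 2 * ‖mulL2 h hρ.continuous (inclL2 h hm u)‖ ^ 2 := by
  induction u using UniformSpace.Completion.induction_on with
  | hp => exact isClosed_le (by fun_prop) (by fun_prop)
  | ih f =>
    rw [mulForm_coe, mulForm_coe, inclL2_coe, UniformSpace.Completion.inner_coe,
      ← toL2Lin_mulCore hρ, norm_sq_toL2Lin]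
    set F := mulCore hρ f
    have hF : Integrable (fun x => ‖F.fn x‖ ^ 2) (vol h) :=
      (F.contMDiff.continuous.norm.pow 2).integrable_of_hasCompactSupport
        (HasCompactSupport.of_compactSpace _)
    have hform : Integrable (fun x => (formDensity f (mulCore hρ F) x).re) (vol h) :=
      (integrable_formDensity f _).re
    have hre : (inner ℂ f (mulCore hρ F)).re =
        ∫ x, (formDensity f (mulCore hρ F) x).re ∂(vol h) :=
      (integral_re (integrable_formDensity f (mulCore hρ F))).symm
    rw [hre, ← integral_const_mul, ← integral_const_mul, ← integral_add hform (hF.const_mul _)]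
    refine integral_mono (hF.const_mul _) (hform.add (hF.const_mul _)) fun x => ?_
    calc m ^ 2 * ‖F.fn x‖ ^ 2
        ≤ (formDensity F F x).re := formDensity_self_re F x
      _ = (formDensity f (mulCore hρ F) x).re + slopeSq h ρ x * ‖f.fn x‖ ^ 2 := by
          rw [re_formDensity_mulCore_mulCore, sub_add_cancel]
      _ ≤ (formDensity f (mulCore hρ F) x).re + (k * ρ x) ^ 2 * ‖f.fn x‖ ^ 2 := by
          gcongr
          exact hk x
      _ = (formDensity f (mulCore hρ F) x).re + k ^ 2 * ‖F.fn x‖ ^ 2 := by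
          rw [mulCore_fn, norm_mul, Complex.norm_real, Real.norm_eq_abs, mul_pow, mul_pow, sq_abs,
            mul_assoc]

theorem norm_mulL2_resolventOfInv_le (hm : 0 < m) (hρ : ContMDiff (𝓡 3) 𝓘(ℝ, ℝ) ∞ ρ) {k : ℝ}
    (hk : ∀ x, slopeSq h ρ x ≤ (k * ρ x) ^ 2) (g : L2 h) :
    m ^ 2 * ‖mulL2 h hρ.continuous (resolventOfInv (invA h hm) k g)‖ ≤
      ‖mulL2 h hρ.continuous g‖ := by
  set W := mulL2 h hρ.continuous
  set v := resolventOfInv (invA h hm) k g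
  set u := ContinuousLinearMap.adjoint (inclL2 h hm) (g - (k ^ 2 : ℝ) • v) with hu
  have huv : inclL2 h hm u = v := (resolventOfInv_invA_apply hm k g).symm
  have henergy := norm_sq_mulL2_inclL2_le hm hρ hk u
  have hweak : inner ℂ u (mulForm hm hρ (mulForm hm hρ u)) =
      inner ℂ (W g) (W v) - (k ^ 2 : ℝ) * inner ℂ (W v) (W v) := by
    have hsmul : (k ^ 2 : ℝ) • v = ((k ^ 2 : ℝ) : ℂ) • v := (Complex.coe_smul _ _).symm
    conv_lhs => rw [hu]
    rw [ContinuousLinearMap.adjoint_inner_left, inclL2_mulForm, inclL2_mulForm, huv,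
      inner_sub_left, hsmul, inner_smul_left, Complex.conj_ofReal, inner_mulL2, inner_mulL2]
  have hself : ((k ^ 2 : ℝ) * inner ℂ (W v) (W v)).re = k ^ 2 * ‖W v‖ ^ 2 := by
    rw [Complex.re_ofReal_mul]
    exact congrArg _ (inner_self_eq_norm_sq (𝕜 := ℂ) (W v))
  have hCS : (inner ℂ (W g) (W v)).re ≤ ‖W g‖ * ‖W v‖ :=
    (Complex.re_le_norm _).trans (norm_inner_le_norm _ _)
  rw [huv, hweak, Complex.sub_re, hself] at henergy
  rcases (norm_nonneg (W v)).eq_or_lt with hv | hv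
  · rw [← hv, mul_zero]
    exact norm_nonneg _
  · refine le_of_mul_le_mul_right ?_ hv
    linarith

end Weight

variable {ψ : S → ℝ}

theorem mulL2_expWeight_neg (hψ : ContMDiff (𝓡 3) 𝓘(ℝ, ℝ) ∞ ψ) (k : ℝ) (f : L2 h) :
    mulL2 h (contMDiff_expWeight hψ (-k)).continuous
      (mulL2 h (contMDiff_expWeight hψ k).continuous f) = f := by
  refine Lp.ext ?_
  filter_upwards [coeFn_mulL2 (contMDiff_expWeight hψ (-k)).continuous
      (mulL2 h (contMDiff_expWeight hψ k).continuous f),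
    coeFn_mulL2 (contMDiff_expWeight hψ k).continuous f] with x hneg hpos
  rw [hneg, hpos, ← mul_assoc, ← Complex.ofReal_mul, expWeight, expWeight, ← Real.exp_add]
  simp

theorem norm_inner_resolventOfInv_le (hm : 0 < m) (hψ : IsShort h ψ) {a b k : ℝ} (hk : 0 < k)
    {f g : L2 h} (hf : ∀ᵐ x ∂(vol h), f x ≠ 0 → b ≤ ψ x)
    (hg : ∀ᵐ x ∂(vol h), g x ≠ 0 → ψ x ≤ a) :
    ‖inner ℂ f (resolventOfInv (invA h hm) k g)‖ ≤
      m⁻¹ ^ 2 * (‖f‖ * ‖g‖) * Real.exp (-k * (b - a)) := by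
  have hw := fun k => (contMDiff_expWeight hψ.contMDiff k).continuous
  set v := resolventOfInv (invA h hm) k g
  have hf' : ‖mulL2 h (hw (-k)) f‖ ≤ Real.exp (-k * b) * ‖f‖ := by
    refine norm_mulL2_le _ _ ?_
    filter_upwards [hf] with x hx hfx
    rw [expWeight, Real.abs_exp, Real.exp_le_exp]
    nlinarith [hx hfx]
  have hg' : ‖mulL2 h (hw k) g‖ ≤ Real.exp (k * a) * ‖g‖ := by
    refine norm_mulL2_le _ _ ?_
    filter_upwards [hg] with x hx hgx
    rw [expWeight, Real.abs_exp, Real.exp_le_exp]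
    nlinarith [hx hgx]
  have hv : ‖mulL2 h (hw k) v‖ ≤ m⁻¹ ^ 2 * (Real.exp (k * a) * ‖g‖) := by
    rw [inv_pow, inv_mul_eq_div, le_div_iff₀' (by positivity)]
    exact (norm_mulL2_resolventOfInv_le hm (contMDiff_expWeight hψ.contMDiff k)
      (hψ.slopeSq_expWeight_le k) g).trans hg'
  calc ‖inner ℂ f v‖ = ‖inner ℂ (mulL2 h (hw (-k)) f) (mulL2 h (hw k) v)‖ := by
        rw [inner_mulL2, mulL2_expWeight_neg hψ.contMDiff]
    _ ≤ ‖mulL2 h (hw (-k)) f‖ * ‖mulL2 h (hw k) v‖ := norm_inner_le_norm _ _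
    _ ≤ (Real.exp (-k * b) * ‖f‖) * (m⁻¹ ^ 2 * (Real.exp (k * a) * ‖g‖)) := by gcongr
    _ = m⁻¹ ^ 2 * (‖f‖ * ‖g‖) * (Real.exp (-k * b) * Real.exp (k * a)) := by ring
    _ = m⁻¹ ^ 2 * (‖f‖ * ‖g‖) * Real.exp (-k * (b - a)) := by
        rw [← Real.exp_add]
        ring_nf

theorem inner_sinOp_eq_zero (hm : 0 < m) (hψ : IsShort h ψ) {a b τ : ℝ} (hτ : |τ| < b - a)
    {f g : L2 h} (hf : ∀ᵐ x ∂(vol h), f x ≠ 0 → b ≤ ψ x)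
    (hg : ∀ᵐ x ∂(vol h), g x ≠ 0 → ψ x ≤ a) : inner ℂ f (sinOp h hm τ g) = 0 :=
  inner_sinOfInv_eq_zero (isPositive_invA hm)
    (fun _ hk => norm_inner_resolventOfInv_le hm hψ hk hf hg) hτ

end Resolvent

section Trace

theorem countable_of_hilbertBasis {𝕜 H : Type*} [RCLike 𝕜] [NormedAddCommGroup H]
    [InnerProductSpace 𝕜 H] [SecondCountableTopology H] {ι : Type*} (b : HilbertBasis ι 𝕜 H) :
    Countable ι := by
  have hdisjoint (i j : ι) (hij : i ≠ j) :
      Disjoint (Metric.ball (b i) (1 / 2)) (Metric.ball (b j) (1 / 2)) := by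
    have hdist : ‖b i - b j‖ ^ 2 = 2 := by
      rw [norm_sub_sq (𝕜 := 𝕜), b.orthonormal.2 hij, b.orthonormal.1 i, b.orthonormal.1 j]
      norm_num
    refine Metric.ball_disjoint_ball ?_
    rw [dist_eq_norm]
    nlinarith [norm_nonneg (b i - b j)]
  exact Pairwise.countable_of_isOpen_disjoint hdisjoint (fun _ => Metric.isOpen_ball)
    fun i => ⟨b i, Metric.mem_ball_self (by norm_num)⟩

theorem tsum_enorm_inner_mul_inner_le {𝕜 H : Type*} [RCLike 𝕜] [NormedAddCommGroup H]
    [InnerProductSpace 𝕜 H] {ι : Type*} {b : ι → H} (hb : Orthonormal 𝕜 b) (u v : H) :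
    ∑' k, ‖inner 𝕜 u (b k) * inner 𝕜 (b k) v‖ₑ ≤ ‖u‖ₑ * ‖v‖ₑ := by
  rw [ENNReal.tsum_eq_iSup_sum]
  refine iSup_le fun s => ?_
  simp only [← ofReal_norm]
  rw [← ENNReal.ofReal_sum_of_nonneg fun _ _ => norm_nonneg _,
    ← ENNReal.ofReal_mul (norm_nonneg u)]
  refine ENNReal.ofReal_le_ofReal ?_
  calc ∑ k ∈ s, ‖inner 𝕜 u (b k) * inner 𝕜 (b k) v‖
      = ∑ k ∈ s, ‖inner 𝕜 (b k) u‖ * ‖inner 𝕜 (b k) v‖ := by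
        simp only [norm_mul, norm_inner_symm u]
    _ ≤ √(∑ k ∈ s, ‖inner 𝕜 (b k) u‖ ^ 2) * √(∑ k ∈ s, ‖inner 𝕜 (b k) v‖ ^ 2) :=
        Real.sum_mul_le_sqrt_mul_sqrt _ _ _
    _ ≤ ‖u‖ * ‖v‖ := by
        gcongr <;> exact (Real.sqrt_le_left (norm_nonneg _)).2 (hb.sum_inner_products_le _)

theorem tsum_integral_inner_mul_inner {𝕜 H : Type*} [RCLike 𝕜] [NormedAddCommGroup H]
    [InnerProductSpace 𝕜 H] {ι X : Type*} [Countable ι] [MeasurableSpace X] {μ : Measure X}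
    (b : HilbertBasis ι 𝕜 H) {F G : X → H} {bound : X → ℝ} (hbound : Integrable bound μ)
    (hFG : ∀ x, ‖F x‖ * ‖G x‖ ≤ bound x)
    (hmeas : ∀ k, AEStronglyMeasurable (fun x => inner 𝕜 (F x) (b k) * inner 𝕜 (b k) (G x)) μ) :
    ∑' k, ∫ x, inner 𝕜 (F x) (b k) * inner 𝕜 (b k) (G x) ∂μ = ∫ x, inner 𝕜 (F x) (G x) ∂μ := by
  rw [← integral_tsum hmeas]
  · simp only [b.tsum_inner_mul_inner]
  · rw [← lintegral_tsum fun k => (hmeas k).enorm]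
    refine ((lintegral_mono fun x => ?_).trans_lt hbound.lintegral_lt_top).ne
    calc ∑' k, ‖inner 𝕜 (F x) (b k) * inner 𝕜 (b k) (G x)‖ₑ
        ≤ ‖F x‖ₑ * ‖G x‖ₑ := tsum_enorm_inner_mul_inner_le b.orthonormal (F x) (G x)
      _ = ENNReal.ofReal (‖F x‖ * ‖G x‖) := by
          rw [ENNReal.ofReal_mul (norm_nonneg _), ofReal_norm, ofReal_norm]
      _ ≤ ENNReal.ofReal (bound x) := ENNReal.ofReal_le_ofReal (hFG x)

theorem integral_mul_integral_swap {𝕜 X Z : Type*} [RCLike 𝕜] [MeasurableSpace X]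
    [MeasurableSpace Z] {μ : Measure X} {ν : Measure Z} [SFinite μ] [SFinite ν] {f : X → 𝕜}
    (hf : Integrable f μ) {Φ : Z × X → 𝕜} (hΦ : AEStronglyMeasurable Φ (ν.prod μ)) {K : Set Z}
    (hK : MeasurableSet K) (hν : ν K ≠ ⊤) {C : ℝ} (hC : ∀ p, ‖Φ p‖ ≤ K.indicator (fun _ => C) p.1) :
    ∫ x, f x * ∫ z, Φ (z, x) ∂ν ∂μ = ∫ z, ∫ x, f x * Φ (z, x) ∂μ ∂ν := by
  have hdom : Integrable (fun p : X × Z => ‖f p.1‖ * K.indicator (fun _ => C) p.2) (μ.prod ν) :=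
    hf.norm.mul_prod ((integrable_indicator_iff hK).2 (integrableOn_const hν))
  have hprod : Integrable (fun p : X × Z => f p.1 * Φ p.swap) (μ.prod ν) := by
    refine hdom.mono' (hf.1.comp_fst.mul hΦ.prod_swap) (ae_of_all _ fun p => ?_)
    rw [norm_mul]
    exact mul_le_mul_of_nonneg_left (hC p.swap) (norm_nonneg _)
  simp only [← integral_const_mul]
  exact integral_integral_swap hprod

theorem integral_integral_mul_superposition {𝕜 X Y Z : Type*} [RCLike 𝕜] [MeasurableSpace X]
    [MeasurableSpace Y] [MeasurableSpace Z] {μ : Measure X} {μ' : Measure Y} {ν : Measure Z}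
    [SFinite μ] [SFinite μ'] [SFinite ν] {f : X → 𝕜} {g : Y → 𝕜} (hf : Integrable f μ)
    (hg : Integrable g μ') {L : Z × X → 𝕜} {B : Z × Y → 𝕜} (hL : StronglyMeasurable L)
    (hB : StronglyMeasurable B) {K : Set Z} (hK : MeasurableSet K) (hν : ν K ≠ ⊤) {C D : ℝ}
    (hLC : ∀ p, ‖L p‖ ≤ K.indicator (fun _ => C) p.1) (hBD : ∀ p, ‖B p‖ ≤ D) :
    ∫ x, ∫ y, f x * g y * ∫ z, L (z, x) * B (z, y) ∂ν ∂μ' ∂μ =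
      ∫ z, (∫ x, f x * L (z, x) ∂μ) * ∫ y, g y * B (z, y) ∂μ' ∂ν := by
  set β : Z → 𝕜 := fun z => ∫ y, g y * B (z, y) ∂μ'
  have hβ : AEStronglyMeasurable β ν :=
    AEStronglyMeasurable.integral_prod_right' (f := fun p : Z × Y => g p.2 * B p)
      (hg.1.comp_snd.mul hB.aestronglyMeasurable)
  have hβ_le (z : Z) : ‖β z‖ ≤ ∫ y, ‖g y‖ * D ∂μ' := by
    refine norm_integral_le_of_norm_le (hg.norm.mul_const D) (ae_of_all _ fun y => ?_)
    rw [norm_mul]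
    exact mul_le_mul_of_nonneg_left (hBD _) (norm_nonneg _)
  have mul_le_indicator {E : ℝ} {z : Z} {x : X} {e : 𝕜} (he : ‖e‖ ≤ E) :
      ‖L (z, x) * e‖ ≤ K.indicator (fun _ => C * E) z := by
    calc ‖L (z, x) * e‖ ≤ K.indicator (fun _ => C) z * E := by
          rw [norm_mul]
          exact mul_le_mul (hLC (z, x)) he (norm_nonneg _) ((norm_nonneg _).trans (hLC (z, x)))
      _ = K.indicator (fun _ => C * E) z := by by_cases hz : z ∈ K <;> simp [hz]
  have hinner (x : X) : ∫ y, g y * ∫ z, L (z, x) * B (z, y) ∂ν ∂μ' = ∫ z, L (z, x) * β z ∂ν := by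
    have hLx : StronglyMeasurable fun p : Z × Y => L (p.1, x) :=
      hL.comp_measurable (by fun_prop)
    rw [integral_mul_integral_swap hg (Φ := fun p : Z × Y => L (p.1, x) * B p)
      (hLx.mul hB).aestronglyMeasurable hK hν fun p => mul_le_indicator (hBD p)]
    simp only [mul_left_comm (g _), integral_const_mul, β]
  simp only [mul_assoc, integral_const_mul, hinner]
  rw [integral_mul_integral_swap hf (Φ := fun p : Z × X => L p * β p.1)
    (hL.aestronglyMeasurable.mul hβ.comp_fst) hK hν fun p => mul_le_indicator (hβ_le p.1)]
  simp only [← mul_assoc, integral_mul_const, β]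

end Trace

section PartialDerivatives

variable {F G N E V : Type*} [NormedAddCommGroup F] [NormedSpace ℝ F] [TopologicalSpace G]
  {J : ModelWithCorners ℝ F G} [TopologicalSpace N] [ChartedSpace G N]
  [NormedAddCommGroup E] [NormedSpace ℝ E] [NormedAddCommGroup V] [NormedSpace ℝ V]
  {u : N × E → V}

/-- The derivative in the direction `v` of the second variable. -/
def partialD (v : E) (u : N × E → V) (p : N × E) : V :=
  fderiv ℝ (fun z => u (p.1, z)) p.2 v

theorem partialD_eq_zero {K : Set (N × E)} (hK : IsClosed K) (hu : ∀ p ∉ K, u p = 0) (v : E) :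
    ∀ p ∉ K, partialD v u p = 0 := by
  intro p hp
  have hzero : (fun z => u (p.1, z)) =ᶠ[𝓝 p.2] fun _ => 0 := by
    have hslice : Tendsto (fun z => (p.1, z)) (𝓝 p.2) (𝓝 (p.1, p.2)) :=
      (Continuous.prodMk_right p.1).tendsto p.2
    filter_upwards [hslice (hK.isOpen_compl.mem_nhds hp)] with z hz using hu _ hz
  rw [partialD, hzero.fderiv_eq, fderiv_const_apply, zero_apply]

theorem contDiff_slice (hu : ContMDiff (J.prod 𝓘(ℝ, E)) 𝓘(ℝ, V) ∞ u) (n : N) :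
    ContDiff ℝ ∞ fun z => u (n, z) :=
  (hu.comp (contMDiff_const.prodMk contMDiff_id)).contDiff

theorem hasDerivAt_line (hu : ContMDiff (J.prod 𝓘(ℝ, E)) 𝓘(ℝ, V) ∞ u) (n : N) (r v : E) (a : ℝ) :
    HasDerivAt (fun a : ℝ => u (n, r + a • v)) (partialD v u (n, r + a • v)) a := by
  have hslice : HasFDerivAt (fun z => u (n, z)) (fderiv ℝ (fun z => u (n, z)) (r + a • v))
      (r + a • v) :=
    ((contDiff_slice hu n).differentiable (by simp)).differentiableAt.hasFDerivAt
  have hline : HasDerivAt (fun a : ℝ => r + a • v) v a := by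
    simpa only [one_smul, id] using ((hasDerivAt_id a).smul_const v).const_add r
  exact hslice.comp_hasDerivAt a hline

theorem integral_partialD [CompleteSpace V] (hu : ContMDiff (J.prod 𝓘(ℝ, E)) 𝓘(ℝ, V) ∞ u)
    {K : Set (N × E)} (hK : IsCompact K) (hKu : ∀ p ∉ K, u p = 0) (n : N) (r : E) {v : E}
    (hv : v ≠ 0) (y : ℝ) : ∫ a in Iic y, partialD v u (n, r + a • v) = u (n, r + y • v) := by
  have hslice : HasCompactSupport fun z => u (n, z) :=
    HasCompactSupport.intro (hK.image continuous_snd) fun z hz => hKu _ fun hmem =>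
      hz ⟨_, hmem, rfl⟩
  have hline : IsClosedEmbedding fun a : ℝ => r + a • v :=
    (Homeomorph.addLeft r).isClosedEmbedding.comp (isClosedEmbedding_smul_left hv)
  have hsmooth : ContDiff ℝ 1 fun a : ℝ => u (n, r + a • v) :=
    ((contDiff_slice hu n).of_le (by simp)).comp
      (contDiff_const.add (contDiff_id.smul contDiff_const))
  simp only [← (hasDerivAt_line hu n r v _).deriv]
  exact HasCompactSupport.integral_Iic_deriv_eq hsmooth (hslice.comp_isClosedEmbedding hline) y

theorem contMDiff_partialD [IsManifold J 1 N] (hu : ContMDiff (J.prod 𝓘(ℝ, E)) 𝓘(ℝ, V) ∞ u)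
    (v : E) : ContMDiff (J.prod 𝓘(ℝ, E)) 𝓘(ℝ, V) ∞ (partialD v u) := by
  intro p
  have hparam : ContMDiffAt ((J.prod 𝓘(ℝ, E)).prod 𝓘(ℝ, E)) 𝓘(ℝ, V) ∞
      (Function.uncurry fun (q : N × E) (z : E) => u (q.1, z)) (p, p.2) :=
    (hu.comp ((contMDiff_fst.comp contMDiff_fst).prodMk contMDiff_snd)).contMDiffAt
  have hderiv := ContMDiffAt.mfderiv (J := J.prod 𝓘(ℝ, E)) (I := 𝓘(ℝ, E)) (I' := 𝓘(ℝ, V))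
    (m := ∞) (n := ∞) (fun (q : N × E) (z : E) => u (q.1, z)) (fun q => q.2) hparam
    contMDiff_snd.contMDiffAt (by simp)
  simp only [mfderiv_eq_fderiv] at hderiv
  rw [inTangentCoordinates_model_space] at hderiv
  exact (ContinuousLinearMap.apply ℝ V v).contMDiff.contMDiffAt.comp p hderiv

end PartialDerivatives

section Superposition

/-- The point of `ℝ³` with given coordinates, as an element of the Euclidean space `E3`. -/
def ofCoords (r : ℝ × ℝ × ℝ) : E3 := r.1 • e3 0 + r.2.1 • e3 1 + r.2.2 • e3 2

/-- The coordinates of a point of `ℝ³`, as a triple carrying the product Lebesgue measure. -/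
def toCoords (z : E3) : ℝ × ℝ × ℝ := (z 0, z 1, z 2)

theorem continuous_ofCoords : Continuous ofCoords := by
  unfold ofCoords
  fun_prop

theorem continuous_toCoords : Continuous toCoords := by
  unfold toCoords
  fun_prop

theorem toCoords_ofCoords (r : ℝ × ℝ × ℝ) : toCoords (ofCoords r) = r := by
  simp [toCoords, ofCoords]

theorem ofCoords_toCoords (z : E3) : ofCoords (toCoords z) = z := by
  ext i
  fin_cases i <;> simp [toCoords, ofCoords]

theorem e3_ne_zero (i : Fin 3) : e3 i ≠ 0 := fun h => by
  simpa [e3] using congrArg (fun v : E3 => v i) h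

/-- The closed octant of the points below `r` in each coordinate. -/
def lowerOctant (r : ℝ × ℝ × ℝ) : Set (ℝ × ℝ × ℝ) := Iic r.1 ×ˢ (Iic r.2.1 ×ˢ Iic r.2.2)

theorem measurableSet_lowerOctant (r : ℝ × ℝ × ℝ) : MeasurableSet (lowerOctant r) :=
  measurableSet_Iic.prod (measurableSet_Iic.prod measurableSet_Iic)

theorem setIntegral_lowerOctant {V : Type*} [NormedAddCommGroup V] [NormedSpace ℝ V]
    {f : ℝ × ℝ × ℝ → V} (hf : Integrable f) (r : ℝ × ℝ × ℝ) :
    ∫ z in lowerOctant r, f z =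
      ∫ a in Iic r.1, ∫ b in Iic r.2.1, ∫ c in Iic r.2.2, f (a, b, c) := by
  rw [lowerOctant, Measure.volume_eq_prod, setIntegral_prod _ hf.integrableOn]
  refine integral_congr_ae (ae_restrict_of_ae ?_)
  filter_upwards [hf.prod_right_ae] with a ha
  rw [Measure.volume_eq_prod]
  exact setIntegral_prod _ ha.integrableOn

variable {F G N V : Type*} [NormedAddCommGroup F] [NormedSpace ℝ F] [TopologicalSpace G]
  {J : ModelWithCorners ℝ F G} [TopologicalSpace N] [ChartedSpace G N]
  [NormedAddCommGroup V] [NormedSpace ℝ V] {u : N × E3 → V}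

/-- The mixed third derivative `∂₀∂₁∂₂` in the second variable. -/
def mixedD (u : N × E3 → V) : N × E3 → V := partialD (e3 2) (partialD (e3 1) (partialD (e3 0) u))

theorem mixedD_eq_zero {K : Set (N × E3)} (hK : IsClosed K) (hu : ∀ p ∉ K, u p = 0) :
    ∀ p ∉ K, mixedD u p = 0 :=
  partialD_eq_zero hK (partialD_eq_zero hK (partialD_eq_zero hK hu _) _) _

variable [IsManifold J 1 N]

theorem contMDiff_mixedD (hu : ContMDiff (J.prod 𝓘(ℝ, E3)) 𝓘(ℝ, V) ∞ u) :
    ContMDiff (J.prod 𝓘(ℝ, E3)) 𝓘(ℝ, V) ∞ (mixedD u) :=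
  contMDiff_partialD (contMDiff_partialD (contMDiff_partialD hu _) _) _

variable [T2Space N]

theorem integrable_mixedD (hu : ContMDiff (J.prod 𝓘(ℝ, E3)) 𝓘(ℝ, V) ∞ u) {K : Set (N × E3)}
    (hK : IsCompact K) (hKu : ∀ p ∉ K, u p = 0) (n : N) :
    Integrable fun z => mixedD u (n, ofCoords z) := by
  refine Continuous.integrable_of_hasCompactSupport
    ((contMDiff_mixedD hu).continuous.comp (continuous_const.prodMk continuous_ofCoords)) ?_
  refine HasCompactSupport.intro ((hK.image continuous_snd).image continuous_toCoords)
    fun z hz => mixedD_eq_zero hK.isClosed hKu _ fun hmem => hz ?_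
  exact ⟨_, ⟨_, hmem, rfl⟩, toCoords_ofCoords z⟩

theorem setIntegral_lowerOctant_mixedD [CompleteSpace V]
    (hu : ContMDiff (J.prod 𝓘(ℝ, E3)) 𝓘(ℝ, V) ∞ u) {K : Set (N × E3)} (hK : IsCompact K)
    (hKu : ∀ p ∉ K, u p = 0) (n : N) (r : ℝ × ℝ × ℝ) :
    ∫ z in lowerOctant r, mixedD u (n, ofCoords z) = u (n, ofCoords r) := by
  have hu₀ := contMDiff_partialD hu (e3 0)
  have hu₁ := contMDiff_partialD hu₀ (e3 1)
  have hKu₀ := partialD_eq_zero hK.isClosed hKu (e3 0)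
  have hKu₁ := partialD_eq_zero hK.isClosed hKu₀ (e3 1)
  have integral₂ (a b : ℝ) : ∫ c in Iic r.2.2, mixedD u (n, ofCoords (a, b, c)) =
      partialD (e3 1) (partialD (e3 0) u) (n, a • e3 0 + r.2.2 • e3 2 + b • e3 1) := by
    rw [add_right_comm]
    exact integral_partialD hu₁ hK hKu₁ n (a • e3 0 + b • e3 1) (e3_ne_zero 2) r.2.2
  have integral₁ (a : ℝ) : ∫ b in Iic r.2.1,
      partialD (e3 1) (partialD (e3 0) u) (n, a • e3 0 + r.2.2 • e3 2 + b • e3 1) =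
        partialD (e3 0) u (n, r.2.1 • e3 1 + r.2.2 • e3 2 + a • e3 0) := by
    rw [integral_partialD hu₀ hK hKu₀ n _ (e3_ne_zero 1) r.2.1]
    congr 2
    abel
  rw [setIntegral_lowerOctant (integrable_mixedD hu hK hKu n)]
  simp only [integral₂, integral₁]
  rw [integral_partialD hu hK hKu n _ (e3_ne_zero 0) r.1, ofCoords]
  congr 2
  abel

end Superposition

section ChartPull

variable {S : Type*} [TopologicalSpace S] [ChartedSpace E3 S]

/-- The test functions on `M × M` whose support lies, in the last variable, over the open subset
`O` of the domain of the chart around `c`. -/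
structure IsLocalTest (c : S) (O : Set S) (w : (ℝ × S) × (ℝ × S) → ℂ) : Prop
    extends IsTest (IM.prod IM) w where
  isOpen : IsOpen O
  subset_source : O ⊆ (extChartAt (𝓡 3) c).source
  mem_of_mem_tsupport : ∀ r ∈ tsupport w, r.2.2 ∈ O

open Classical in
/-- A function on `M × M`, with the last variable read in the chart around `c` and extended by
zero. -/
def chartPull (c : S) (w : (ℝ × S) × (ℝ × S) → ℂ) (p : ((ℝ × S) × ℝ) × E3) : ℂ :=
  if p.2 ∈ (extChartAt (𝓡 3) c).target then w (p.1.1, (p.1.2, (extChartAt (𝓡 3) c).symm p.2))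
  else 0

/-- The support of `w`, with the last variable read in the chart around `c`. -/
def chartSupport (c : S) (w : (ℝ × S) × (ℝ × S) → ℂ) : Set (((ℝ × S) × ℝ) × E3) :=
  (fun r : (ℝ × S) × (ℝ × S) => ((r.1, r.2.1), extChartAt (𝓡 3) c r.2.2)) '' tsupport w

/-- The pairs of a point of `O` and of a triple of reals below its coordinates. -/
def belowSet (c : S) (O : Set S) : Set ((ℝ × ℝ × ℝ) × S) :=
  {p | p.2 ∈ O ∧ p.1 ∈ lowerOctant (toCoords (extChartAt (𝓡 3) c p.2))}

variable {c : S} {O : Set S} {w : (ℝ × S) × (ℝ × S) → ℂ}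

theorem chartPull_eq_zero : ∀ p ∉ chartSupport c w, chartPull c w p = 0 := by
  intro p
  contrapose!
  intro hne
  rw [chartPull] at hne
  split_ifs at hne with htarget
  · exact ⟨_, subset_tsupport w hne, Prod.ext rfl ((extChartAt (𝓡 3) c).right_inv htarget)⟩
  · exact absurd rfl hne

theorem chartPull_extChartAt {y : S} (hy : y ∈ (extChartAt (𝓡 3) c).source) (p : ℝ × S) (s : ℝ) :
    chartPull c w ((p, s), extChartAt (𝓡 3) c y) = w (p, (s, y)) := by
  simp only [chartPull]
  rw [if_pos ((extChartAt (𝓡 3) c).map_source hy), (extChartAt (𝓡 3) c).left_inv hy]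

theorem IsLocalTest.isCompact_chartSupport (hw : IsLocalTest c O w) :
    IsCompact (chartSupport c w) := by
  refine hw.hasCompactSupport.isCompact.image_of_continuousOn
    (ContinuousOn.prodMk (by fun_prop) ?_)
  exact (continuousOn_extChartAt c).comp (by fun_prop) fun r hr =>
    hw.subset_source (hw.mem_of_mem_tsupport r hr)

theorem measurableSet_belowSet [MeasurableSpace S] [BorelSpace S] (hO : IsOpen O)
    (hsource : O ⊆ (extChartAt (𝓡 3) c).source) :
    MeasurableSet (belowSet c O) := by
  classical
  set coords : S → ℝ × ℝ × ℝ :=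
    O.piecewise (fun y => toCoords (extChartAt (𝓡 3) c y)) fun _ => 0
  have hcoords : Measurable coords :=
    (continuous_toCoords.comp_continuousOn
      ((continuousOn_extChartAt c).mono hsource)).measurable_piecewise continuousOn_const
      hO.measurableSet
  have hbelow : belowSet c O = {p | p.2 ∈ O} ∩ ({p | p.1.1 ≤ (coords p.2).1} ∩
      ({p | p.1.2.1 ≤ (coords p.2).2.1} ∩ {p | p.1.2.2 ≤ (coords p.2).2.2})) := by
    ext p
    refine and_congr_right fun hp => ?_
    have hp' : coords p.2 = toCoords (extChartAt (𝓡 3) c p.2) := piecewise_eq_of_mem _ _ _ hp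
    simp only [mem_inter_iff, mem_ofPred_eq, hp']
    rfl
  rw [hbelow]
  exact (hO.measurableSet.preimage measurable_snd).inter
    ((measurableSet_le (by fun_prop) (by fun_prop)).inter
      ((measurableSet_le (by fun_prop) (by fun_prop)).inter
        (measurableSet_le (by fun_prop) (by fun_prop))))

variable [IsManifold (𝓡 3) ∞ S] [T2Space S]

theorem IsLocalTest.contMDiff_chartPull (hw : IsLocalTest c O w) :
    ContMDiff ((IM.prod 𝓘(ℝ, ℝ)).prod 𝓘(ℝ, E3)) 𝓘(ℝ, ℂ) ∞ (chartPull c w) := by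
  intro p
  by_cases hp : p.2 ∈ (extChartAt (𝓡 3) c).target
  · have hopen : IsOpen (extChartAt (𝓡 3) c).target := isOpen_extChartAt_target c
    have hsymm : ContMDiffAt 𝓘(ℝ, E3) (𝓡 3) ∞ (extChartAt (𝓡 3) c).symm p.2 :=
      (contMDiffOn_extChartAt_symm c).contMDiffAt (hopen.mem_nhds hp)
    have hfst : ContMDiffAt ((IM.prod 𝓘(ℝ, ℝ)).prod 𝓘(ℝ, E3)) (IM.prod 𝓘(ℝ, ℝ)) ∞
        (fun p : ((ℝ × S) × ℝ) × E3 => p.1) p := contMDiffAt_fst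
    have hread : ContMDiffAt ((IM.prod 𝓘(ℝ, ℝ)).prod 𝓘(ℝ, E3)) (IM.prod IM) ∞
        (fun p : ((ℝ × S) × ℝ) × E3 =>
          (p.1.1, (p.1.2, (extChartAt (𝓡 3) c).symm p.2))) p :=
      (contMDiffAt_fst.comp p hfst).prodMk
        ((contMDiffAt_snd.comp p hfst).prodMk (hsymm.comp p contMDiffAt_snd))
    refine (hw.contMDiff.contMDiffAt.comp p hread).congr_of_eventuallyEq ?_
    filter_upwards [(hopen.preimage continuous_snd).mem_nhds hp] with q hq using if_pos hq
  · have hp' : p ∉ chartSupport c w := by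
      rintro ⟨r, hr, rfl⟩
      exact hp ((extChartAt (𝓡 3) c).map_source
        (hw.subset_source (hw.mem_of_mem_tsupport r hr)))
    refine (contMDiffAt_const (c := (0 : ℂ))).congr_of_eventuallyEq ?_
    filter_upwards [hw.isCompact_chartSupport.isClosed.isOpen_compl.mem_nhds hp'] with q hq
      using chartPull_eq_zero q hq

theorem IsLocalTest.integral_mixedD_chartPull (hw : IsLocalTest c O w) (p q : ℝ × S) :
    ∫ r, mixedD (chartPull c w) ((p, q.1), ofCoords r) *
      (belowSet c O).indicator (fun _ => (1 : ℂ)) (r, q.2) = w (p, q) := by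
  by_cases hq : q.2 ∈ O
  · set octant := lowerOctant (toCoords (extChartAt (𝓡 3) c q.2))
    have hindicator (r : ℝ × ℝ × ℝ) : mixedD (chartPull c w) ((p, q.1), ofCoords r) *
        (belowSet c O).indicator (fun _ => (1 : ℂ)) (r, q.2) =
          octant.indicator (fun r => mixedD (chartPull c w) ((p, q.1), ofCoords r)) r := by
      by_cases hr : r ∈ octant
      · rw [indicator_of_mem hr, indicator_of_mem (show (r, q.2) ∈ belowSet c O from ⟨hq, hr⟩),
          mul_one]
      · rw [indicator_of_notMem hr,
          indicator_of_notMem (show (r, q.2) ∉ belowSet c O from fun h => hr h.2), mul_zero]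
    calc ∫ r, mixedD (chartPull c w) ((p, q.1), ofCoords r) *
          (belowSet c O).indicator (fun _ => (1 : ℂ)) (r, q.2)
        = ∫ r in octant, mixedD (chartPull c w) ((p, q.1), ofCoords r) := by
          simp only [hindicator]
          exact integral_indicator (measurableSet_lowerOctant _)
      _ = chartPull c w ((p, q.1), ofCoords (toCoords (extChartAt (𝓡 3) c q.2))) :=
          setIntegral_lowerOctant_mixedD hw.contMDiff_chartPull hw.isCompact_chartSupport
            chartPull_eq_zero (p, q.1) _
      _ = w (p, q) := by
          rw [ofCoords_toCoords, chartPull_extChartAt (hw.subset_source hq)]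
  · have hzero : w (p, q) = 0 := by
      by_contra hne
      exact hq (hw.mem_of_mem_tsupport _ (subset_tsupport w hne))
    have hbelow (r : ℝ × ℝ × ℝ) : (r, q.2) ∉ belowSet c O := fun h => hq h.1
    simp only [hzero, indicator_of_notMem (hbelow _), mul_zero, integral_zero]

end ChartPull

section SectionL2

variable {X Z : Type*} [MeasurableSpace X] [MeasurableSpace Z] (μ : Measure X) [IsFiniteMeasure μ]
  {B : Set (Z × X)} (hB : MeasurableSet B)

/-- The indicator of the section of `B` over `z`, as an element of `L²`. -/
def sectionL2 (z : Z) : Lp ℂ 2 μ :=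
  indicatorConstLp 2 (hB.preimage measurable_prodMk_left : MeasurableSet (Prod.mk z ⁻¹' B))
    (measure_ne_top μ _) 1

theorem coeFn_sectionL2 (z : Z) :
    sectionL2 μ hB z =ᵐ[μ] fun x => B.indicator (fun _ => (1 : ℂ)) (z, x) :=
  indicatorConstLp_coeFn

theorem norm_sectionL2_le (z : Z) :
    ‖sectionL2 μ hB z‖ ≤ measureUnivNNReal μ ^ (ENNReal.toReal 2)⁻¹ * 1 := by
  refine Lp.norm_le_of_ae_bound zero_le_one ?_
  filter_upwards [coeFn_sectionL2 μ hB z] with x hx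
  rw [hx]
  exact (norm_indicator_le_norm_self _ _).trans norm_one.le

theorem inner_sectionL2 (f : Lp ℂ 2 μ) (z : Z) :
    inner ℂ f (sectionL2 μ hB z) =
      ∫ x, conj (f x) * B.indicator (fun _ => (1 : ℂ)) (z, x) ∂μ := by
  rw [L2.inner_def]
  refine integral_congr_ae ?_
  filter_upwards [coeFn_sectionL2 μ hB z] with x hx
  rw [hx, RCLike.inner_apply, mul_comm]

theorem stronglyMeasurable_inner_sectionL2 (f : Lp ℂ 2 μ) :
    StronglyMeasurable fun z => inner ℂ f (sectionL2 μ hB z) := by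
  simp only [inner_sectionL2]
  refine StronglyMeasurable.integral_prod_right' (f := fun p : Z × X =>
    conj (f p.2) * B.indicator (fun _ => (1 : ℂ)) p) ?_
  exact (Complex.continuous_conj.comp_stronglyMeasurable
    ((Lp.stronglyMeasurable f).comp_measurable measurable_snd)).mul
      (stronglyMeasurable_const.indicator hB)

end SectionL2

section KernelVanishing

variable {S : Type*} [TopologicalSpace S] [ChartedSpace E3 S] {c : S}
  {O : Set S} {w : (ℝ × S) × (ℝ × S) → ℂ}

/-- The parameters `((t, s), r)` of the superposition: two times and the coordinates of the corner
of an octant. -/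
abbrev Params : Type := (ℝ × ℝ) × (ℝ × ℝ × ℝ)

/-- The density with which the product of the point mass at `x` and of the indicator of the octant
above `r` contributes to `w ((t, x), (s, ·))`, see `IsLocalTest.integral_mixedD_chartPull`. -/
def leftFactor (c : S) (w : (ℝ × S) × (ℝ × S) → ℂ) (p : Params × S) : ℂ :=
  mixedD (chartPull c w) (((p.1.1.1, p.2), p.1.1.2), ofCoords p.1.2)

namespace IsLocalTest

theorem measurableSet_belowSet [CompactSpace S] [MeasurableSpace S] [BorelSpace S]
    (hw : IsLocalTest c O w) : MeasurableSet (belowSet c O) :=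
  have : SecondCountableTopology S := ChartedSpace.secondCountable_of_sigmaCompact E3 S
  Ultrastatic.measurableSet_belowSet hw.isOpen hw.subset_source

variable [T2Space S]

theorem exists_mem_tsupport (hw : IsLocalTest c O w) {p : Params × S} (hp : leftFactor c w p ≠ 0) :
    ∃ r ∈ tsupport w, r.1 = (p.1.1.1, p.2) ∧ r.2.1 = p.1.1.2 ∧
      toCoords (extChartAt (𝓡 3) c r.2.2) = p.1.2 := by
  have hmem : (((p.1.1.1, p.2), p.1.1.2), ofCoords p.1.2) ∈ chartSupport c w := by
    contrapose! hp
    exact mixedD_eq_zero hw.isCompact_chartSupport.isClosed chartPull_eq_zero _ hp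
  obtain ⟨r, hr, heq⟩ := hmem
  simp only [Prod.mk.injEq] at heq
  exact ⟨r, hr, heq.1.1, heq.1.2, by rw [heq.2, toCoords_ofCoords]⟩

theorem exists_compact_leftFactor (hw : IsLocalTest c O w) :
    ∃ K : Set Params, IsCompact K ∧ ∀ p : Params × S, p.1 ∉ K → leftFactor c w p = 0 := by
  refine ⟨(fun r : (ℝ × S) × (ℝ × S) => ((r.1.1, r.2.1), toCoords (extChartAt (𝓡 3) c r.2.2))) ''
    tsupport w, ?_, fun p hp => ?_⟩
  · refine IsCompact.image_of_continuousOn hw.hasCompactSupport ?_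
    refine ContinuousOn.prodMk (by fun_prop) (continuous_toCoords.comp_continuousOn ?_)
    exact (continuousOn_extChartAt c).comp (by fun_prop) fun r hr =>
      hw.subset_source (hw.mem_of_mem_tsupport r hr)
  · contrapose! hp
    obtain ⟨r, hr, hfst, htime, hcoords⟩ := hw.exists_mem_tsupport hp
    exact ⟨r, hr, by simp only [hfst, htime, hcoords]⟩

variable [IsManifold (𝓡 3) ∞ S]

theorem continuous_leftFactor (hw : IsLocalTest c O w) : Continuous (leftFactor c w) := by
  have := continuous_ofCoords
  exact (contMDiff_mixedD hw.contMDiff_chartPull).continuous.comp (by fun_prop)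

variable [CompactSpace S]

theorem exists_norm_leftFactor_le (hw : IsLocalTest c O w) : ∃ C, ∀ p, ‖leftFactor c w p‖ ≤ C := by
  obtain ⟨K, hK, hzero⟩ := hw.exists_compact_leftFactor
  exact hw.continuous_leftFactor.bounded_above_of_compact_support
    (HasCompactSupport.intro (hK.prod isCompact_univ) fun p hp =>
      hzero p fun h => hp ⟨h, mem_univ _⟩)

variable [MeasurableSpace S] [BorelSpace S] {h : C11Metric S}

/-- The conjugate of the left factor, as a family of elements of `L²`. -/
def leftL2 (h : C11Metric S) (hw : IsLocalTest c O w) (r : Params) : L2 h :=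
  ContinuousMap.toLp 2 (vol h) ℂ
    ⟨fun x => conj (leftFactor c w (r, x)), Complex.continuous_conj.comp
      (hw.continuous_leftFactor.comp (Continuous.prodMk_right r))⟩

theorem coeFn_leftL2 (hw : IsLocalTest c O w) (r : Params) :
    hw.leftL2 h r =ᵐ[vol h] fun x => conj (leftFactor c w (r, x)) :=
  ContinuousMap.coeFn_toLp _ _

theorem continuous_leftL2 (hw : IsLocalTest c O w) : Continuous (hw.leftL2 h) := by
  let conjFactor : C(Params × S, ℂ) := ⟨fun p => conj (leftFactor c w p),
    Complex.continuous_conj.comp hw.continuous_leftFactor⟩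
  exact (ContinuousMap.toLp 2 (vol h) ℂ).continuous.comp conjFactor.curry.continuous

theorem inner_leftL2 (hw : IsLocalTest c O w) (r : Params) (f : L2 h) :
    inner ℂ (hw.leftL2 h r) f = ∫ x, f x * leftFactor c w (r, x) ∂vol h := by
  rw [L2.inner_def]
  refine integral_congr_ae ?_
  filter_upwards [hw.coeFn_leftL2 r] with x hx
  rw [hx, RCLike.inner_apply, Complex.conj_conj]

theorem leftL2_eq_zero (hw : IsLocalTest c O w) {r : Params}
    (hr : ∀ x, leftFactor c w (r, x) = 0) : hw.leftL2 h r = 0 := by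
  refine Lp.eq_zero_iff_ae_eq_zero.2 ?_
  filter_upwards [hw.coeFn_leftL2 r] with x hx
  rw [hx, hr, map_zero, Pi.zero_apply]

theorem exists_norm_leftL2_le (hw : IsLocalTest c O w) :
    ∃ K : Set Params, IsCompact K ∧
      ∃ C, ∀ r, ‖hw.leftL2 h r‖ ≤ K.indicator (fun _ => C) r := by
  obtain ⟨K, hK, hzero⟩ := hw.exists_compact_leftFactor
  have hleft_zero (r : Params) (hr : r ∉ K) : hw.leftL2 h r = 0 :=
    hw.leftL2_eq_zero fun x => hzero (r, x) hr
  obtain ⟨C, hC⟩ := hw.continuous_leftL2.bounded_above_of_compact_support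
    (HasCompactSupport.intro hK hleft_zero)
  refine ⟨K, hK, C, fun r => ?_⟩
  by_cases hr : r ∈ K
  · simpa only [indicator_of_mem hr] using hC r
  · rw [indicator_of_notMem hr, hleft_zero r hr, norm_zero]

theorem integral_integral_mul (hw : IsLocalTest c O w) (f g : L2 h) (t s : ℝ) :
    ∫ x, ∫ y, f x * conj (g y) * w ((t, x), (s, y)) ∂vol h ∂vol h =
      ∫ r, inner ℂ (hw.leftL2 h ((t, s), r)) f *
        inner ℂ g (sectionL2 (vol h) hw.measurableSet_belowSet r) := by
  have : SecondCountableTopology S := ChartedSpace.secondCountable_of_sigmaCompact E3 S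
  have hf : Integrable f (vol h) := (Lp.memLp f).integrable one_le_two
  have hg : Integrable (fun y => conj (g y)) (vol h) :=
    Complex.conjCLE.toContinuousLinearMap.integrable_comp ((Lp.memLp g).integrable one_le_two)
  obtain ⟨K, hK, hzero⟩ := hw.exists_compact_leftFactor
  obtain ⟨C, hC⟩ := hw.exists_norm_leftFactor_le
  have hK' : IsCompact (Prod.snd '' K) := hK.image continuous_snd
  have hleft : Continuous fun p : (ℝ × ℝ × ℝ) × S => leftFactor c w (((t, s), p.1), p.2) :=
    hw.continuous_leftFactor.comp (by fun_prop)
  have hleft_le (p : (ℝ × ℝ × ℝ) × S) :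
      ‖leftFactor c w (((t, s), p.1), p.2)‖ ≤ (Prod.snd '' K).indicator (fun _ => C) p.1 := by
    by_cases hp : p.1 ∈ Prod.snd '' K
    · simpa only [indicator_of_mem hp] using hC _
    · rw [indicator_of_notMem hp, hzero (((t, s), p.1), p.2) fun h => hp ⟨_, h, rfl⟩, norm_zero]
  have hsuper := integral_integral_mul_superposition (ν := (volume : Measure (ℝ × ℝ × ℝ))) hf hg
    hleft.stronglyMeasurable (stronglyMeasurable_const.indicator hw.measurableSet_belowSet)
    hK'.measurableSet hK'.measure_ne_top hleft_le
    fun p => (norm_indicator_le_norm_self (fun _ => (1 : ℂ)) p).trans norm_one.le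
  have hreproduce (x y : S) : w ((t, x), (s, y)) = ∫ r, leftFactor c w (((t, s), r), x) *
      (belowSet c O).indicator (fun _ => (1 : ℂ)) (r, y) :=
    (hw.integral_mixedD_chartPull (t, x) (s, y)).symm
  simp only [inner_leftL2, inner_sectionL2, hreproduce]
  exact hsuper

end IsLocalTest

variable [IsManifold (𝓡 3) ∞ S] [T2Space S] [CompactSpace S] [MeasurableSpace S] [BorelSpace S]
  {h : C11Metric S} {m : ℝ}
  {hm : 0 < m} {ι : Type*}

theorem causalKernel_eq_integral (hw : IsLocalTest c O w) (b : HilbertBasis ι ℂ (L2 h)) :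
    causalKernel h hm b w = -∫ r : Params, inner ℂ (hw.leftL2 h r)
      (sinOp h hm (r.1.1 - r.1.2) (sectionL2 (vol h) hw.measurableSet_belowSet r.2)) := by
  have : SecondCountableTopology S := ChartedSpace.secondCountable_of_sigmaCompact E3 S
  have : Fact ((2 : ENNReal) ≠ ⊤) := ⟨by norm_num⟩
  have : Countable ι := countable_of_hilbertBasis b
  set section' := sectionL2 (vol h) hw.measurableSet_belowSet
  set D : ℝ := measureUnivNNReal (vol h) ^ (ENNReal.toReal 2)⁻¹ * 1
  obtain ⟨K, hK, C, hC⟩ := hw.exists_norm_leftL2_le (h := h)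
  set F : Params → L2 h := fun r => (sinOp h hm (r.1.1 - r.1.2)).adjoint (hw.leftL2 h r)
  set term : ι → Params → ℂ := fun k r => inner ℂ (F r) (b k) * inner ℂ (b k) (section' r.2)
  have hbound : Integrable (fun r => √‖invA h hm‖ * K.indicator (fun _ => C) r * D) :=
    (((integrable_indicator_iff hK.measurableSet).2
      (integrableOn_const hK.measure_ne_top)).const_mul _).mul_const _
  have hF (r : Params) : ‖F r‖ ≤ √‖invA h hm‖ * K.indicator (fun _ => C) r := by
    refine (ContinuousLinearMap.le_opNorm _ _).trans ?_
    rw [LinearIsometryEquiv.norm_map]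
    exact mul_le_mul (norm_sinOfInv_le _ _) (hC r) (norm_nonneg _) (Real.sqrt_nonneg _)
  have hF_section (r : Params) :
      ‖F r‖ * ‖section' r.2‖ ≤ √‖invA h hm‖ * K.indicator (fun _ => C) r * D :=
    mul_le_mul (hF r) (norm_sectionL2_le _ _ _) (norm_nonneg _) ((norm_nonneg _).trans (hF r))
  have hmeas (k : ι) : AEStronglyMeasurable (term k) volume := by
    have hsin : Continuous fun r : Params => sinOp h hm (r.1.1 - r.1.2) (b k) :=
      (continuous_sinOfInv.comp (by fun_prop)).clm_apply continuous_const
    simp only [term, F, ContinuousLinearMap.adjoint_inner_left]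
    exact (hw.continuous_leftL2.inner hsin).aestronglyMeasurable.mul
      ((stronglyMeasurable_inner_sectionL2 _ _ (b k)).comp_measurable
        measurable_snd).aestronglyMeasurable
  have hterm (k : ι) : Integrable (term k) := by
    refine hbound.mono' (hmeas k) (ae_of_all _ fun r => le_trans ?_ (hF_section r))
    simpa [term, b.orthonormal.1 k] using mul_le_mul (norm_inner_le_norm (𝕜 := ℂ) (F r) (b k))
      (norm_inner_le_norm (𝕜 := ℂ) (b k) (section' r.2)) (norm_nonneg _) (by positivity)
  calc causalKernel h hm b w = -∑' k, ∫ r, term k r := by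
        simp only [causalKernel, hw.integral_integral_mul]
        congr! 3 with k
        simp only [term, F, ContinuousLinearMap.adjoint_inner_left] at hterm ⊢
        exact ((integral_prod _ (hterm k)).trans
          (integral_prod _ (hterm k).integral_prod_left)).symm
    _ = -∫ r : Params, inner ℂ (F r) (section' r.2) := by
        rw [tsum_integral_inner_mul_inner b hbound hF_section hmeas]
    _ = _ := by simp only [F, ContinuousLinearMap.adjoint_inner_left]

theorem causalKernel_eq_zero_of_isShort (hw : IsLocalTest c O w) (b : HilbertBasis ι ℂ (L2 h))
    {ψ : S → ℝ} (hψ : IsShort h ψ) {α β : ℝ} (hright : ∀ y ∈ O, ψ y ≤ α)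
    (hleft : ∀ r ∈ tsupport w, β ≤ ψ r.1.2)
    (htime : ∀ r ∈ tsupport w, |r.1.1 - r.2.1| < β - α) : causalKernel h hm b w = 0 := by
  rw [causalKernel_eq_integral hw b, neg_eq_zero]
  refine integral_eq_zero_of_ae (ae_of_all _ fun r => ?_)
  beta_reduce
  by_cases hr : ∀ x, leftFactor c w (r, x) = 0
  · rw [hw.leftL2_eq_zero hr, inner_zero_left, Pi.zero_apply]
  · push Not at hr
    obtain ⟨x, hx⟩ := hr
    refine inner_sinOp_eq_zero hm hψ (a := α) (b := β) ?_ ?_ ?_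
    · obtain ⟨r', hr', hfst, hsnd, -⟩ := hw.exists_mem_tsupport hx
      simpa only [hfst, hsnd] using htime r' hr'
    · filter_upwards [hw.coeFn_leftL2 r] with y hy hne
      rw [hy, ne_eq, map_eq_zero] at hne
      obtain ⟨r', hr', hfst, -⟩ := hw.exists_mem_tsupport hne
      simpa only [hfst] using hleft r' hr'
    · filter_upwards [coeFn_sectionL2 (vol h) hw.measurableSet_belowSet r.2] with y hy hne
      rw [hy] at hne
      exact hright y (mem_of_indicator_ne_zero hne).1

theorem notMem_distSupport_of_isShort (b : HilbertBasis ι ℂ (L2 h)) {ψ : S → ℝ}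
    (hψ : IsShort h ψ) {p q : ℝ × S} (hpq : |p.1 - q.1| < ψ p.2 - ψ q.2) :
    (p, q) ∉ distSupport (IM.prod IM) (causalKernel h hm b) := by
  rw [distSupport, mem_compl_iff, not_not]
  obtain ⟨ε, hε, hgap⟩ : ∃ ε > 0, |p.1 - q.1| < ψ p.2 - ε - (ψ q.2 + ε) :=
    ⟨(ψ p.2 - ψ q.2 - |p.1 - q.1|) / 3, by linarith, by linarith⟩
  have hψ_cont := hψ.contMDiff.continuous
  set O : Set S := (extChartAt (𝓡 3) q.2).source ∩ {y | ψ y < ψ q.2 + ε}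
  have hO : IsOpen O := (isOpen_extChartAt_source q.2).inter (isOpen_lt hψ_cont continuous_const)
  set W : Set ((ℝ × S) × (ℝ × S)) := {r | |r.1.1 - r.2.1| < ψ p.2 - ε - (ψ q.2 + ε)} ∩
    ({r | ψ p.2 - ε < ψ r.1.2} ∩ {r | r.2.2 ∈ O})
  have hW : IsOpen W := (isOpen_lt (by fun_prop) continuous_const).inter
    ((isOpen_lt continuous_const (by fun_prop)).inter (hO.preimage (by fun_prop)))
  refine ⟨W, ⟨hW, fun w hw hsupp => ?_⟩,
    hgap, sub_lt_self _ hε, mem_extChartAt_source q.2, lt_add_of_pos_right _ hε⟩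
  exact causalKernel_eq_zero_of_isShort
    { hw with
      isOpen := hO
      subset_source := inter_subset_left
      mem_of_mem_tsupport := fun r hr => (hsupp hr).2.2 }
    b hψ (fun y hy => hy.2.le) (fun r hr => (hsupp hr).2.1.le) fun r hr => (hsupp hr).1

end KernelVanishing

section ShortFunctions

variable {S : Type*} [TopologicalSpace S] [ChartedSpace E3 S] {f g : S → ℝ} {x : S}

theorem realD_congr (hfg : f =ᶠ[𝓝 x] g) (v : TangentSpace (𝓡 3) x) :
    realD f x v = realD g x v :=
  congrArg (fun T : E3 →L[ℝ] ℝ => T v) hfg.mfderiv_eq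

theorem realD_const (a : ℝ) (v : TangentSpace (𝓡 3) x) : realD (fun _ : S => a) x v = 0 :=
  congrArg (fun T : E3 →L[ℝ] ℝ => T v) mfderiv_const

theorem realD_comp {F : ℝ → ℝ} {F' : ℝ} (hf : MDifferentiableAt (𝓡 3) 𝓘(ℝ, ℝ) f x)
    (hF : HasDerivAt F F' (f x)) (v : TangentSpace (𝓡 3) x) :
    realD (fun y => F (f y)) x v = F' * realD f x v := by
  have hcomp := hF.hasFDerivAt.hasMFDerivAt.comp x hf.hasMFDerivAt
  exact (congrArg (fun T : E3 →L[ℝ] ℝ => T v) hcomp.mfderiv).trans (mul_comm _ _)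

theorem realD_const_mul (a : ℝ) (hf : MDifferentiableAt (𝓡 3) 𝓘(ℝ, ℝ) f x)
    (v : TangentSpace (𝓡 3) x) : realD (fun y => a * f y) x v = a * realD f x v :=
  realD_comp hf (by simpa using (hasDerivAt_id (f x)).const_mul a) v

theorem realD_mul (hf : MDifferentiableAt (𝓡 3) 𝓘(ℝ, ℝ) f x)
    (hg : MDifferentiableAt (𝓡 3) 𝓘(ℝ, ℝ) g x) (v : TangentSpace (𝓡 3) x) :
    realD (fun y => f y * g y) x v = f x * realD g x v + g x * realD f x v :=
  congrArg (fun T : E3 →L[ℝ] ℝ => T v) (hf.hasMFDerivAt.mul hg.hasMFDerivAt).mfderiv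

variable [IsManifold (𝓡 3) ∞ S] {h : C11Metric S}

theorem sq_inner_le (h : C11Metric S) (x : S) (v w : TangentSpace (𝓡 3) x) :
    h.inner x v w ^ 2 ≤ h.inner x v v * h.inner x w w := by
  have hquad (s : ℝ) :
      0 ≤ h.inner x w w * (s * s) + 2 * h.inner x v w * s + h.inner x v v := by
    have hnonneg := inner_self_nonneg_tangent h x (v + s • w)
    simp only [map_add, map_smul, _root_.add_apply, _root_.smul_apply, smul_eq_mul,
      ← h.symm x v w] at hnonneg
    linarith
  have hdiscrim := discrim_le_zero hquad
  rw [discrim] at hdiscrim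
  linarith

/-- The length of a tangent vector. -/
def tangentNorm (h : C11Metric S) (x : S) (v : TangentSpace (𝓡 3) x) : ℝ :=
  √(h.inner x v v)

theorem tangentNorm_nonneg (x : S) (v : TangentSpace (𝓡 3) x) : 0 ≤ tangentNorm h x v :=
  Real.sqrt_nonneg _

theorem abs_realD_le (f : S → ℝ) (x : S) (v : TangentSpace (𝓡 3) x) :
    |realD f x v| ≤ √(slopeSq h f x) * tangentNorm h x v := by
  rw [tangentNorm, ← Real.sqrt_mul (slopeSq_nonneg h f x)]
  exact Real.abs_le_sqrt (sq_realD_le h f x v)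

theorem IsShort.abs_realD_le (hf : IsShort h f) (x : S) (v : TangentSpace (𝓡 3) x) :
    |realD f x v| ≤ tangentNorm h x v :=
  Real.abs_le_sqrt (hf.sq_le x v)

theorem IsShort.of_abs_le (hf : ContMDiff (𝓡 3) 𝓘(ℝ, ℝ) ∞ f)
    (hle : ∀ x v, |realD f x v| ≤ tangentNorm h x v) : IsShort h f where
  contMDiff := hf
  sq_le x v := by
    rw [← sq_abs]
    exact (Real.le_sqrt (abs_nonneg _) (inner_self_nonneg_tangent h x v)).1 (hle x v)

theorem IsShort.mdifferentiableAt (hf : IsShort h f) : MDifferentiableAt (𝓡 3) 𝓘(ℝ, ℝ) f x :=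
  hf.contMDiff.mdifferentiableAt (by simp)

theorem IsShort.neg (hf : IsShort h f) : IsShort h fun x => -f x where
  contMDiff := contDiff_neg.contMDiff.comp hf.contMDiff
  sq_le x v := by
    rw [realD_comp hf.mdifferentiableAt (hasDerivAt_neg (f x)), neg_one_mul, neg_sq]
    exact hf.sq_le x v

theorem isShort_mul_comp {χ : S → ℝ} {F F' : ℝ → ℝ} {C L δ : ℝ}
    (hχ : ContMDiff (𝓡 3) 𝓘(ℝ, ℝ) ∞ χ) (hχ01 : ∀ x, χ x ∈ Icc 0 1)
    (hχC : ∀ x v, |realD χ x v| ≤ C * tangentNorm h x v)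
    (hf : ContMDiff (𝓡 3) 𝓘(ℝ, ℝ) ∞ f) (hL : 0 ≤ L)
    (hfL : ∀ x, χ x ≠ 0 → ∀ v, |realD f x v| ≤ L * tangentNorm h x v)
    (hF : ContDiff ℝ ∞ F) (hFF' : ∀ t, HasDerivAt F (F' t) t)
    (hFδ : ∀ t, |F t| ≤ δ) (hF'1 : ∀ t, |F' t| ≤ 1) (hle : L + δ * C ≤ 1) :
    IsShort h fun x => χ x * F (f x) := by
  have hFf : ContMDiff (𝓡 3) 𝓘(ℝ, ℝ) ∞ fun x => F (f x) := hF.contMDiff.comp hf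
  refine .of_abs_le (hχ.mul hFf) fun x v => ?_
  rw [realD_mul (hχ.mdifferentiableAt (by simp)) (hFf.mdifferentiableAt (by simp)),
    realD_comp (hf.mdifferentiableAt (by simp)) (hFF' (f x))]
  have hn := tangentNorm_nonneg (h := h) x v
  have hδ : 0 ≤ δ := (abs_nonneg _).trans (hFδ 0)
  have hmain : |χ x * (F' (f x) * realD f x v)| ≤ L * tangentNorm h x v := by
    rcases eq_or_ne (χ x) 0 with hx | hx
    · rw [hx, zero_mul, abs_zero]
      positivity
    · rw [abs_mul, abs_mul, abs_of_nonneg (hχ01 x).1]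
      calc χ x * (|F' (f x)| * |realD f x v|)
          ≤ 1 * (1 * (L * tangentNorm h x v)) := by
            gcongr
            exacts [(hχ01 x).2, hF'1 _, hfL x hx v]
        _ = L * tangentNorm h x v := by ring
  have herror : |F (f x) * realD χ x v| ≤ δ * (C * tangentNorm h x v) := by
    rw [abs_mul]
    exact mul_le_mul (hFδ _) (hχC x v) (abs_nonneg _) hδ
  calc |χ x * (F' (f x) * realD f x v) + F (f x) * realD χ x v|
      ≤ L * tangentNorm h x v + δ * (C * tangentNorm h x v) :=
        (abs_add_le _ _).trans (add_le_add hmain herror)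
    _ = (L + δ * C) * tangentNorm h x v := by ring
    _ ≤ tangentNorm h x v := mul_le_of_le_one_left hn hle

theorem exists_pos_abs_realD_le [CompactSpace S] (h : C11Metric S)
    (hf : ContMDiff (𝓡 3) 𝓘(ℝ, ℝ) ∞ f) :
    ∃ C, 0 < C ∧ ∀ x v, |realD f x v| ≤ C * tangentNorm h x v := by
  obtain ⟨C, hC⟩ := (isCompact_range (continuous_slopeSq h hf)).bddAbove
  refine ⟨√(max C 1), by positivity, fun x v => (abs_realD_le (h := h) f x v).trans ?_⟩
  exact mul_le_mul_of_nonneg_right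
    (Real.sqrt_le_sqrt ((hC ⟨x, rfl⟩).trans (le_max_left _ _))) (tangentNorm_nonneg x v)

theorem exists_isShort_const_mul [CompactSpace S] (h : C11Metric S)
    (hf : ContMDiff (𝓡 3) 𝓘(ℝ, ℝ) ∞ f) : ∃ a, 0 < a ∧ IsShort h fun x => a * f x := by
  obtain ⟨C, hC, hle⟩ := exists_pos_abs_realD_le h hf
  refine ⟨C⁻¹, by positivity, .of_abs_le (contMDiff_const.mul hf) fun x v => ?_⟩
  rw [realD_const_mul _ (hf.mdifferentiableAt (by simp)), abs_mul, abs_of_pos (by positivity),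
    inv_mul_le_iff₀ hC]
  exact hle x v

variable [T2Space S] {c : S}

theorem exists_bump {O : Set S} (hO : O ∈ 𝓝 c) : ∃ χ : S → ℝ,
    ContMDiff (𝓡 3) 𝓘(ℝ, ℝ) ∞ χ ∧ (∀ x, χ x ∈ Icc 0 1) ∧ (∀ x ∉ O, χ x = 0) ∧
      χ =ᶠ[𝓝 c] fun _ => 1 := by
  obtain ⟨χ, -, hχ⟩ := (SmoothBumpFunction.nhds_basis_tsupport (I := 𝓡 3) c).mem_iff.1 hO
  exact ⟨χ, χ.contMDiff, fun x => ⟨χ.nonneg, χ.le_one⟩,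
    fun x hx => image_eq_zero_of_notMem_tsupport fun hx' => hx (hχ hx'), χ.eventuallyEq_one⟩

theorem exists_nhds_contMDiff_eventuallyEq_chart (c : S) : ∃ O ∈ 𝓝 c, ∀ f : E3 → ℝ,
    ContDiff ℝ ∞ f → ∃ F : S → ℝ, ContMDiff (𝓡 3) 𝓘(ℝ, ℝ) ∞ F ∧
      ∀ x ∈ O, F =ᶠ[𝓝 x] fun y => f (extChartAt (𝓡 3) c y) := by
  obtain ⟨χ⟩ : Nonempty (SmoothBumpFunction (𝓡 3) c) := inferInstance
  refine ⟨{x | χ =ᶠ[𝓝 x] 1}, eventually_eventuallyEq_nhds.2 χ.eventuallyEq_one, fun f hf =>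
    ⟨fun x => χ x • f (extChartAt (𝓡 3) c x),
      χ.contMDiff_smul (hf.contMDiff.comp_contMDiffOn contMDiffOn_extChartAt), fun x hx => ?_⟩⟩
  filter_upwards [hx] with y hy
  simp [hy]

theorem exists_contMDiff_eventuallyEq_chart (c : S) {f : E3 → ℝ} (hf : ContDiff ℝ ∞ f) :
    ∃ F : S → ℝ, ContMDiff (𝓡 3) 𝓘(ℝ, ℝ) ∞ F ∧ F =ᶠ[𝓝 c] fun x => f (extChartAt (𝓡 3) c x) := by
  obtain ⟨O, hO, hext⟩ := exists_nhds_contMDiff_eventuallyEq_chart c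
  obtain ⟨F, hF, hFe⟩ := hext f hf
  exact ⟨F, hF, hFe c (mem_of_mem_nhds hO)⟩

theorem exists_realD_eq (c : S) (α : TangentSpace (𝓡 3) c →L[ℝ] ℝ) : ∃ f : S → ℝ,
    ContMDiff (𝓡 3) 𝓘(ℝ, ℝ) ∞ f ∧ f c = 0 ∧ ∀ v, realD f c v = α v := by
  obtain ⟨L, hL⟩ :=
    isInvertible_mfderiv_extChartAt (I := 𝓡 3) (mem_extChartAt_source (I := 𝓡 3) c)
  let L' : E3 ≃L[ℝ] E3 := L
  let α' : E3 →L[ℝ] ℝ := α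
  let β : E3 →L[ℝ] ℝ := α'.comp (L'.symm : E3 →L[ℝ] E3)
  obtain ⟨f, hf, hfβ⟩ := exists_contMDiff_eventuallyEq_chart c β.contDiff
  have hshift (v : TangentSpace (𝓡 3) c) : realD (fun x => f x - f c) c v = realD f c v := by
    simpa using realD_comp (hf.mdifferentiableAt (by simp))
      ((hasDerivAt_id (f c)).sub_const (f c)) v
  have hβ (v : TangentSpace (𝓡 3) c) :
      realD (fun x => β (extChartAt (𝓡 3) c x)) c v = β (L' v) := by
    have hchart : MDifferentiableAt (𝓡 3) 𝓘(ℝ, E3) (extChartAt (𝓡 3) c) c :=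
      mdifferentiableAt_extChartAt (mem_chart_source E3 c)
    have hcomp := (β.hasMFDerivAt (x := extChartAt (𝓡 3) c c)).comp c hchart.hasMFDerivAt
    rw [← hL] at hcomp
    exact congrArg (fun T : E3 →L[ℝ] ℝ => T v) hcomp.mfderiv
  refine ⟨fun x => f x - f c, hf.sub contMDiff_const, sub_self _, fun v => ?_⟩
  exact (hshift v).trans ((realD_congr hfβ v).trans ((hβ v).trans
    (congrArg α' (L'.symm_apply_apply v))))

variable [CompactSpace S]

theorem exists_isShort_ne (h : C11Metric S) {x y : S} (hxy : x ≠ y) :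
    ∃ f, IsShort h f ∧ f x ≠ f y := by
  obtain ⟨χ, hχ, -, hχy, hχx⟩ := exists_bump (isOpen_compl_singleton.mem_nhds hxy)
  obtain ⟨a, ha, hshort⟩ := exists_isShort_const_mul h hχ
  refine ⟨_, hshort, ?_⟩
  simp [hχy y (by simp), hχx.eq_of_nhds, ha.ne']

theorem hasDerivAt_mul_sin_div {δ : ℝ} (hδ : δ ≠ 0) (t : ℝ) :
    HasDerivAt (fun t => δ * Real.sin (t / δ)) (Real.cos (t / δ)) t := by
  refine ((((hasDerivAt_id' t).div_const δ).sin).const_mul δ).congr_deriv ?_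
  field_simp

theorem exists_isShort_realD_eq (hf : ContMDiff (𝓡 3) 𝓘(ℝ, ℝ) ∞ f) (hfc : f c = 0)
    (hslope : slopeSq h f c < 1) : ∃ ψ, IsShort h ψ ∧ ∀ v, realD ψ c v = realD f c v := by
  obtain ⟨θ, hcθ, hθ1⟩ := exists_between hslope
  have hO : {x | slopeSq h f x < θ} ∈ 𝓝 c :=
    (isOpen_lt (continuous_slopeSq h hf) continuous_const).mem_nhds hcθ
  obtain ⟨χ, hχ, hχ01, hχO, hχc⟩ := exists_bump hO
  obtain ⟨C, hC, hχC⟩ := exists_pos_abs_realD_le h hχ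
  have hθ : √θ < 1 := (Real.sqrt_lt' one_pos).2 (by simpa using hθ1)
  -- Replacing `f` by the uniformly small `δ sin (f / δ)`, which has the same differential at `c`
  -- and nowhere a larger one, makes the differential of the cutoff `χ` harmless.
  set δ := (1 - √θ) / C with hδ
  have hδ0 : 0 < δ := div_pos (by linarith) hC
  refine ⟨fun x => χ x * (δ * Real.sin (f x / δ)), isShort_mul_comp hχ hχ01 hχC hf
    (Real.sqrt_nonneg θ) (fun x hx v => ?_) (F := fun t => δ * Real.sin (t / δ))
    (by fun_prop) (hasDerivAt_mul_sin_div hδ0.ne') (δ := δ) (fun t => ?_)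
    (fun t => Real.abs_cos_le_one _) (by rw [hδ, div_mul_cancel₀ _ hC.ne']; linarith),
    fun v => ?_⟩
  · have hxθ : slopeSq h f x < θ := not_imp_comm.1 (hχO x) hx
    exact (abs_realD_le f x v).trans
      (mul_le_mul_of_nonneg_right (Real.sqrt_le_sqrt hxθ.le) (tangentNorm_nonneg x v))
  · rw [abs_mul, abs_of_pos hδ0]
    exact mul_le_of_le_one_right hδ0.le (Real.abs_sin_le_one _)
  · have heq : (fun x => χ x * (δ * Real.sin (f x / δ))) =ᶠ[𝓝 c]
        fun x => δ * Real.sin (f x / δ) := by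
      filter_upwards [hχc] with x hx
      rw [hx, one_mul]
    rw [realD_congr heq, realD_comp (hf.mdifferentiableAt (by simp))
      (hasDerivAt_mul_sin_div hδ0.ne' (f c)), hfc, zero_div, Real.cos_zero, one_mul]

end ShortFunctions

section CausalCurves

theorem exists_lipschitzWith_toLp {X ι : Type*} [PseudoEMetricSpace X] [Fintype ι]
    {f : ι → X → ℝ} (hf : ∀ i, ∃ K, LipschitzWith K (f i)) :
    ∃ C, LipschitzWith C fun x => WithLp.toLp 2 fun i => f i x := by
  choose K hK using hf
  have hle (i : ι) : LipschitzWith (∑ j, K j) (f i) :=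
    (hK i).weaken (Finset.single_le_sum_of_canonicallyOrdered (Finset.mem_univ i))
  have hpi : LipschitzWith (∑ j, K j) fun x i => f i x :=
    fun x y => edist_pi_le_iff.2 fun i => hle i x y
  exact ⟨_, (PiLp.lipschitzWith_toLp 2 fun _ : ι => ℝ).comp hpi⟩

variable {S : Type*} [TopologicalSpace S] [ChartedSpace E3 S] {γ : ℝ → S} {c : S} {t : ℝ}

theorem velocity_prodMk (t₀ : ℝ) (hγ : MDifferentiableAt 𝓘(ℝ, ℝ) (𝓡 3) γ t) :
    velocity (fun s => (t₀ + s, γ s)) t =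
      ((1 : ℝ), (mfderiv 𝓘(ℝ, ℝ) (𝓡 3) γ t (1 : ℝ) : E3)) := by
  have htime := ((hasDerivAt_id t).const_add t₀).hasFDerivAt.hasMFDerivAt
  refine (congrArg (fun T : ℝ →L[ℝ] ℝ × E3 => T 1)
    (mfderiv_prodMk htime.mdifferentiableAt hγ)).trans (Prod.ext ?_ rfl)
  exact (congrArg (fun T : ℝ →L[ℝ] ℝ => T 1) htime.mfderiv).trans (one_smul ℝ (1 : ℝ))

variable [IsManifold (𝓡 3) ∞ S]

theorem mdifferentiableAt_chart_symm {z : E3} (hz : z ∈ (extChartAt (𝓡 3) c).target) :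
    MDifferentiableAt 𝓘(ℝ, E3) (𝓡 3) (extChartAt (𝓡 3) c).symm z := by
  have hwithin := mdifferentiableWithinAt_extChartAt_symm (I := 𝓡 3) hz
  rwa [ModelWithCorners.range_eq_univ, mdifferentiableWithinAt_univ] at hwithin

theorem mdifferentiableAt_of_extChartAt (hsrc : ∀ᶠ s in 𝓝 t, γ s ∈ (extChartAt (𝓡 3) c).source)
    (hd : DifferentiableAt ℝ (extChartAt (𝓡 3) c ∘ γ) t) :
    MDifferentiableAt 𝓘(ℝ, ℝ) (𝓡 3) γ t := by
  have hsymm : MDifferentiableAt 𝓘(ℝ, E3) (𝓡 3) (extChartAt (𝓡 3) c).symm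
      ((extChartAt (𝓡 3) c ∘ γ) t) :=
    mdifferentiableAt_chart_symm ((extChartAt (𝓡 3) c).map_source hsrc.self_of_nhds)
  refine (hsymm.comp t hd.mdifferentiableAt).congr_of_eventuallyEq ?_
  filter_upwards [hsrc] with s hs
  exact ((extChartAt (𝓡 3) c).left_inv hs).symm

variable {h : C11Metric S}

variable (h) in
/-- The curves along which all short functions are `1`-Lipschitz: a substitute for curves of speed
at most `1` that does not presuppose differentiability and is stable under pointwise limits. -/
def IsShortCurve (γ : ℝ → S) : Prop :=
  ∀ ψ, IsShort h ψ → ∀ s t, |ψ (γ s) - ψ (γ t)| ≤ |s - t|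

theorem IsShortCurve.abs_realD_le_one (hγ : IsShortCurve h γ)
    (hd : MDifferentiableAt 𝓘(ℝ, ℝ) (𝓡 3) γ t) {ψ : S → ℝ} (hψ : IsShort h ψ) :
    |realD ψ (γ t) (mfderiv 𝓘(ℝ, ℝ) (𝓡 3) γ t (1 : ℝ))| ≤ 1 := by
  have hcomp : HasFDerivAt (ψ ∘ γ) ((realD ψ (γ t) : E3 →L[ℝ] ℝ).comp
      (mfderiv 𝓘(ℝ, ℝ) (𝓡 3) γ t : ℝ →L[ℝ] E3)) t :=
    (hψ.mdifferentiableAt.hasMFDerivAt.comp t hd.hasMFDerivAt).hasFDerivAt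
  refine hcomp.hasDerivAt.le_of_lip' zero_le_one (.of_forall fun s => ?_)
  rw [one_mul]
  exact hγ ψ hψ s t

variable [CompactSpace S]

theorem IsShortCurve.exists_lipschitzWith_comp (hγ : IsShortCurve h γ) {f : S → ℝ}
    (hf : ContMDiff (𝓡 3) 𝓘(ℝ, ℝ) ∞ f) : ∃ K, LipschitzWith K (f ∘ γ) := by
  obtain ⟨a, ha, hshort⟩ := exists_isShort_const_mul h hf
  refine ⟨Real.toNNReal a⁻¹, LipschitzWith.of_dist_le_mul fun s t => ?_⟩
  have hle := hγ _ hshort s t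
  rw [← mul_sub, abs_mul, abs_of_pos ha] at hle
  rw [Real.coe_toNNReal _ (inv_nonneg.2 ha.le), Real.dist_eq, Real.dist_eq, inv_mul_eq_div,
    le_div_iff₀' ha]
  exact hle

variable [T2Space S]

theorem IsShortCurve.continuous (hγ : IsShortCurve h γ) : Continuous γ := by
  refine continuous_iff_continuousAt.2 fun t => le_nhds_of_unique_clusterPt fun x hx => ?_
  by_contra hne
  obtain ⟨ψ, hψ, hψne⟩ := exists_isShort_ne h hne
  have hlim : Tendsto (fun s => ψ (γ s)) (𝓝 t) (𝓝 (ψ (γ t))) := by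
    refine tendsto_iff_dist_tendsto_zero.2
      (squeeze_zero (fun s => dist_nonneg) (fun s => hγ ψ hψ s t) ?_)
    have habs : Continuous fun s : ℝ => |s - t| := by fun_prop
    simpa using habs.tendsto t
  have hcluster : ClusterPt (ψ x) (map ψ (map γ (𝓝 t))) :=
    hx.map hψ.contMDiff.continuous.continuousAt tendsto_map
  have hcluster' : ClusterPt (ψ x) (𝓝 (ψ (γ t))) := hcluster.mono hlim
  exact hψne (eq_of_nhds_neBot hcluster')

theorem IsShortCurve.exists_lipschitzOnWith (hγ : IsShortCurve h γ) (t : ℝ) :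
    ∃ K, ∃ u, IsOpen u ∧ t ∈ u ∧ (∀ s ∈ u, γ s ∈ (extChartAt (𝓡 3) (γ t)).source) ∧
      LipschitzOnWith K (extChartAt (𝓡 3) (γ t) ∘ γ) u := by
  choose f hf hfe using fun i : Fin 3 =>
    exists_contMDiff_eventuallyEq_chart (γ t) (EuclideanSpace.proj i : E3 →L[ℝ] ℝ).contDiff
  have hV : ∀ᶠ x in 𝓝 (γ t), x ∈ (extChartAt (𝓡 3) (γ t)).source ∧
      ∀ i, f i x = extChartAt (𝓡 3) (γ t) x i :=
    Filter.Eventually.and (extChartAt_source_mem_nhds (γ t)) (eventually_all.2 hfe)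
  obtain ⟨u, hu, huo, htu⟩ := mem_nhds_iff.1 (hγ.continuous.continuousAt hV)
  obtain ⟨K, hK⟩ := exists_lipschitzWith_toLp fun i => hγ.exists_lipschitzWith_comp (hf i)
  have heq (s : ℝ) (hs : s ∈ u) :
      (extChartAt (𝓡 3) (γ t) ∘ γ) s = WithLp.toLp 2 fun i => (f i ∘ γ) s :=
    PiLp.ext fun i => ((hu hs).2 i).symm
  refine ⟨K, u, huo, htu, fun s hs => (hu hs).1, fun s hs s' hs' => ?_⟩
  rw [heq s hs, heq s' hs']
  exact hK s s'

theorem IsShortCurve.ae_mdifferentiableAt (hγ : IsShortCurve h γ) :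
    ∀ᵐ t, MDifferentiableAt 𝓘(ℝ, ℝ) (𝓡 3) γ t := by
  rw [ae_iff]
  refine measure_null_of_locally_null _ fun t _ => ?_
  obtain ⟨K, u, huo, htu, hsrc, hlip⟩ := hγ.exists_lipschitzOnWith t
  refine ⟨{s | ¬MDifferentiableAt 𝓘(ℝ, ℝ) (𝓡 3) γ s} ∩ u,
    inter_mem self_mem_nhdsWithin (mem_nhdsWithin_of_mem_nhds (huo.mem_nhds htu)), ?_⟩
  refine measure_mono_null ?_ (ae_iff.1 (hlip.ae_differentiableWithinAt_of_mem (μ := volume)))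
  rintro s ⟨hs, hsu⟩ hd
  have hu : u ∈ 𝓝 s := huo.mem_nhds hsu
  exact hs (mdifferentiableAt_of_extChartAt (mem_of_superset hu hsrc)
    ((hd hsu).differentiableAt hu))

theorem exists_isShort_one_lt_realD {v : TangentSpace (𝓡 3) c} (hv : 1 < h.inner c v v) :
    ∃ ψ, IsShort h ψ ∧ 1 < realD ψ c v := by
  set n := h.inner c v v with hn
  -- Any factor strictly between `1 / n` and `1 / √n` would do.
  obtain ⟨f, hf, hfc, hfd⟩ := exists_realD_eq c ((2 / (n + 1)) • h.inner c v)
  have hfd' (w : TangentSpace (𝓡 3) c) : realD f c w = 2 / (n + 1) * h.inner c v w := hfd w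
  have hslope : slopeSq h f c ≤ (2 / (n + 1)) ^ 2 * n := by
    refine slopeSq_le (by positivity) fun w => ?_
    rw [hfd', mul_pow, mul_assoc]
    gcongr
    exact sq_inner_le h c v w
  have hlt : (2 / (n + 1)) ^ 2 * n < 1 := by
    rw [div_pow, div_mul_eq_mul_div, div_lt_one (by positivity)]
    nlinarith
  obtain ⟨ψ, hψ, hψd⟩ := exists_isShort_realD_eq hf hfc (hslope.trans_lt hlt)
  refine ⟨ψ, hψ, ?_⟩
  rw [hψd, hfd', ← hn, div_mul_eq_mul_div, one_lt_div (by positivity)]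
  linarith

theorem IsShortCurve.inner_le_one (hγ : IsShortCurve h γ)
    (hd : MDifferentiableAt 𝓘(ℝ, ℝ) (𝓡 3) γ t) :
    h.inner (γ t) (mfderiv 𝓘(ℝ, ℝ) (𝓡 3) γ t (1 : ℝ)) (mfderiv 𝓘(ℝ, ℝ) (𝓡 3) γ t (1 : ℝ)) ≤ 1 := by
  by_contra! hlt
  obtain ⟨ψ, hψ, hψlt⟩ := exists_isShort_one_lt_realD hlt
  exact absurd ((le_abs_self _).trans (hγ.abs_realD_le_one hd hψ)) hψlt.not_ge

theorem IsShortCurve.isFutureCausal (hγ : IsShortCurve h γ) (t₀ a b : ℝ) :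
    IsFutureCausal h (fun s => (t₀ + s, γ s)) a b where
  continuousOn := ((continuous_const.add continuous_id).prodMk hγ.continuous).continuousOn
  lipschitz t _ := by
    obtain ⟨K, u, huo, htu, -, hlip⟩ := hγ.exists_lipschitzOnWith t
    have htime : LipschitzOnWith 1 (fun s : ℝ => t₀ + s) u :=
      (LipschitzWith.of_dist_le_mul fun x y => by simp).lipschitzOnWith
    exact ⟨max 1 K, u, mem_nhdsWithin_of_mem_nhds (huo.mem_nhds htu), htime.prodMk hlip⟩
  causal := by
    filter_upwards [hγ.ae_mdifferentiableAt] with t ht _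
    have htime : MDifferentiableAt 𝓘(ℝ, ℝ) 𝓘(ℝ, ℝ) (fun s : ℝ => t₀ + s) t :=
      ((differentiableAt_id).const_add t₀).mdifferentiableAt
    refine ⟨htime.prodMk ht, ?_, ?_⟩
    · have hspeed := hγ.inner_le_one ht
      rw [velocity_prodMk t₀ ht]
      change 0 ≤ (1 : ℝ) * 1 - h.inner (γ t) (mfderiv 𝓘(ℝ, ℝ) (𝓡 3) γ t (1 : ℝ))
        (mfderiv 𝓘(ℝ, ℝ) (𝓡 3) γ t (1 : ℝ))
      linarith
    · rw [velocity_prodMk t₀ ht]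
      exact one_pos

end CausalCurves

section Mollify

variable {E : Type*} [NormedAddCommGroup E] {f g N : E → ℝ} {a b z₀ : E} {r : ℝ}

theorem continuousOn_of_abs_sub_le (hN : Continuous N) (hN0 : N 0 = 0) {B : Set E}
    (hg : ∀ a ∈ B, ∀ b ∈ B, |g a - g b| ≤ N (a - b)) : ContinuousOn g B := by
  intro b hb
  have hlim : Tendsto (fun a => N (a - b)) (𝓝[B] b) (𝓝 0) := by
    have hcont : Continuous fun a => N (a - b) := by fun_prop
    simpa [hN0] using (hcont.tendsto b).mono_left nhdsWithin_le_nhds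
  refine tendsto_iff_dist_tendsto_zero.2 (squeeze_zero' (.of_forall fun _ => dist_nonneg) ?_ hlim)
  filter_upwards [self_mem_nhdsWithin] with a ha
  exact hg a ha b hb

variable [NormedSpace ℝ E]

theorem abs_fderiv_le (hN : ∀ (a : ℝ) v, N (a • v) = |a| * N v) (hN0 : ∀ v, 0 ≤ N v) {U : Set E}
    (hU : U ∈ 𝓝 z₀) (hf : DifferentiableAt ℝ f z₀)
    (hlip : ∀ a ∈ U, ∀ b ∈ U, |f a - f b| ≤ N (a - b)) (v : E) : |fderiv ℝ f z₀ v| ≤ N v := by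
  have hline : HasDerivAt (fun s : ℝ => z₀ + s • v) v 0 := by
    simpa using ((hasDerivAt_id (0 : ℝ)).smul_const v).const_add z₀
  have hz₀ : z₀ + (0 : ℝ) • v = z₀ := by simp
  have hderiv : HasDerivAt (fun s : ℝ => f (z₀ + s • v)) (fderiv ℝ f z₀ v) 0 :=
    (hz₀.symm ▸ hf.hasFDerivAt : HasFDerivAt f _ (z₀ + (0 : ℝ) • v)).comp_hasDerivAt 0 hline
  have hmem : ∀ᶠ s in 𝓝 (0 : ℝ), z₀ + s • v ∈ U := by
    refine hline.continuousAt.eventually ?_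
    beta_reduce
    rwa [hz₀]
  refine hderiv.le_of_lip' (hN0 v) ?_
  filter_upwards [hmem] with s hs
  have hle := hlip _ hs z₀ (mem_of_mem_nhds hU)
  rw [add_sub_cancel_left, hN] at hle
  simpa [mul_comm] using hle

variable [FiniteDimensional ℝ E]

theorem eventually_norm_le_mul {Z : Type*} [TopologicalSpace Z] {Q : Z → E → ℝ} {z₀ : Z}
    (hQ : ∀ v, ContinuousAt (fun p : Z × E => Q p.1 p.2) (z₀, v))
    (hhom : ∀ z (a : ℝ) v, Q z (a • v) = |a| * Q z v) (hpos : ∀ v, v ≠ 0 → 0 < Q z₀ v)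
    {κ : ℝ} (hκ : 1 < κ) : ∀ᶠ z in 𝓝 z₀, ∀ v, Q z v ≤ κ * Q z₀ v ∧ Q z₀ v ≤ κ * Q z v := by
  have hsphere : ∀ᶠ z in 𝓝 z₀, ∀ v ∈ Metric.sphere (0 : E) 1,
      Q z v ≤ κ * Q z₀ v ∧ Q z₀ v ≤ κ * Q z v := by
    refine (isCompact_sphere (0 : E) 1).eventually_forall_of_forall_eventually fun v hv => ?_
    have hv0 : v ≠ 0 := Metric.ne_of_mem_sphere hv one_ne_zero
    have hlt : Q z₀ v < κ * Q z₀ v := lt_mul_of_one_lt_left (hpos v hv0) hκ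
    have hfrozen : ContinuousAt (fun p : Z × E => Q z₀ p.2) (z₀, v) :=
      ContinuousAt.comp (g := fun p : Z × E => Q p.1 p.2) (f := fun p : Z × E => (z₀, p.2))
        (hQ v) (by fun_prop)
    filter_upwards [(hQ v).eventually_lt (continuousAt_const.mul hfrozen) hlt,
      hfrozen.eventually_lt (continuousAt_const.mul (hQ v)) hlt] with p hp hp'
    exact ⟨hp.le, hp'.le⟩
  filter_upwards [hsphere] with z hz v
  rcases eq_or_ne v 0 with rfl | hv
  · have hzero (z : Z) : Q z 0 = 0 := by simpa using hhom z 0 0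
    simp [hzero]
  · have hunit := hz (‖v‖⁻¹ • v) (by simp [norm_smul, norm_ne_zero_iff.2 hv])
    have hn : 0 < |‖v‖⁻¹| := by positivity
    rw [hhom, hhom, mul_left_comm, mul_left_comm κ] at hunit
    exact ⟨le_of_mul_le_mul_left hunit.1 hn, le_of_mul_le_mul_left hunit.2 hn⟩

section Measure

variable [MeasurableSpace E] [BorelSpace E] {μ : Measure E} [μ.IsAddHaarMeasure]

theorem integrableOn_ball_of_abs_sub_le (hN : Continuous N) (hN0 : N 0 = 0) (hr : 0 < r)
    (hg : ∀ a ∈ Metric.ball z₀ r, ∀ b ∈ Metric.ball z₀ r, |g a - g b| ≤ N (a - b)) :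
    IntegrableOn g (Metric.ball z₀ r) μ := by
  have hmeas : MeasurableSet (Metric.ball z₀ r) := Metric.isOpen_ball.measurableSet
  obtain ⟨C, hC⟩ := ((isCompact_closedBall z₀ r).image
    (by fun_prop : Continuous fun a => N (a - z₀))).bddAbove
  refine Integrable.mono' (integrableOn_const (C := C + |g z₀|) measure_ball_lt_top.ne)
    ((continuousOn_of_abs_sub_le hN hN0 hg).aestronglyMeasurable hmeas)
    ((ae_restrict_iff' hmeas).2 (ae_of_all _ fun a ha => ?_))
  calc ‖g a‖ ≤ |g a - g z₀| + |g z₀| := by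
        simpa using norm_add_le (g a - g z₀) (g z₀)
    _ ≤ C + |g z₀| := by
        gcongr
        exact (hg a ha z₀ (Metric.mem_ball_self hr)).trans
          (hC ⟨a, Metric.ball_subset_closedBall ha, rfl⟩)

theorem abs_convolution_sub_le (ρ : ContDiffBump (0 : E)) (hg : LocallyIntegrable g μ) {C : ℝ}
    (hC : ∀ t ∈ Metric.ball 0 ρ.rOut, |g (a - t) - g (b - t)| ≤ C) :
    |convolution (ρ.normed μ) g (ContinuousLinearMap.lsmul ℝ ℝ) μ a -
      convolution (ρ.normed μ) g (ContinuousLinearMap.lsmul ℝ ℝ) μ b| ≤ C := by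
  have hexists : ConvolutionExists (ρ.normed μ) g (ContinuousLinearMap.lsmul ℝ ℝ) μ :=
    ρ.hasCompactSupport_normed.convolutionExists_left _ ρ.continuous_normed hg
  rw [convolution_def, convolution_def, ← integral_sub (hexists a) (hexists b), ← Real.norm_eq_abs]
  calc _ ≤ ∫ t, ρ.normed μ t * C ∂μ := by
        refine norm_integral_le_of_norm_le (ρ.integrable_normed.mul_const _)
          (ae_of_all _ fun t => ?_)
        rw [ContinuousLinearMap.lsmul_apply, ContinuousLinearMap.lsmul_apply, ← smul_sub,
          norm_smul, Real.norm_of_nonneg (ρ.nonneg_normed t), Real.norm_eq_abs]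
        rcases eq_or_ne (ρ.normed μ t) 0 with ht | ht
        · simp [ht]
        · have hball : t ∈ Metric.ball 0 ρ.rOut := ρ.support_normed_eq (μ := μ) ▸ ht
          exact mul_le_mul_of_nonneg_left (hC t hball) (ρ.nonneg_normed t)
    _ = C := by rw [integral_mul_const, ρ.integral_normed, one_mul]

end Measure

theorem exists_contDiff_approx (hN : Continuous N) (hN0 : N 0 = 0) (hr : 0 < r)
    (hg : ∀ a ∈ Metric.ball z₀ r, ∀ b ∈ Metric.ball z₀ r, |g a - g b| ≤ N (a - b))
    {ξ : ℝ} (hξ : 0 < ξ) : ∃ f : E → ℝ, ContDiff ℝ ∞ f ∧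
      (∀ a ∈ Metric.ball z₀ (r / 2), |f a - g a| ≤ ξ) ∧
      ∀ a ∈ Metric.ball z₀ (r / 2), ∀ b ∈ Metric.ball z₀ (r / 2), |f a - f b| ≤ N (a - b) := by
  borelize E
  let μ : Measure E := Measure.addHaar
  set B := Metric.ball z₀ r
  have hGint : Integrable (B.indicator g) μ :=
    (integrable_indicator_iff Metric.isOpen_ball.measurableSet).2
      (integrableOn_ball_of_abs_sub_le hN hN0 hr hg)
  have hG {a b : E} (ha : a ∈ B) (hb : b ∈ B) :
      |B.indicator g a - B.indicator g b| ≤ N (a - b) := by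
    rw [indicator_of_mem ha, indicator_of_mem hb]
    exact hg a ha b hb
  obtain ⟨δ, hδ, hNδ⟩ : ∃ δ > 0, ∀ w : E, ‖w‖ < δ → N w < ξ := by
    obtain ⟨δ, hδ, hlt⟩ := Metric.eventually_nhds_iff.1
      (hN.continuousAt.eventually (hN0 ▸ eventually_lt_nhds hξ))
    exact ⟨δ, hδ, fun w hw => hlt (by simpa using hw)⟩
  set R := min δ (r / 2)
  have hR : 0 < R := lt_min hδ (by linarith)
  let ρ : ContDiffBump (0 : E) := ⟨R / 2, R, by linarith, by linarith⟩
  have hsub {a x : E} (ha : a ∈ Metric.ball z₀ (r / 2)) (hx : x ∈ Metric.ball a R) : x ∈ B := by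
    refine Metric.ball_subset_ball' ?_ hx
    linarith [min_le_right δ (r / 2), Metric.mem_ball.1 ha]
  refine ⟨convolution (ρ.normed μ) (B.indicator g) (ContinuousLinearMap.lsmul ℝ ℝ) μ,
    ρ.hasCompactSupport_normed.contDiff_convolution_left _ ρ.contDiff_normed
      hGint.locallyIntegrable, fun a ha => ?_, fun a ha b hb => ?_⟩
  · have haB : a ∈ B := hsub ha (Metric.mem_ball_self hR)
    rw [← indicator_of_mem haB g, ← Real.dist_eq]
    refine ρ.dist_normed_convolution_le hGint.aestronglyMeasurable fun x hx => ?_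
    have hxδ : ‖x - a‖ < δ := (dist_eq_norm x a ▸ Metric.mem_ball.1 hx).trans_le (min_le_left _ _)
    exact (hG (hsub ha hx) haB).trans (hNδ _ hxδ).le
  · refine abs_convolution_sub_le ρ hGint.locallyIntegrable fun t ht => ?_
    have hshift {a : E} (ha : a ∈ Metric.ball z₀ (r / 2)) : a - t ∈ B :=
      hsub ha (by simpa [dist_eq_norm] using ht)
    simpa using hG (hshift ha) (hshift hb)

end Mollify

section ChartNorm

variable {S : Type*} [TopologicalSpace S] [ChartedSpace E3 S] {c : S} {z : E3}

/-- The differential of the inverse of a chart. -/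
def chartD (c : S) (z : E3) : E3 →L[ℝ] TangentSpace (𝓡 3) ((extChartAt (𝓡 3) c).symm z) :=
  mfderiv 𝓘(ℝ, E3) (𝓡 3) (extChartAt (𝓡 3) c).symm z

variable [IsManifold (𝓡 3) ∞ S] {h : C11Metric S}

theorem exists_equiv_eq_chartD (hz : z ∈ (extChartAt (𝓡 3) c).target) :
    ∃ L : E3 ≃L[ℝ] E3, ∀ v, L v = chartD c z v := by
  obtain ⟨L, hL⟩ := isInvertible_mfderivWithin_extChartAt_symm (I := 𝓡 3) hz
  rw [ModelWithCorners.range_eq_univ, mfderivWithin_univ] at hL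
  exact ⟨L, fun v => congrArg (fun T : E3 →L[ℝ] E3 => T v) hL⟩

theorem hasFDerivAt_comp_chart_symm {f : S → ℝ}
    (hf : MDifferentiableAt (𝓡 3) 𝓘(ℝ, ℝ) f ((extChartAt (𝓡 3) c).symm z))
    (hz : z ∈ (extChartAt (𝓡 3) c).target) :
    HasFDerivAt (fun z => f ((extChartAt (𝓡 3) c).symm z))
      ((realD f ((extChartAt (𝓡 3) c).symm z) : E3 →L[ℝ] ℝ).comp (chartD c z : E3 →L[ℝ] E3)) z :=
  (hf.hasMFDerivAt.comp z (mdifferentiableAt_chart_symm hz).hasMFDerivAt).hasFDerivAt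

/-- The length of the tangent vector with coordinates `v` at the point with coordinates `z`, in the
chart at `c`. -/
def chartNorm (h : C11Metric S) (c : S) (z v : E3) : ℝ :=
  tangentNorm h ((extChartAt (𝓡 3) c).symm z) (chartD c z v)

theorem chartNorm_eq (h : C11Metric S) (c : S) (z v : E3) : chartNorm h c z v =
    √(v.ofLp ⬝ᵥ (coordMatrix h.toContinuousRiemannianMetric c z).mulVec v.ofLp) :=
  let B : E3 →L[ℝ] E3 →L[ℝ] ℝ := h.inner ((extChartAt (𝓡 3) c).symm z)
  let L : E3 →L[ℝ] E3 := chartD c z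
  congrArg Real.sqrt (bilin_eq_dotProduct (B.bilinearComp L L) v)

theorem chartNorm_nonneg (v : E3) : 0 ≤ chartNorm h c z v := tangentNorm_nonneg _ _

theorem chartNorm_smul (a : ℝ) (v : E3) : chartNorm h c z (a • v) = |a| * chartNorm h c z v := by
  rw [chartNorm_eq, chartNorm_eq, WithLp.ofLp_smul, Matrix.mulVec_smul, dotProduct_smul,
    smul_dotProduct, smul_smul, smul_eq_mul, Real.sqrt_mul (mul_self_nonneg a),
    Real.sqrt_mul_self_eq_abs]

theorem chartNorm_pos (hz : z ∈ (extChartAt (𝓡 3) c).target) {v : E3} (hv : v ≠ 0) :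
    0 < chartNorm h c z v := by
  obtain ⟨L, hL⟩ := exists_equiv_eq_chartD hz
  refine Real.sqrt_pos.2 (h.pos _ _ fun h0 => hv ?_)
  exact L.map_eq_zero_iff.1 ((hL v).trans h0)

theorem continuousAt_chartNorm (h : C11Metric S) (hz : z ∈ (extChartAt (𝓡 3) c).target) (v : E3) :
    ContinuousAt (fun p : E3 × E3 => chartNorm h c p.1 p.2) (z, v) := by
  have hcoord (i j : Fin 3) : ContinuousAt (fun p : E3 × E3 =>
      coordMatrix h.toContinuousRiemannianMetric c p.1 i j) (z, v) :=
    ContinuousAt.comp (g := fun z => coordMatrix h.toContinuousRiemannianMetric c z i j)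
      (f := fun p : E3 × E3 => p.1)
      ((h.contDiffOn_coord c i j).continuousOn.continuousAt
        ((isOpen_extChartAt_target c).mem_nhds hz)) continuousAt_fst
  have hvec (i : Fin 3) : ContinuousAt (fun p : E3 × E3 => p.2 i) (z, v) :=
    Continuous.continuousAt (by fun_prop)
  simp only [chartNorm_eq, dotProduct, Matrix.mulVec]
  refine ContinuousAt.sqrt ?_
  exact tendsto_finsetSum _ fun i _ => (hvec i).mul
    (tendsto_finsetSum _ fun j _ => (hcoord i j).mul (hvec j))

theorem continuous_chartNorm_apply (h : C11Metric S) (hz : z ∈ (extChartAt (𝓡 3) c).target) :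
    Continuous (chartNorm h c z) :=
  continuous_iff_continuousAt.2 fun v =>
    ContinuousAt.comp (g := fun p : E3 × E3 => chartNorm h c p.1 p.2) (f := fun v : E3 => (z, v))
      (continuousAt_chartNorm h hz v) (by fun_prop)

theorem IsShort.abs_sub_le_chartNorm {ψ : S → ℝ} (hψ : IsShort h ψ) {z₀ : E3} {r κ : ℝ}
    (htarget : Metric.ball z₀ r ⊆ (extChartAt (𝓡 3) c).target)
    (hκ : ∀ z ∈ Metric.ball z₀ r, ∀ v, chartNorm h c z v ≤ κ * chartNorm h c z₀ v)
    {a b : E3} (ha : a ∈ Metric.ball z₀ r) (hb : b ∈ Metric.ball z₀ r) :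
    |ψ ((extChartAt (𝓡 3) c).symm a) - ψ ((extChartAt (𝓡 3) c).symm b)| ≤
      κ * chartNorm h c z₀ (a - b) := by
  let L (s : ℝ) : E3 := b + s • (a - b)
  have hmem {s : ℝ} (hs : s ∈ Icc (0 : ℝ) 1) : L s ∈ Metric.ball z₀ r :=
    (convex_ball z₀ r).add_smul_sub_mem hb ha hs
  have hL (s : ℝ) : HasDerivAt L (a - b) s := by
    simpa [L] using ((hasDerivAt_id s).smul_const (a - b)).const_add b
  have hderiv (s : ℝ) (hs : s ∈ Icc (0 : ℝ) 1) :
      HasDerivAt (fun s => ψ ((extChartAt (𝓡 3) c).symm (L s)))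
        (realD ψ ((extChartAt (𝓡 3) c).symm (L s)) (chartD c (L s) (a - b))) s :=
    (hasFDerivAt_comp_chart_symm hψ.mdifferentiableAt (htarget (hmem hs))).comp_hasDerivAt s (hL s)
  have hmean := norm_image_sub_le_of_norm_deriv_le_segment_01'
    (fun s hs => (hderiv s hs).hasDerivWithinAt) fun s hs =>
      (hψ.abs_realD_le _ _).trans (hκ _ (hmem (Ico_subset_Icc_self hs)) (a - b))
  simpa [L] using hmean

end ChartNorm

section LocalApproximation

variable {S : Type*} [TopologicalSpace S] [ChartedSpace E3 S] [IsManifold (𝓡 3) ∞ S]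
  {h : C11Metric S} {ψ₀ : S → ℝ} {ε κ r : ℝ} {c : S} {z z₀ : E3}

variable (h) in
/-- Functions that are `1`-Lipschitz at scales less than `ε`, for the distance defined by the short
functions. -/
def IsLocallyShort (ε : ℝ) (ψ₀ : S → ℝ) : Prop :=
  ∀ a b δ, 0 ≤ δ → δ ≤ ε → (∀ ψ, IsShort h ψ → |ψ a - ψ b| ≤ δ) → |ψ₀ a - ψ₀ b| ≤ δ

theorem IsLocallyShort.abs_sub_le_chartNorm (hψ₀ : IsLocallyShort h ε ψ₀) (hκ0 : 0 ≤ κ)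
    (htarget : Metric.ball z₀ r ⊆ (extChartAt (𝓡 3) c).target)
    (hκ : ∀ z ∈ Metric.ball z₀ r, ∀ v, chartNorm h c z v ≤ κ * chartNorm h c z₀ v)
    {a b : E3} (ha : a ∈ Metric.ball z₀ r) (hb : b ∈ Metric.ball z₀ r)
    (hab : κ * chartNorm h c z₀ (a - b) ≤ ε) :
    |ψ₀ ((extChartAt (𝓡 3) c).symm a) - ψ₀ ((extChartAt (𝓡 3) c).symm b)| ≤
      κ * chartNorm h c z₀ (a - b) :=
  hψ₀ _ _ _ (mul_nonneg hκ0 (chartNorm_nonneg _)) hab fun _ hψ =>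
    hψ.abs_sub_le_chartNorm htarget hκ ha hb

theorem exists_ball_chartNorm_le (h : C11Metric S) (hz₀ : z₀ ∈ (extChartAt (𝓡 3) c).target)
    (hκ : 1 < κ) (hε : 0 < ε) : ∃ r > 0, Metric.ball z₀ r ⊆ (extChartAt (𝓡 3) c).target ∧
      (∀ z ∈ Metric.ball z₀ r, ∀ v, chartNorm h c z v ≤ κ * chartNorm h c z₀ v ∧
        chartNorm h c z₀ v ≤ κ * chartNorm h c z v) ∧
      ∀ a ∈ Metric.ball z₀ r, ∀ b ∈ Metric.ball z₀ r, κ * chartNorm h c z₀ (a - b) ≤ ε := by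
  have hcomp := eventually_norm_le_mul (Q := chartNorm h c) (continuousAt_chartNorm h hz₀)
    (fun z a v => chartNorm_smul a v) (fun v hv => chartNorm_pos hz₀ hv) hκ
  obtain ⟨r₁, hr₁, hball₁⟩ := Metric.eventually_nhds_iff_ball.1
    (hcomp.and ((isOpen_extChartAt_target c).mem_nhds hz₀))
  have hsmall : ∀ᶠ w in 𝓝 (0 : E3), κ * chartNorm h c z₀ w < ε := by
    have hzero : chartNorm h c z₀ 0 = 0 := by simpa using chartNorm_smul (h := h) 0 (0 : E3)
    have hcont : Continuous fun w => κ * chartNorm h c z₀ w :=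
      continuous_const.mul (continuous_chartNorm_apply h hz₀)
    exact (hcont.tendsto 0).eventually_lt_const (by rwa [hzero, mul_zero])
  obtain ⟨r₂, hr₂, hball₂⟩ := Metric.eventually_nhds_iff.1 hsmall
  have hsub {z : E3} (hz : z ∈ Metric.ball z₀ (min r₁ (r₂ / 2))) : z ∈ Metric.ball z₀ r₁ :=
    Metric.ball_subset_ball (min_le_left _ _) hz
  refine ⟨min r₁ (r₂ / 2), by positivity, fun z hz => (hball₁ z (hsub hz)).2,
    fun z hz => (hball₁ z (hsub hz)).1, fun a ha b hb => (hball₂ ?_).le⟩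
  calc dist (a - b) 0 = dist a b := by rw [dist_zero_right, dist_eq_norm]
    _ ≤ dist a z₀ + dist b z₀ := dist_triangle_right a b z₀
    _ < r₂ / 2 + r₂ / 2 := add_lt_add ((Metric.mem_ball.1 ha).trans_le (min_le_right _ _))
        ((Metric.mem_ball.1 hb).trans_le (min_le_right _ _))
    _ = r₂ := add_halves r₂

theorem realD_chartD_eq {F : S → ℝ} {f : E3 → ℝ} (hz : z ∈ (extChartAt (𝓡 3) c).target)
    (hF : MDifferentiableAt (𝓡 3) 𝓘(ℝ, ℝ) F ((extChartAt (𝓡 3) c).symm z))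
    (hFf : F =ᶠ[𝓝 ((extChartAt (𝓡 3) c).symm z)] fun x => f (extChartAt (𝓡 3) c x)) (w : E3) :
    realD F ((extChartAt (𝓡 3) c).symm z) (chartD c z w) = fderiv ℝ f z w := by
  have heq : f =ᶠ[𝓝 z] fun z => F ((extChartAt (𝓡 3) c).symm z) := by
    filter_upwards [(isOpen_extChartAt_target c).mem_nhds hz,
      (mdifferentiableAt_chart_symm hz).continuousAt.eventually hFf] with z' hz' hFz'
    rw [hFz', (extChartAt (𝓡 3) c).right_inv hz']
  exact (congrArg (fun T : E3 →L[ℝ] ℝ => T w)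
    ((hasFDerivAt_comp_chart_symm hF hz).congr_of_eventuallyEq heq).fderiv).symm

theorem abs_realD_le_of_chart {F : S → ℝ} {f : E3 → ℝ} {L : ℝ}
    (hz : z ∈ (extChartAt (𝓡 3) c).target)
    (hF : MDifferentiableAt (𝓡 3) 𝓘(ℝ, ℝ) F ((extChartAt (𝓡 3) c).symm z))
    (hFf : F =ᶠ[𝓝 ((extChartAt (𝓡 3) c).symm z)] fun x => f (extChartAt (𝓡 3) c x))
    (hle : ∀ w, |fderiv ℝ f z w| ≤ L * chartNorm h c z w)
    (v : TangentSpace (𝓡 3) ((extChartAt (𝓡 3) c).symm z)) :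
    |realD F ((extChartAt (𝓡 3) c).symm z) v| ≤ L * tangentNorm h _ v := by
  obtain ⟨e, he⟩ := exists_equiv_eq_chartD hz
  obtain ⟨w, rfl⟩ : ∃ w, chartD c z w = v := ⟨e.symm v, (he _).symm.trans (e.apply_symm_apply v)⟩
  rw [realD_chartD_eq hz hF hFf]
  exact hle w

variable [T2Space S]

theorem IsLocallyShort.exists_approx_near (hψ₀ : IsLocallyShort h ε ψ₀) (hε : 0 < ε) (c : S)
    (hκ : 1 < κ) : ∃ O ∈ 𝓝 c, ∀ ξ > 0, ∃ F : S → ℝ, ContMDiff (𝓡 3) 𝓘(ℝ, ℝ) ∞ F ∧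
      ∀ x ∈ O, |F x - ψ₀ x| ≤ ξ ∧ ∀ v, |realD F x v| ≤ κ ^ 2 * tangentNorm h x v := by
  set φ := extChartAt (𝓡 3) c
  have hz₀ : φ c ∈ φ.target := mem_extChartAt_target c
  have hκ0 : 0 ≤ κ := by linarith
  obtain ⟨r, hr, htarget, hcomp, hsmall⟩ := exists_ball_chartNorm_le h hz₀ hκ hε
  let N (v : E3) : ℝ := κ * chartNorm h c (φ c) v
  have hN : Continuous N := continuous_const.mul (continuous_chartNorm_apply h hz₀)
  have hNsmul (a : ℝ) (v : E3) : N (a • v) = |a| * N v := by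
    simp only [N, chartNorm_smul, mul_left_comm]
  have hNnonneg (v : E3) : 0 ≤ N v := mul_nonneg hκ0 (chartNorm_nonneg v)
  have hlip : ∀ a ∈ Metric.ball (φ c) r, ∀ b ∈ Metric.ball (φ c) r,
      |ψ₀ (φ.symm a) - ψ₀ (φ.symm b)| ≤ N (a - b) := fun a ha b hb =>
    hψ₀.abs_sub_le_chartNorm hκ0 htarget (fun z hz v => (hcomp z hz v).1) ha hb (hsmall a ha b hb)
  obtain ⟨O, hO, hext⟩ := exists_nhds_contMDiff_eventuallyEq_chart c
  have hO' : O ∩ φ.source ∩ φ ⁻¹' Metric.ball (φ c) (r / 2) ∈ 𝓝 c :=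
    inter_mem (inter_mem hO (extChartAt_source_mem_nhds c))
      ((continuousAt_extChartAt c).preimage_mem_nhds (Metric.ball_mem_nhds _ (half_pos hr)))
  refine ⟨_, hO', fun ξ hξ => ?_⟩
  obtain ⟨f, hf, hfψ₀, hflip⟩ :=
    exists_contDiff_approx hN (by simpa using hNsmul 0 0) hr hlip hξ
  obtain ⟨F, hF, hFf⟩ := hext f hf
  refine ⟨F, hF, ?_⟩
  rintro x ⟨⟨hxO, hxs⟩, hxb : φ x ∈ Metric.ball (φ c) (r / 2)⟩
  obtain ⟨z, hz, rfl⟩ : ∃ z ∈ φ.target, φ.symm z = x := ⟨φ x, φ.map_source hxs, φ.left_inv hxs⟩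
  rw [φ.right_inv hz] at hxb
  refine ⟨?_, abs_realD_le_of_chart hz (hF.mdifferentiableAt (by simp)) (hFf _ hxO) fun w => ?_⟩
  · rw [(hFf _ hxO).eq_of_nhds, φ.right_inv hz]
    exact hfψ₀ z hxb
  · calc |fderiv ℝ f z w| ≤ κ * chartNorm h c (φ c) w := abs_fderiv_le hNsmul hNnonneg
          (Metric.isOpen_ball.mem_nhds hxb) (hf.differentiable (by simp) z) hflip w
      _ ≤ κ * (κ * chartNorm h c z w) := by
        gcongr
        exact (hcomp z (Metric.ball_subset_ball (by linarith) hxb) w).2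
      _ = κ ^ 2 * chartNorm h c z w := by ring

end LocalApproximation

section Gluing

variable {S : Type*} [TopologicalSpace S] [ChartedSpace E3 S]

theorem realD_sum {ι : Type*} (s : Finset ι) {f : ι → S → ℝ} {x : S}
    (hf : ∀ i, MDifferentiableAt (𝓡 3) 𝓘(ℝ, ℝ) (f i) x) (v : TangentSpace (𝓡 3) x) :
    realD (fun y => ∑ i ∈ s, f i y) x v = ∑ i ∈ s, realD (f i) x v := by
  let f' (i : ι) : TangentSpace (𝓡 3) x →L[ℝ] ℝ := realD (f i) x
  have hsum : HasMFDerivAt (𝓡 3) 𝓘(ℝ, ℝ) (fun y => ∑ i ∈ s, f i y) x (∑ i ∈ s, f' i) :=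
    ⟨tendsto_finsetSum s fun i _ => (hf i).continuousAt,
      HasFDerivWithinAt.fun_sum fun i _ => (hf i).hasMFDerivAt.2⟩
  exact (congrArg (fun T : E3 →L[ℝ] ℝ => T v) hsum.mfderiv).trans (_root_.sum_apply s f' v)

variable {ι : Type*} [Fintype ι] {χ F : ι → S → ℝ} {x : S} {v : TangentSpace (𝓡 3) x}

theorem realD_sum_mul (hχ : ∀ i, MDifferentiableAt (𝓡 3) 𝓘(ℝ, ℝ) (χ i) x)
    (hF : ∀ i, MDifferentiableAt (𝓡 3) 𝓘(ℝ, ℝ) (F i) x) (hχ1 : ∀ y, ∑ i, χ i y = 1) (a : ℝ) :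
    realD (fun y => ∑ i, χ i y * F i y) x v =
      ∑ i, (χ i x * realD (F i) x v + (F i x - a) * realD (χ i) x v) := by
  have hzero : ∑ i, realD (χ i) x v = 0 := by
    rw [← realD_sum _ hχ, funext hχ1, realD_const]
  rw [realD_sum (f := fun i y => χ i y * F i y) _ fun i => (hχ i).mul (hF i),
    Finset.sum_add_distrib]
  simp only [realD_mul (hχ _) (hF _), sub_mul, Finset.sum_sub_distrib, ← Finset.mul_sum, hzero,
    Finset.sum_add_distrib, mul_zero, sub_zero]

theorem abs_realD_sum_mul_le (hχ : ∀ i, MDifferentiableAt (𝓡 3) 𝓘(ℝ, ℝ) (χ i) x)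
    (hF : ∀ i, MDifferentiableAt (𝓡 3) 𝓘(ℝ, ℝ) (F i) x) (hχ0 : ∀ i, 0 ≤ χ i x)
    (hχ1 : ∀ y, ∑ i, χ i y = 1) {C : ι → ℝ} (hC : ∀ i, |realD (χ i) x v| ≤ C i) {a ξ K : ℝ}
    (hξ : 0 ≤ ξ)
    (hFa : ∀ i, x ∈ tsupport (χ i) → |F i x - a| ≤ ξ ∧ |realD (F i) x v| ≤ K) :
    |realD (fun y => ∑ i, χ i y * F i y) x v| ≤ K + ξ * ∑ i, C i := by
  rw [realD_sum_mul hχ hF hχ1 a]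
  calc _ ≤ ∑ i, |χ i x * realD (F i) x v + (F i x - a) * realD (χ i) x v| :=
        Finset.abs_sum_le_sum_abs _ _
    _ ≤ ∑ i, (χ i x * K + ξ * C i) := by
        refine Finset.sum_le_sum fun i _ => ?_
        by_cases hx : x ∈ tsupport (χ i)
        · refine (abs_add_le _ _).trans ?_
          rw [abs_mul, abs_mul, abs_of_nonneg (hχ0 i)]
          exact add_le_add (mul_le_mul_of_nonneg_left (hFa i hx).2 (hχ0 i))
            (mul_le_mul (hFa i hx).1 (hC i) (abs_nonneg _) hξ)
        · have heq : χ i =ᶠ[𝓝 x] fun _ => 0 := notMem_tsupport_iff_eventuallyEq.1 hx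
          rw [heq.eq_of_nhds, realD_congr heq, realD_const]
          simpa using mul_nonneg hξ ((abs_nonneg _).trans (hC i))
    _ = K + ξ * ∑ i, C i := by
        rw [Finset.sum_add_distrib, ← Finset.sum_mul, hχ1, one_mul, ← Finset.mul_sum]

end Gluing

section Smoothing

variable {S : Type*} [TopologicalSpace S] [ChartedSpace E3 S] [IsManifold (𝓡 3) ∞ S]
  [T2Space S] [CompactSpace S] {h : C11Metric S} {ψ₀ : S → ℝ} {ε η : ℝ}

theorem exists_finite_smoothPartitionOfUnity {O : S → Set S} (hO : ∀ c, O c ∈ 𝓝 c) :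
    ∃ (t : Finset S) (χ : SmoothPartitionOfUnity t (𝓡 3) S univ),
      ∀ c, tsupport (χ c) ⊆ O c := by
  obtain ⟨t, ht⟩ := CompactSpace.elim_nhds_subcover (fun c => interior (O c))
    fun c => interior_mem_nhds.2 (hO c)
  obtain ⟨χ, hχ⟩ := SmoothPartitionOfUnity.exists_isSubordinate (𝓡 3) isClosed_univ
    (fun c : t => interior (O c)) (fun _ => isOpen_interior)
    (ht.ge.trans (iUnion_subtype (· ∈ t) fun c => interior (O c)).ge)
  exact ⟨t, χ, fun c => (hχ c).trans interior_subset⟩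

theorem IsLocallyShort.exists_approx (hψ₀ : IsLocallyShort h ε ψ₀) (hε : 0 < ε) (hη : 0 < η) :
    ∃ f : S → ℝ, ContMDiff (𝓡 3) 𝓘(ℝ, ℝ) ∞ f ∧ (∀ x, |f x - ψ₀ x| ≤ η) ∧
      ∀ x v, |realD f x v| ≤ (1 + η) * tangentNorm h x v := by
  obtain ⟨κ, hκ, hκη⟩ : ∃ κ : ℝ, 1 < κ ∧ κ ^ 2 ≤ 1 + η / 2 := by
    refine ⟨√(1 + η / 2), ?_, (Real.sq_sqrt (by positivity)).le⟩
    rw [Real.lt_sqrt one_pos.le]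
    linarith
  choose O hO hnear using fun c => hψ₀.exists_approx_near hε c hκ
  obtain ⟨t, χ, hχO⟩ := exists_finite_smoothPartitionOfUnity hO
  have hχ1 (x : S) : ∑ c, χ c x = 1 := by
    rw [← finsum_eq_sum_of_fintype]
    exact χ.sum_eq_one (mem_univ x)
  choose C hC hχC using fun c => exists_pos_abs_realD_le h (χ c).contMDiff
  have hCsum : 0 ≤ ∑ c, C c := Finset.sum_nonneg fun c _ => (hC c).le
  -- The partition is chosen before `ξ`, so that `ξ` can compensate for its derivatives.
  obtain ⟨ξ, hξ, hξη, hξC⟩ : ∃ ξ > 0, ξ ≤ η ∧ ξ * ∑ c, C c ≤ η / 2 := by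
    refine ⟨min η (η / 2 / (∑ c, C c + 1)), by positivity, min_le_left _ _, ?_⟩
    calc _ ≤ η / 2 / (∑ c, C c + 1) * (∑ c, C c + 1) := by
          gcongr
          · exact min_le_right _ _
          · linarith
      _ = η / 2 := div_mul_cancel₀ _ (by positivity)
  choose F hF hFψ₀ using fun c : t => hnear c ξ hξ
  refine ⟨fun x => ∑ c, χ c x * F c x,
    contMDiff_finsetSum fun c _ => (χ c).contMDiff.mul (hF c), fun x => ?_, fun x v => ?_⟩
  · have hball : ∑ᶠ c, χ c x • F c x ∈ Metric.closedBall (ψ₀ x) ξ :=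
      χ.finsum_smul_mem_convex (mem_univ x)
        (fun c hc => (hFψ₀ c x (hχO c (subset_tsupport _ hc))).1) (convex_closedBall _ _)
    rw [finsum_eq_sum_of_fintype] at hball
    exact (Metric.mem_closedBall.1 hball).trans hξη
  · calc _ ≤ κ ^ 2 * tangentNorm h x v + ξ * ∑ c, C c * tangentNorm h x v :=
          abs_realD_sum_mul_le (fun c => (χ c).contMDiff.mdifferentiableAt (by simp))
            (fun c => (hF c).mdifferentiableAt (by simp)) (fun c => χ.nonneg c x) hχ1
            (fun c => hχC c x v) hξ.le fun c hx =>
              ⟨(hFψ₀ c x (hχO c hx)).1, (hFψ₀ c x (hχO c hx)).2 v⟩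
      _ = (κ ^ 2 + ξ * ∑ c, C c) * tangentNorm h x v := by rw [← Finset.sum_mul]; ring
      _ ≤ (1 + η) * tangentNorm h x v :=
          mul_le_mul_of_nonneg_right (by linarith) (tangentNorm_nonneg x v)

end Smoothing

section Chains

variable {S : Type*} {ε : ℝ} {x y : S}

theorem abs_sub_le_of_jump {γ : ℝ → S} {ψ : S → ℝ} {x' : S} {c δ s : ℝ}
    (hγ : ∀ s, c ≤ s → γ s = x) (hγx : |ψ (γ s) - ψ x| ≤ max (c - s) 0 + ε)
    (hδε : δ ≤ ε) (hjump : |ψ x - ψ x'| ≤ δ) (hs : s < c + δ) :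
    |ψ (γ s) - ψ x'| ≤ c + δ - s + ε := by
  rcases lt_or_ge s c with hsc | hsc
  · rw [max_eq_left (by linarith)] at hγx
    linarith [abs_sub_le (ψ (γ s)) (ψ x) (ψ x')]
  · rw [hγ s hsc]
    linarith

variable [TopologicalSpace S] [ChartedSpace E3 S] [IsManifold (𝓡 3) ∞ S] {h : C11Metric S}

variable (h) in
/-- `Chain h ε y x c`: the point `x` can be reached from `y` by jumps of size at most `ε` and of
total size `c`, the size of a jump being an upper bound on the increments of the short functions. -/
inductive Chain (ε : ℝ) (y : S) : S → ℝ → Prop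
  | refl : Chain ε y y 0
  | step {x x' : S} {c δ : ℝ} : Chain ε y x c → 0 ≤ δ → δ ≤ ε →
      (∀ ψ, IsShort h ψ → |ψ x - ψ x'| ≤ δ) → Chain ε y x' (c + δ)

theorem Chain.nonneg {c : ℝ} (hc : Chain h ε y x c) : 0 ≤ c := by
  induction hc with
  | refl => exact le_rfl
  | step _ hδ _ _ ih => exact add_nonneg ih hδ

theorem Chain.exists_stepFun (hε : 0 ≤ ε) {c : ℝ} (hc : Chain h ε y x c) : ∃ γ : ℝ → S,
    (∀ s < 0, γ s = y) ∧ (∀ s, c ≤ s → γ s = x) ∧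
      (∀ ψ, IsShort h ψ → ∀ s, |ψ (γ s) - ψ x| ≤ max (c - s) 0 + ε) ∧
      ∀ ψ, IsShort h ψ → ∀ s t, |ψ (γ s) - ψ (γ t)| ≤ |s - t| + 2 * ε := by
  induction hc with
  | refl =>
    refine ⟨fun _ => y, fun _ _ => rfl, fun _ _ => rfl, fun ψ _ s => ?_, fun ψ _ s t => ?_⟩
    all_goals
      rw [sub_self, abs_zero]
      positivity
  | @step x x' c δ hch hδ hδε hjump ih =>
    obtain ⟨γ, hneg, hge, hx, hlip⟩ := ih
    have hc := hch.nonneg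
    have hx' {ψ : S → ℝ} (hψ : IsShort h ψ) {s : ℝ} (hs : s < c + δ) :
        |ψ (γ s) - ψ x'| ≤ c + δ - s + ε :=
      abs_sub_le_of_jump hge (hx ψ hψ s) hδε (hjump ψ hψ) hs
    refine ⟨fun s => if s < c + δ then γ s else x',
      fun s hs => (if_pos (by linarith)).trans (hneg s hs), fun s hs => if_neg hs.not_gt,
      fun ψ hψ s => ?_, fun ψ hψ s t => ?_⟩
    · beta_reduce
      split_ifs with hs
      · exact (hx' hψ hs).trans (add_le_add_left (le_max_left _ _) _)
      · rw [sub_self, abs_zero]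
        positivity
    · beta_reduce
      split_ifs with hs ht ht
      · exact hlip ψ hψ s t
      · linarith [hx' hψ hs, neg_abs_le (s - t)]
      · rw [abs_sub_comm]
        linarith [hx' hψ ht, le_abs_self (s - t)]
      · rw [sub_self, abs_zero]
        positivity

/-- The least total size of a chain, cut off at `R`. -/
def chainDist (h : C11Metric S) (ε R : ℝ) (y x : S) : ℝ :=
  sInf {c | Chain h ε y x c ∨ c = R}

theorem bddBelow_chain (R : ℝ) : BddBelow {c | Chain h ε y x c ∨ c = R} := by
  refine ⟨min 0 R, ?_⟩
  rintro c (hc | rfl)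
  · exact (min_le_left _ _).trans hc.nonneg
  · exact min_le_right _ _

theorem chainDist_sub_le {R δ : ℝ} {a b : S} (hδ : 0 ≤ δ) (hδε : δ ≤ ε)
    (hab : ∀ ψ, IsShort h ψ → |ψ a - ψ b| ≤ δ) :
    chainDist h ε R y b - chainDist h ε R y a ≤ δ := by
  rw [sub_le_comm]
  refine le_csInf ⟨R, .inr rfl⟩ ?_
  rintro c (hc | rfl)
  · exact sub_le_iff_le_add.2 (csInf_le (bddBelow_chain R) (.inl (hc.step hδ hδε hab)))
  · exact sub_le_iff_le_add.2
      ((csInf_le (bddBelow_chain c) (.inr rfl)).trans (le_add_of_nonneg_right hδ))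

theorem isLocallyShort_chainDist (R : ℝ) : IsLocallyShort h ε (chainDist h ε R y) :=
  fun a b _ hδ hδε hab => abs_sub_le_iff.2
    ⟨chainDist_sub_le hδ hδε fun ψ hψ => abs_sub_comm (ψ a) (ψ b) ▸ hab ψ hψ,
      chainDist_sub_le hδ hδε hab⟩

variable [T2Space S] [CompactSpace S] {T : ℝ}

theorem exists_chain (hT : 0 ≤ T) (hε : 0 < ε) (hxy : ∀ ψ, IsShort h ψ → |ψ x - ψ y| ≤ T) :
    ∃ c < T + ε, Chain h ε y x c := by
  set ρ := chainDist h ε (T + ε) y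
  obtain ⟨η, hη, hηε⟩ : ∃ η > 0, η * (T + 2) < ε := by
    refine ⟨ε / (T + 3), by positivity, ?_⟩
    rw [div_mul_eq_mul_div, div_lt_iff₀ (by positivity)]
    exact mul_lt_mul_of_pos_left (by linarith) hε
  obtain ⟨f, hf, hfρ, hfd⟩ :=
    (isLocallyShort_chainDist (h := h) (y := y) (T + ε)).exists_approx hε hη
  have hshort : IsShort h fun z => (1 + η)⁻¹ * f z := by
    refine .of_abs_le (contMDiff_const.mul hf) fun z v => ?_
    rw [realD_const_mul _ (hf.mdifferentiableAt (by simp)), abs_mul, abs_of_pos (by positivity),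
      inv_mul_le_iff₀ (by positivity)]
    exact hfd z v
  have hfT : |f x - f y| ≤ (1 + η) * T := by
    have hle := hxy _ hshort
    rwa [← mul_sub, abs_mul, abs_of_pos (by positivity), inv_mul_le_iff₀ (by positivity)] at hle
  have hy : ρ y ≤ 0 := csInf_le (bddBelow_chain _) (.inl .refl)
  have hx : ρ x < T + ε := by
    linarith [(abs_le.1 (hfρ x)).1, (abs_le.1 (hfρ y)).2, (abs_le.1 hfT).2]
  obtain ⟨c, hc | rfl, hcT⟩ := (csInf_lt_iff (bddBelow_chain _) ⟨_, .inr rfl⟩).1 hx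
  · exact ⟨c, hcT, hc⟩
  · exact absurd hcT (lt_irrefl _)

theorem exists_almost_isShortCurve (hT : 0 < T) (hε : 0 < ε)
    (hxy : ∀ ψ, IsShort h ψ → |ψ x - ψ y| ≤ T) : ∃ γ : ℝ → S, γ 0 = y ∧ γ T = x ∧
      ∀ ψ, IsShort h ψ → ∀ s t, |ψ (γ s) - ψ (γ t)| ≤ |s - t| + 4 * ε := by
  obtain ⟨c, hcT, hc⟩ := exists_chain hT.le hε hxy
  obtain ⟨γ, hneg, hge, -, hlip⟩ := hc.exists_stepFun hε.le
  let σ (s : ℝ) : ℝ := if s ≤ 0 then s - ε else s + ε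
  have hσlip (s t : ℝ) : |σ s - σ t| ≤ |s - t| + 2 * ε := by
    have hle := le_abs_self (s - t)
    have hge := neg_abs_le (s - t)
    simp only [σ]
    split_ifs <;> rw [abs_le] <;> constructor <;> linarith
  refine ⟨γ ∘ σ, hneg _ (by simp [σ, hε]), hge _ (by simpa [σ, hT.not_ge] using hcT.le),
    fun ψ hψ s t => ?_⟩
  calc |ψ (γ (σ s)) - ψ (γ (σ t))| ≤ |σ s - σ t| + 2 * ε := hlip ψ hψ (σ s) (σ t)
    _ ≤ |s - t| + 2 * ε + 2 * ε := by gcongr; exact hσlip s t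
    _ = |s - t| + 4 * ε := by ring

theorem exists_isShortCurve (hT : 0 < T) (hxy : ∀ ψ, IsShort h ψ → |ψ x - ψ y| ≤ T) :
    ∃ γ : ℝ → S, IsShortCurve h γ ∧ γ 0 = y ∧ γ T = x := by
  -- By Tychonoff, the sets of almost short curves are compact in the product `ℝ → S`.
  let K (n : ℕ) : Set (ℝ → S) := {γ | γ 0 = y ∧ γ T = x ∧
    ∀ ψ, IsShort h ψ → ∀ s t, |ψ (γ s) - ψ (γ t)| ≤ |s - t| + 1 / ((n : ℝ) + 1)}
  have hclosed (n : ℕ) : IsClosed (K n) := by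
    simp only [K, ofPred_and, ofPred_forall]
    refine (isClosed_eq (continuous_apply 0) continuous_const).inter
      ((isClosed_eq (continuous_apply T) continuous_const).inter ?_)
    refine isClosed_iInter fun ψ => isClosed_iInter fun hψ => isClosed_iInter fun s =>
      isClosed_iInter fun t => isClosed_le ?_ continuous_const
    have hcont := hψ.contMDiff.continuous
    fun_prop
  have hanti (n : ℕ) : K (n + 1) ⊆ K n := fun γ ⟨h0, hT, hlip⟩ =>
    ⟨h0, hT, fun ψ hψ s t => (hlip ψ hψ s t).trans (by gcongr; simp)⟩
  have hnonempty (n : ℕ) : (K n).Nonempty := by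
    obtain ⟨γ, h0, hT, hlip⟩ :=
      exists_almost_isShortCurve hT (ε := 1 / ((n : ℝ) + 1) / 4) (by positivity) hxy
    exact ⟨γ, h0, hT, fun ψ hψ s t => (hlip ψ hψ s t).trans_eq (by ring)⟩
  obtain ⟨γ, hγ⟩ := IsCompact.nonempty_iInter_of_sequence_nonempty_isCompact_isClosed K hanti
    hnonempty (hclosed 0).isCompact hclosed
  rw [mem_iInter] at hγ
  refine ⟨γ, fun ψ hψ s t => ?_, (hγ 0).1, (hγ 0).2.1⟩
  have hlim : Tendsto (fun n : ℕ => |s - t| + 1 / ((n : ℝ) + 1)) atTop (𝓝 |s - t|) := by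
    simpa using tendsto_one_div_add_atTop_nhds_zero_nat.const_add |s - t|
  exact ge_of_tendsto' hlim fun n => (hγ n).2.2 ψ hψ s t

theorem mem_causalFuture_of_forall_isShort {p q : ℝ × S} (hpq : q.1 < p.1)
    (hle : ∀ ψ, IsShort h ψ → |ψ p.2 - ψ q.2| ≤ p.1 - q.1) : p ∈ causalFuture h q := by
  obtain ⟨γ, hγ, h0, hT⟩ := exists_isShortCurve (sub_pos.2 hpq) hle
  refine .inr ⟨_, 0, p.1 - q.1, sub_pos.2 hpq, hγ.isFutureCausal q.1 0 (p.1 - q.1), ?_, ?_⟩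
  · simp [h0]
  · simp [hT]

theorem exists_isShort_of_notMem_causalJ {p q : ℝ × S} (hpq : p ∉ causalJ h q) :
    ∃ ψ, IsShort h ψ ∧ |p.1 - q.1| < ψ p.2 - ψ q.2 := by
  by_contra! hcon
  have hle (ψ : S → ℝ) (hψ : IsShort h ψ) : |ψ p.2 - ψ q.2| ≤ |p.1 - q.1| := by
    refine abs_le'.2 ⟨hcon ψ hψ, ?_⟩
    linarith [hcon _ hψ.neg]
  refine hpq ?_
  rcases lt_trichotomy p.1 q.1 with hlt | heq | hgt
  · refine .inr (mem_causalFuture_of_forall_isShort hlt fun ψ hψ => ?_)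
    rw [abs_sub_comm, ← abs_of_pos (sub_pos.2 hlt), abs_sub_comm q.1]
    exact hle ψ hψ
  · refine .inl (.inl (Prod.ext heq ?_))
    by_contra hne
    obtain ⟨ψ, hψ, hψne⟩ := exists_isShort_ne h hne
    have hzero := hle ψ hψ
    rw [heq, sub_self, abs_zero, abs_nonpos_iff, sub_eq_zero] at hzero
    exact hψne hzero
  · refine .inl (mem_causalFuture_of_forall_isShort hgt fun ψ hψ => ?_)
    rw [← abs_of_pos (sub_pos.2 hgt)]
    exact hle ψ hψ

end Chains

end Ultrastatic

end

theorem lemma5p1 {S : Type*} [TopologicalSpace S] [ChartedSpace Ultrastatic.E3 S]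
    [IsManifold (𝓡 3) ∞ S] [T2Space S] [CompactSpace S] [MeasurableSpace S] [BorelSpace S]
    (h : Ultrastatic.C11Metric S) {m : ℝ} (hm : 0 < m)
    {ι : Type*} (b : HilbertBasis ι ℂ (Ultrastatic.L2 h))
    (p q : ℝ × S) (hpq : p ∉ Ultrastatic.causalJ h q) :
    (p, q) ∉ Ultrastatic.distSupport (Ultrastatic.IM.prod Ultrastatic.IM)
      (Ultrastatic.causalKernel h hm b) := by
  obtain ⟨ψ, hψ, hlt⟩ := Ultrastatic.exists_isShort_of_notMem_causalJ hpq
  exact Ultrastatic.notMem_distSupport_of_isShort b hψ hlt
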